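/- Let $f$ be continuous in the closed half-plane $\operatorname{Re} z\ge 0$ and holomorphic in $\operatorname{Re} z>0$, and write $f_N=f(N+\tfrac12)$ for $N=0,1,2,\dots$. Assume: (a) $f$ has order at most one in $\operatorname{Re} z\ge 0$, i.e. $\limsup_{r\to\infty}\frac{\log^+\log^+ M(r)}{\log r}\le 1$, where $M(r)=\max\{|f(z)|:|z|=r,\ \operatorname{Re}z\ge 0\}$ and $\log^+ t=\max(0,\log t)$ (this holds in particular if $f$ is of exponential type, $|f(z)|\le A e^{B|z|}$); (b) (Carlson's bound) for some real $b<\pi$, the indicator $h_f(\theta)=\limsup_{r\to\infty}\frac{\log|f(re^{i\theta})|}{r}$ satisfies $h_f(\theta)\le b|\sin\theta|$ for $-\frac\pi2\le\theta\le\frac\pi2$ (with $\log 0=-\infty$); (c) the function $y\mapsto f(iy)$ belongs to $L^2(-\infty,+\infty)$; (d) $\sum_{N=1}^\infty \frac{|f_N|}{N}<\infty$. Let $P_n(z)=i^n\,{}_2F_1(-n,\tfrac12+iz;1;2)$ be the Meixner–Pollaczek polynomials with $\alpha=\tfrac12$, and let $\psi_n(y)=\frac1{\sqrt\pi}\,\Gamma(\tfrac12+iy)\,P_n(y)$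 for $n\ge 0$, $y\in\mathbb R$. Then the functions $\psi_n$ form an orthonormal basis of $L^2(-\infty,+\infty)$; for every $n\ge0$ the series $$c_n=2\sqrt\pi\sum_{N=0}^\infty\frac{(-1)^N}{N!}\,f_N\,P_n\!\left[-i\left(N+\tfrac12\right)\right]$$ converges absolutely; $f(iy)=\sum_{n=0}^\infty c_n\psi_n(y)$ with convergence in $L^2(-\infty,+\infty)$; and for every real $x>-\frac12$ $$f\!\left(x+\tfrac12\right)=\sum_{N=0}^\infty f_N\,\operatorname{sinc}(x-N)-\frac{\sin\pi x}{2\pi}\int_{-\infty}^{+\infty}\frac{\sum_{n=0}^\infty c_n\psi_n(y)}{(x+\frac12-iy)\cosh\pi y}\,dy,$$ where $\operatorname{sinc}(t)=\frac{\sin\pi t}{\pi t}$ for $t\ne0$ and $\operatorname{sinc}(0)=1$, the sum under the integral is taken in $L^2(-\infty,+\infty)$, and the series over $N$ and the integral converge absolutely. -/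

import Mathlib

open MeasureTheory Filter

noncomputable section

/-- Maximum modulus of `f` on the half-circle `|z| = r`, `Re z ≥ 0`. -/
def maxModulus (f : ℂ → ℂ) (r : ℝ) : ℝ :=
  sSup ((fun z : ℂ => ‖f z‖) '' {z : ℂ | ‖z‖ = r ∧ 0 ≤ z.re})

/-- `f` has growth order at most one in the half-plane `Re z ≥ 0`:
`limsup_{r → ∞} (log log M(r)) / log r ≤ 1`, where `M(r)` is the maximum modulus on the half-circle.
The positive part `log⁺ t = max 0 (log t)` is used so that bounded functions cause no trouble with
logarithms of nonpositive numbers. In particular every function with `|f z| ≤ A * exp (B * |z|)`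
on `Re z ≥ 0` has this property. -/
def HasOrderAtMostOne (f : ℂ → ℂ) : Prop :=
  limsup (fun r : ℝ =>
    ((Real.posLog (Real.posLog (maxModulus f r)) / Real.log r : ℝ) : EReal)) atTop ≤ 1

/-- The Phragmén–Lindelöf indicator `h_f(θ) = limsup_{r → ∞} log |f(r e^{iθ})| / r`, with values in
the extended reals and with `log 0 = -∞`. -/
def indicator (f : ℂ → ℂ) (θ : ℝ) : EReal :=
  limsup (fun r : ℝ =>
    ENNReal.log ‖f ((r : ℂ) * Complex.exp (Complex.I * (θ : ℂ)))‖ₑ / (r : EReal)) atTop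

/-- Carlson's bound with constant `b`: `h_f(θ) ≤ b |sin θ|` for `-π/2 ≤ θ ≤ π/2`. -/
def CarlsonBound (f : ℂ → ℂ) (b : ℝ) : Prop :=
  ∀ θ ∈ Set.Icc (-(Real.pi / 2)) (Real.pi / 2),
    indicator f θ ≤ ((b * |Real.sin θ| : ℝ) : EReal)

/-- The samples `f_N = f(N + 1/2)`. -/
def sample (f : ℂ → ℂ) (N : ℕ) : ℂ := f ((N : ℂ) + 1 / 2)

/-- The Meixner–Pollaczek polynomials `P_n = P_n^{(1/2)}`, at a complex argument:
`P_n(z) = i^n ₂F₁(-n, 1/2 + i z; 1; 2)` (the hypergeometric series terminates). -/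
def meixnerPollaczek (n : ℕ) (z : ℂ) : ℂ :=
  Complex.I ^ n * ordinaryHypergeometric (-(n : ℂ)) (1 / 2 + Complex.I * z) (1 : ℂ) (2 : ℂ)

/-- The functions `ψ_n(y) = π^{-1/2} Γ(1/2 + i y) P_n(y)`. -/
def psi (n : ℕ) (y : ℝ) : ℂ :=
  1 / (Real.sqrt Real.pi : ℂ) * Complex.Gamma (1 / 2 + Complex.I * (y : ℂ)) *
    meixnerPollaczek n (y : ℂ)

/-- The `N`-th term of the series for `c_n`, without the factor `2 √π`. -/
def coeffTerm (f : ℂ → ℂ) (n N : ℕ) : ℂ :=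
  (-1) ^ N / (N.factorial : ℂ) * sample f N *
    meixnerPollaczek n (-Complex.I * ((N : ℂ) + 1 / 2))

/-- `c_n = 2 √π ∑_{N ≥ 0} ((-1)^N / N!) f_N P_n(-i (N + 1/2))`. -/
def coeff (f : ℂ → ℂ) (n : ℕ) : ℂ :=
  2 * (Real.sqrt Real.pi : ℂ) * ∑' N : ℕ, coeffTerm f n N

/-- The normalized cardinal sine: `sinc 0 = 1`, `sinc t = sin (π t) / (π t)` for `t ≠ 0`. -/
def sincPi (t : ℝ) : ℝ := if t = 0 then 1 else Real.sin (Real.pi * t) / (Real.pi * t)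

end

/-!
The proof rests on one quadrature formula. On the strip `0 ≤ Re z ≤ 1` the function `cos (π z)` has
the single zero `1 / 2` and equals `± cosh (π y)` on the two boundary lines, so Cauchy's theorem
gives `∫ G(iy) / cosh (π y) dy + ∫ G(1 + iy) / cosh (π y) dy = 2 G(1/2)` (`strip_quadrature`). A
Gaussian factor makes this valid for every `G` of order less than two in the strip. Alternating the
formula over the strips `K ≤ Re z ≤ K + 1` sums the residues of `G z / cos (π z)` over the right
half-plane, provided the integrals over the lines `Re z = K` tend to zero
(`tendsto_alternating_sum_of_halfPlane`).

This decay comes from a growth estimate. In the direction of the positive axis Carlson's bound says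
that `f` grows subexponentially, and on the imaginary axis `f` is square-integrable. A primitive of
`f` is then `O(1 + |y|)` on the imaginary axis, so that the Phragmén–Lindelöf principle applies to
it, and Cauchy's estimate yields `|f z| ≤ C (1 + |z|) exp (ε Re z)` for `Re z ≥ 1` and every
`ε > 0` (`exists_norm_le_of_one_le_re`).

Since `|Γ(1/2 + iy)|² = π / cosh (π y)`, orthonormality of the `ψ_n` is orthonormality of the
polynomials `P_n` for the density `1 / cosh (π y)`. Quadrature together with Pascal's rule gives the
moments `2^(-k)` of the rising binomials `(s)_k / k!` at `s = 1/2 + iy`; hence `P_n` is orthogonal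
to `1` for `n > 0`, and the three-term recurrence carries this to all pairs. For completeness, a
function orthogonal to all `ψ_n` gives, after multiplication by the Gamma factor, an exponentially
decaying function with vanishing moments, which is zero because its positive and negative parts
have the same moment generating functions (`topologicalClosure_span_psi`).

The Fourier coefficients of `f(iy)` are residue sums: the reflection formula turns `⟨ψ_n, f(i·)⟩`
into the integral of `G(iy) / cosh (π y)` for `G z = f(z) P_n(-iz) / Γ(1/2 + z)`, and `1 / Γ`
supplies the decay to the right (`inner_psi_eq_coeff`). The interpolation formula is the residue sum
for `f(z) / (z - w)` with `w = x + 1/2`, where the pole at `w` is removed by subtracting an explicit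
function vanishing at the half-integers (`tendsto_interpolation_of_decay`). The decay it needs is
obtained by replacing `f(z)` with `exp (-δ z) f(z)`; the limit `δ → 0` is taken by dominated
convergence, using summability of `|f_N| / N` in the series (`interpolation`).
-/

/-! ### Exponentially decaying integrands and the hyperbolic secant -/

lemma integrable_one_add_abs_pow_mul_exp (m : ℕ) {c : ℝ} (hc : 0 < c) :
    Integrable (fun y : ℝ => (1 + |y|) ^ m * Real.exp (-c * |y|)) := by
  have hpos : IntegrableOn (fun y : ℝ => (1 + |y|) ^ m * Real.exp (-c * |y|)) (Set.Ioi 0) := by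
    refine integrable_of_isBigO_exp_neg (b := c / 2) (by positivity) (by fun_prop) ?_
    have h1 : (fun y : ℝ => (1 + y) ^ m) =O[atTop] fun y => Real.exp (c / 2 * y) := by
      have h2 : (fun y : ℝ => (1 + y)) =O[atTop] fun y => y := by
        refine Asymptotics.IsBigO.of_bound 2 ?_
        filter_upwards [eventually_ge_atTop 1] with y hy
        rw [Real.norm_of_nonneg (by linarith), Real.norm_of_nonneg (by linarith)]
        linarith
      refine (h2.pow m).trans ?_
      have := (isLittleO_pow_exp_pos_mul_atTop m (b := c / 2) (by positivity)).isBigO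
      simpa using this
    have h3 : (fun y : ℝ => (1 + |y|) ^ m * Real.exp (-c * |y|))
        =ᶠ[atTop] fun y => (1 + y) ^ m * Real.exp (-c * y) := by
      filter_upwards [eventually_ge_atTop 0] with y hy
      rw [abs_of_nonneg hy]
    refine (h3.trans_isBigO (h1.mul (Asymptotics.isBigO_refl _ _))).trans ?_
    refine Asymptotics.IsBigO.of_bound 1 (Eventually.of_forall fun y => ?_)
    rw [← Real.exp_add, one_mul]
    refine le_of_eq (congrArg _ (congrArg _ ?_))
    ring
  rw [← integrableOn_univ, ← Set.Iic_union_Ioi (a := (0 : ℝ))]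
  refine IntegrableOn.union ?_ hpos
  rw [integrableOn_Iic_iff_integrableOn_Iio]
  have := hpos.comp_neg
  simpa using this

lemma exp_pi_abs_le_two_mul_cosh (y : ℝ) :
    Real.exp (Real.pi * |y|) ≤ 2 * Real.cosh (Real.pi * y) := by
  rw [Real.cosh_eq]
  rcases abs_cases y with ⟨h, _⟩ | ⟨h, _⟩ <;> rw [h]
  · nlinarith [Real.exp_pos (-(Real.pi * y))]
  · rw [mul_neg]; nlinarith [Real.exp_pos (Real.pi * y)]

lemma inv_cosh_le_two_mul_exp (y : ℝ) :
    (Real.cosh (Real.pi * y))⁻¹ ≤ 2 * Real.exp (-Real.pi * |y|) := by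
  rw [neg_mul, Real.exp_neg]
  have h := exp_pi_abs_le_two_mul_cosh y
  have h1 := Real.exp_pos (Real.pi * |y|)
  have h2 := Real.cosh_pos (Real.pi * y)
  rw [← div_eq_mul_inv, inv_le_iff_one_le_mul₀ h2, div_mul_eq_mul_div, one_le_div h1]
  exact h

lemma continuous_inv_cosh : Continuous fun y : ℝ => (Real.cosh (Real.pi * y))⁻¹ :=
  Continuous.inv₀ (by fun_prop) fun y => (Real.cosh_pos _).ne'

lemma integrable_inv_cosh : Integrable fun y : ℝ => (Real.cosh (Real.pi * y))⁻¹ := by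
  refine ((integrable_one_add_abs_pow_mul_exp 0 Real.pi_pos).const_mul 2).mono'
    continuous_inv_cosh.aestronglyMeasurable (Eventually.of_forall fun y => ?_)
  rw [Real.norm_of_nonneg (inv_nonneg.2 (Real.cosh_pos _).le)]
  simpa using inv_cosh_le_two_mul_exp y

/-- The total mass of the hyperbolic secant density; `2 / π * arctan (exp (π y))` is a primitive. -/
lemma integral_inv_cosh : ∫ y : ℝ, (Real.cosh (Real.pi * y))⁻¹ = 1 := by
  have hd : ∀ y : ℝ, HasDerivAt (fun y => 2 / Real.pi * Real.arctan (Real.exp (Real.pi * y)))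
      (Real.cosh (Real.pi * y))⁻¹ y := by
    intro y
    have h1 : HasDerivAt (fun y : ℝ => Real.pi * y) Real.pi y := by
      simpa using (hasDerivAt_id y).const_mul Real.pi
    have := ((h1.exp).arctan).const_mul (2 / Real.pi)
    refine this.congr_deriv ?_
    rw [Real.cosh_eq, Real.exp_neg]
    have := Real.pi_pos
    have := Real.exp_pos (Real.pi * y)
    field_simp
    ring
  have hbot : Tendsto (fun y => 2 / Real.pi * Real.arctan (Real.exp (Real.pi * y))) atBot
      (nhds (2 / Real.pi * Real.arctan 0)) := by
    refine Tendsto.const_mul _ ((Real.continuous_arctan.tendsto 0).comp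
      (Real.tendsto_exp_atBot.comp (tendsto_id.const_mul_atBot Real.pi_pos)))
  have htop : Tendsto (fun y => 2 / Real.pi * Real.arctan (Real.exp (Real.pi * y))) atTop
      (nhds (2 / Real.pi * (Real.pi / 2))) := by
    refine Tendsto.const_mul _ ((tendsto_nhds_of_tendsto_nhdsWithin Real.tendsto_arctan_atTop).comp
      (Real.tendsto_exp_atTop.comp (tendsto_id.const_mul_atTop Real.pi_pos)))
  rw [integral_of_hasDerivAt_of_tendsto hd integrable_inv_cosh hbot htop]
  have := Real.pi_pos
  field_simp
  simp

/-! ### Quadrature on a strip -/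

lemma sinh_abs_im_le_norm_cos (z : ℂ) : Real.sinh |z.im| ≤ ‖Complex.cos z‖ := by
  have h1 : ‖Complex.exp (z * Complex.I)‖ = Real.exp (-z.im) := by
    rw [Complex.norm_exp]; simp
  have h2 : ‖Complex.exp (-z * Complex.I)‖ = Real.exp (z.im) := by
    rw [Complex.norm_exp]; simp
  have h3 : ‖Complex.cos z‖ =
      ‖Complex.exp (z * Complex.I) + Complex.exp (-z * Complex.I)‖ / 2 := by
    rw [Complex.cos, norm_div]; simp
  rw [h3, Real.sinh_eq]
  gcongr
  rcases abs_cases z.im with ⟨h, _⟩ | ⟨h, _⟩ <;> rw [h]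
  · have := norm_sub_le_norm_add (Complex.exp (-z * Complex.I)) (Complex.exp (z * Complex.I))
    rw [h1, h2, add_comm] at this
    exact this
  · have := norm_sub_le_norm_add (Complex.exp (z * Complex.I)) (Complex.exp (-z * Complex.I))
    rw [h1, h2] at this
    simpa using this

lemma cosh_le_four_mul_norm_cos {z : ℂ} (hz : 1 ≤ |z.im|) :
    Real.cosh (Real.pi * z.im) ≤ 4 * ‖Complex.cos (Real.pi * z)‖ := by
  have h := sinh_abs_im_le_norm_cos (Real.pi * z)
  have h0 : (Real.pi * z : ℂ).im = Real.pi * z.im := by simp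
  rw [h0] at h
  set t := |Real.pi * z.im| with ht
  have ht1 : 1 ≤ t := by
    rw [ht, abs_mul, abs_of_pos Real.pi_pos]
    nlinarith [Real.pi_gt_three]
  have h1 : Real.cosh (Real.pi * z.im) = Real.cosh t := by rw [ht, Real.cosh_abs]
  rw [h1]
  refine le_trans ?_ (mul_le_mul_of_nonneg_left h (by norm_num))
  rw [Real.cosh_eq, Real.sinh_eq]
  have h2 : Real.exp 1 ≤ Real.exp t := Real.exp_le_exp.2 ht1
  have h3 : Real.exp (-t) ≤ 1 := Real.exp_le_one_iff.2 (by linarith)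
  have h4 := Real.exp_one_gt_d9
  nlinarith

lemma cos_pi_mul_I (y : ℝ) : Complex.cos (Real.pi * (Complex.I * y)) = Real.cosh (Real.pi * y) := by
  rw [show (Real.pi * (Complex.I * y) : ℂ) = (Real.pi * y : ℂ) * Complex.I by ring,
    Complex.cos_mul_I]
  push_cast; rfl

lemma cos_pi_nat_add_mul_I (K : ℕ) (y : ℝ) :
    Complex.cos (Real.pi * (K + Complex.I * y)) = (-1) ^ K * Real.cosh (Real.pi * y) := by
  induction K with
  | zero => simp [cos_pi_mul_I]
  | succ K ih =>
    rw [show (Real.pi * ((K + 1 : ℕ) + Complex.I * y) : ℂ) =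
      Real.pi * (K + Complex.I * y) + Real.pi by push_cast; ring, Complex.cos_add_pi, ih]
    ring

lemma cos_pi_mul_eq_zero_iff (z : ℂ) :
    Complex.cos (Real.pi * z) = 0 ↔ ∃ k : ℤ, z = k + 1 / 2 := by
  rw [Complex.cos_eq_zero_iff]
  refine exists_congr fun k => ⟨fun h => ?_, fun h => ?_⟩
  · field_simp at h
    linear_combination h / 2
  · rw [h]; field_simp

lemma cos_pi_ne_zero_of_mem_strip {z : ℂ} (h0 : 0 ≤ z.re) (h1 : z.re ≤ 1) (hz : z ≠ 1 / 2) :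
    Complex.cos (Real.pi * z) ≠ 0 := by
  rw [Ne, cos_pi_mul_eq_zero_iff]
  rintro ⟨k, hk⟩
  have hre : z.re = k + 1 / 2 := by rw [hk]; simp
  have hk0 : k = 0 := by
    have a : (-1 : ℝ) < k := by linarith
    have b : (k : ℝ) < 1 := by linarith
    have a' : -1 < k := by exact_mod_cast a
    have b' : k < 1 := by exact_mod_cast b
    omega
  apply hz
  rw [hk, hk0]; simp

lemma hasDerivAt_cos_pi :
    HasDerivAt (fun z : ℂ => Complex.cos (Real.pi * z)) (-Real.pi) (1 / 2) := by
  have h1 : HasDerivAt (fun z : ℂ => (Real.pi * z : ℂ)) Real.pi (1 / 2) := by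
    simpa using (hasDerivAt_id (1 / 2 : ℂ)).const_mul (Real.pi : ℂ)
  convert h1.ccos using 1
  rw [show (Real.pi * (1 / 2) : ℂ) = Real.pi / 2 by ring, Complex.sin_pi_div_two]
  simp

/-- Cauchy's theorem for `(G z - G (1/2)) / cos (π z)`, whose singularity at `1/2` is removable.
Since `cos (π z)` equals `cosh (π y)` on the left and `-cosh (π y)` on the right side of the strip,
the two integrals of `G` are added, and `∫ 1 / cosh (π y) = 1` gives the constant. -/
theorem strip_quadrature_of_small {G : ℂ → ℂ}
    (hd : DifferentiableOn ℂ G {z | 0 < z.re ∧ z.re < 1})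
    (hc : ContinuousOn G {z | 0 ≤ z.re ∧ z.re ≤ 1})
    (hsmall : ∀ ε > 0, ∃ T₀ : ℝ, ∀ z : ℂ, 0 ≤ z.re → z.re ≤ 1 → T₀ ≤ |z.im| →
      ‖G z‖ ≤ ε * Real.cosh (Real.pi * z.im))
    (h0 : Integrable fun y : ℝ => G (Complex.I * y) / (Real.cosh (Real.pi * y) : ℂ))
    (h1 : Integrable fun y : ℝ => G (1 + Complex.I * y) / (Real.cosh (Real.pi * y) : ℂ)) :
    (∫ y : ℝ, G (Complex.I * y) / (Real.cosh (Real.pi * y) : ℂ)) +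
      ∫ y : ℝ, G (1 + Complex.I * y) / (Real.cosh (Real.pi * y) : ℂ) = 2 * G (1 / 2) := by
  set C : ℂ → ℂ := fun z => Complex.cos (Real.pi * z) with hC
  -- a quotient of difference quotients: this equals `(G z - G (1/2)) / C z` off the node and is
  -- holomorphic through it, because `cos (π z)` has a simple zero there
  set Φ : ℂ → ℂ := fun z => dslope G (1 / 2) z / dslope C (1 / 2) z with hΦ
  have hopen : IsOpen {z : ℂ | 0 < z.re ∧ z.re < 1} :=
    (isOpen_lt continuous_const Complex.continuous_re).inter
      (isOpen_lt Complex.continuous_re continuous_const)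
  have hmem : (1 / 2 : ℂ) ∈ {z : ℂ | 0 < z.re ∧ z.re < 1} := by
    constructor <;> norm_num
  have hnhds := hopen.mem_nhds hmem
  have hCd : Differentiable ℂ C := by
    intro z; exact (Complex.differentiable_cos _).comp z (by fun_prop)
  have hChalf : C (1 / 2) = 0 := by
    simp only [hC]
    rw [show (Real.pi * (1 / 2) : ℂ) = Real.pi / 2 by ring, Complex.cos_pi_div_two]
  have hCne : ∀ z : ℂ, 0 ≤ z.re → z.re ≤ 1 → dslope C (1 / 2) z ≠ 0 := by
    intro z hz0 hz1
    by_cases hz : z = 1 / 2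
    · rw [hz, dslope_same, hasDerivAt_cos_pi.deriv]
      exact neg_ne_zero.2 (by exact_mod_cast Real.pi_ne_zero)
    · rw [dslope_of_ne _ hz, slope_def_field, hChalf, sub_zero]
      exact div_ne_zero (cos_pi_ne_zero_of_mem_strip hz0 hz1 hz) (sub_ne_zero.2 hz)
  have hΦeq : ∀ z : ℂ, z ≠ 1 / 2 → Φ z = (G z - G (1 / 2)) / C z := by
    intro z hz
    simp only [hΦ]
    rw [dslope_of_ne _ hz, dslope_of_ne _ hz, slope_def_field, slope_def_field, hChalf, sub_zero]
    have := sub_ne_zero.2 hz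
    rw [div_div_div_cancel_right₀ this]
  have hΦd : DifferentiableOn ℂ Φ {z | 0 < z.re ∧ z.re < 1} := by
    refine DifferentiableOn.div ((Complex.differentiableOn_dslope hnhds).2 hd)
      ((Complex.differentiableOn_dslope hnhds).2 hCd.differentiableOn) ?_
    exact fun z hz => hCne z hz.1.le hz.2.le
  have hnhds' : {z : ℂ | 0 ≤ z.re ∧ z.re ≤ 1} ∈ nhds (1 / 2 : ℂ) :=
    mem_of_superset hnhds fun z hz => ⟨hz.1.le, hz.2.le⟩
  have hΦc : ContinuousOn Φ {z | 0 ≤ z.re ∧ z.re ≤ 1} := by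
    refine ContinuousOn.div ((continuousOn_dslope hnhds').2 ⟨hc, hd.differentiableAt hnhds⟩)
      ((continuousOn_dslope hnhds').2 ⟨hCd.continuous.continuousOn, hCd _⟩) ?_
    exact fun z hz => hCne z hz.1 hz.2
  have hrect : ∀ T : ℝ, 0 < T →
      (∫ x : ℝ in (0 : ℝ)..1, Φ (x + (-T : ℝ) * Complex.I)) -
        (∫ x : ℝ in (0 : ℝ)..1, Φ (x + T * Complex.I)) +
      Complex.I • (∫ y : ℝ in (-T)..T, Φ (1 + y * Complex.I)) -
      Complex.I • (∫ y : ℝ in (-T)..T, Φ (0 + y * Complex.I)) = 0 := by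
    intro T hT
    have := Complex.integral_boundary_rect_eq_zero_of_continuousOn_of_differentiableOn Φ
      (⟨0, -T⟩ : ℂ) (⟨1, T⟩ : ℂ) (hΦc.mono ?_) (hΦd.mono ?_)
    · simpa using this
    · intro z hz
      rw [Complex.mem_reProdIm] at hz
      have := hz.1
      simp only [Set.uIcc_of_le (zero_le_one (α := ℝ))] at this
      exact this
    · intro z hz
      rw [Complex.mem_reProdIm] at hz
      have := hz.1
      simpa using this
  -- the horizontal sides tend to zero
  have hhor : ∀ s : ℝ, |s| = 1 →
      Tendsto (fun T : ℝ => ∫ x : ℝ in (0 : ℝ)..1, Φ (x + (s * T : ℝ) * Complex.I)) atTop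
        (nhds 0) := by
    intro s hs
    rw [Metric.tendsto_atTop]
    intro ε hε
    obtain ⟨T₀, hT₀⟩ := hsmall (ε / 16) (by positivity)
    have hcosh : Tendsto (fun T : ℝ => Real.cosh (Real.pi * T)) atTop atTop := by
      refine tendsto_atTop_mono (fun T => ?_)
        ((Real.tendsto_exp_atTop.comp (tendsto_id.const_mul_atTop Real.pi_pos)).atTop_div_const
          (by norm_num : (0 : ℝ) < 2))
      have := exp_pi_abs_le_two_mul_cosh T
      have h2 : Real.exp (Real.pi * T) ≤ Real.exp (Real.pi * |T|) :=
        Real.exp_le_exp.2 (mul_le_mul_of_nonneg_left (le_abs_self T) Real.pi_pos.le)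
      simp only [Function.comp, id]
      linarith
    obtain ⟨T₁, hT₁⟩ := (hcosh.eventually_ge_atTop (16 * ‖G (1 / 2)‖ / ε)).exists_forall_of_atTop
    refine ⟨max (max T₀ T₁) 1, fun T hT => ?_⟩
    have hTa : T₀ ≤ T := le_trans (le_trans (le_max_left _ _) (le_max_left _ _)) hT
    have hTb : T₁ ≤ T := le_trans (le_trans (le_max_right _ _) (le_max_left _ _)) hT
    have hTc : 1 ≤ T := le_trans (le_max_right _ _) hT
    rw [dist_zero_right]
    have hb : ∀ x ∈ Set.uIoc (0 : ℝ) 1, ‖Φ (x + (s * T : ℝ) * Complex.I)‖ ≤ ε / 2 := by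
      intro x hx
      rw [Set.uIoc_of_le zero_le_one] at hx
      set z : ℂ := x + (s * T : ℝ) * Complex.I with hz
      have hre : z.re = x := by simp [hz]
      have him : z.im = s * T := by simp [hz]
      have himabs : |z.im| = T := by rw [him, abs_mul, hs, one_mul, abs_of_pos (by linarith)]
      have hzne : z ≠ 1 / 2 := by
        intro h
        have : |z.im| = 0 := by rw [h]; simp
        linarith
      have hcoshT : Real.cosh (Real.pi * z.im) = Real.cosh (Real.pi * T) := by
        rw [← Real.cosh_abs, abs_mul, himabs, abs_of_pos Real.pi_pos]
      have hGz := hT₀ z (by rw [hre]; exact hx.1.le) (by rw [hre]; exact hx.2)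
        (by rw [himabs]; exact hTa)
      have hcosz := cosh_le_four_mul_norm_cos (z := z) (by rw [himabs]; exact hTc)
      rw [hcoshT] at hGz hcosz
      have hGh : ‖G (1 / 2)‖ ≤ ε / 16 * Real.cosh (Real.pi * T) := by
        have := hT₁ T hTb
        rw [div_le_iff₀ hε] at this
        linarith
      have hpos := Real.cosh_pos (Real.pi * T)
      have hCpos : 0 < ‖C z‖ := by simp only [hC]; linarith
      rw [hΦeq z hzne, norm_div, div_le_iff₀ hCpos]
      have := norm_sub_le (G z) (G (1 / 2))
      nlinarith
    have := intervalIntegral.norm_integral_le_of_norm_le_const hb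
    simp only [sub_zero, abs_one, mul_one] at this
    linarith
  have hi : Integrable fun y : ℝ => ((Real.cosh (Real.pi * y))⁻¹ : ℂ) := by
    have := integrable_inv_cosh.ofReal (𝕜 := ℂ)
    simpa using this
  have hval : ∫ y : ℝ, ((Real.cosh (Real.pi * y))⁻¹ : ℂ) = 1 := by
    have h := integral_ofReal (f := fun y : ℝ => (Real.cosh (Real.pi * y))⁻¹) (μ := volume) (𝕜 := ℂ)
    rw [integral_inv_cosh] at h
    simpa using h
  have hne0 : ∀ y : ℝ, (Complex.I * y : ℂ) ≠ 1 / 2 := by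
    intro y h; have := congrArg Complex.re h; simp at this
  have hne1 : ∀ y : ℝ, (1 + Complex.I * y : ℂ) ≠ 1 / 2 := by
    intro y h; have := congrArg Complex.re h; norm_num at this
  have e0 : ∀ y : ℝ, Φ (0 + y * Complex.I) = G (Complex.I * y) / (Real.cosh (Real.pi * y) : ℂ) -
      G (1 / 2) * ((Real.cosh (Real.pi * y))⁻¹ : ℂ) := by
    intro y
    rw [zero_add, mul_comm (y : ℂ), hΦeq _ (hne0 y)]
    simp only [hC]
    rw [cos_pi_mul_I]
    ring
  have e1 : ∀ y : ℝ, Φ (1 + y * Complex.I) =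
      G (1 / 2) * ((Real.cosh (Real.pi * y))⁻¹ : ℂ) -
        G (1 + Complex.I * y) / (Real.cosh (Real.pi * y) : ℂ) := by
    intro y
    rw [mul_comm (y : ℂ), hΦeq _ (hne1 y)]
    simp only [hC]
    have := cos_pi_nat_add_mul_I 1 y
    rw [Nat.cast_one] at this
    rw [this]
    rw [pow_one, neg_one_mul, div_neg]
    ring
  have i0 : Integrable fun y : ℝ => Φ (0 + y * Complex.I) := by
    simp only [e0]; exact h0.sub (hi.const_mul _)
  have i1 : Integrable fun y : ℝ => Φ (1 + y * Complex.I) := by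
    simp only [e1]; exact (hi.const_mul _).sub h1
  have v0 : ∫ y : ℝ, Φ (0 + y * Complex.I) =
      (∫ y : ℝ, G (Complex.I * y) / (Real.cosh (Real.pi * y) : ℂ)) - G (1 / 2) := by
    simp only [e0]
    rw [integral_sub h0 (hi.const_mul _), integral_const_mul, hval, mul_one]
  have v1 : ∫ y : ℝ, Φ (1 + y * Complex.I) = G (1 / 2) -
      ∫ y : ℝ, G (1 + Complex.I * y) / (Real.cosh (Real.pi * y) : ℂ) := by
    simp only [e1]
    rw [integral_sub (hi.const_mul _) h1, integral_const_mul, hval, mul_one]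
  have hlim := (((hhor (-1) (by simp)).sub (hhor 1 (by simp))).add
    ((intervalIntegral_tendsto_integral i1 tendsto_neg_atTop_atBot tendsto_id).const_smul
      Complex.I)).sub
    ((intervalIntegral_tendsto_integral i0 tendsto_neg_atTop_atBot tendsto_id).const_smul Complex.I)
  have hlim0 := hlim.congr' (f₂ := fun _ => (0 : ℂ)) (by
    filter_upwards [eventually_gt_atTop 0] with T hT
    have := hrect T hT
    simpa using this)
  have := tendsto_nhds_unique hlim0 tendsto_const_nhds
  rw [v0, v1] at this
  simp only [smul_eq_mul, sub_zero, zero_add] at this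
  have h2 := mul_left_cancel₀ Complex.I_ne_zero (sub_eq_zero.1 this)
  linear_combination -h2

/-- Growth of order at most `3/2` in the vertical direction, on the strip `a ≤ Re z ≤ a + 1`.
The exponent `3/2` stands for any number in `(1, 2)`: larger than the order of the functions
considered, and small enough for a Gaussian factor to beat the growth. -/
def StripGrowth (G : ℂ → ℂ) (a : ℝ) : Prop :=
  ∃ B C : ℝ, ∀ z : ℂ, a ≤ z.re → z.re ≤ a + 1 → 1 ≤ |z.im| →
    ‖G z‖ ≤ C * Real.exp (B * |z.im| ^ (3 / 2 : ℝ))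

lemma StripGrowth.mul {G H : ℂ → ℂ} {a : ℝ} (hG : StripGrowth G a) (hH : StripGrowth H a) :
    StripGrowth (fun z => G z * H z) a := by
  obtain ⟨B, C, h⟩ := hG
  obtain ⟨B', C', h'⟩ := hH
  refine ⟨B + B', C * C', fun z h0 h1 hz => ?_⟩
  have a1 := h z h0 h1 hz
  have a2 := h' z h0 h1 hz
  rw [norm_mul, add_mul, Real.exp_add]
  calc ‖G z‖ * ‖H z‖ ≤ _ := mul_le_mul a1 a2 (norm_nonneg _) ((norm_nonneg _).trans a1)
    _ = _ := by ring

lemma StripGrowth.sub {G H : ℂ → ℂ} {a : ℝ} (hG : StripGrowth G a) (hH : StripGrowth H a) :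
    StripGrowth (fun z => G z - H z) a := by
  obtain ⟨B, C, h⟩ := hG
  obtain ⟨B', C', h'⟩ := hH
  refine ⟨max B B', |C| + |C'|, fun z h0 h1 hz => ?_⟩
  have e1 : Real.exp (B * |z.im| ^ (3 / 2 : ℝ)) ≤ Real.exp (max B B' * |z.im| ^ (3 / 2 : ℝ)) := by
    gcongr; exact le_max_left _ _
  have e2 : Real.exp (B' * |z.im| ^ (3 / 2 : ℝ)) ≤ Real.exp (max B B' * |z.im| ^ (3 / 2 : ℝ)) := by
    gcongr; exact le_max_right _ _
  have a1 : ‖G z‖ ≤ |C| * Real.exp (max B B' * |z.im| ^ (3 / 2 : ℝ)) :=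
    (h z h0 h1 hz).trans (mul_le_mul (le_abs_self C) e1 (Real.exp_pos _).le (abs_nonneg _))
  have a2 : ‖H z‖ ≤ |C'| * Real.exp (max B B' * |z.im| ^ (3 / 2 : ℝ)) :=
    (h' z h0 h1 hz).trans (mul_le_mul (le_abs_self C') e2 (Real.exp_pos _).le (abs_nonneg _))
  refine (norm_sub_le _ _).trans ?_
  rw [add_mul]
  exact add_le_add a1 a2

lemma StripGrowth.mono {G H : ℂ → ℂ} {a : ℝ} (hH : StripGrowth H a)
    (h : ∀ z : ℂ, a ≤ z.re → z.re ≤ a + 1 → 1 ≤ |z.im| → ‖G z‖ ≤ ‖H z‖) : StripGrowth G a := by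
  obtain ⟨B, C, h'⟩ := hH
  exact ⟨B, C, fun z h0 h1 hz => (h z h0 h1 hz).trans (h' z h0 h1 hz)⟩

lemma stripGrowth_const (c : ℂ) (a : ℝ) : StripGrowth (fun _ => c) a :=
  ⟨0, ‖c‖, fun z _ _ _ => by simp⟩

lemma self_le_rpow_three_half {t : ℝ} (ht : 1 ≤ t) : t ≤ t ^ (3 / 2 : ℝ) := by
  have := Real.rpow_le_rpow_of_exponent_le ht (by norm_num : (1 : ℝ) ≤ 3 / 2)
  rwa [Real.rpow_one] at this

/-- Growth of order `3/2` in the distance to the origin implies growth of order `3/2` on strips. -/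
lemma stripGrowth_of_norm_le {G : ℂ → ℂ} {a B C : ℝ} (ha : 0 ≤ a) (hB : 0 ≤ B)
    (h : ∀ z : ℂ, a ≤ z.re → z.re ≤ a + 1 → 1 ≤ |z.im| →
      ‖G z‖ ≤ C * Real.exp (B * ‖z‖ ^ (3 / 2 : ℝ))) :
    StripGrowth G a := by
  refine ⟨B * (a + 2) ^ (3 / 2 : ℝ), |C|, fun z h0 h1 hz => (h z h0 h1 hz).trans ?_⟩
  have hn : ‖z‖ ≤ (a + 2) * |z.im| := by
    have := Complex.norm_le_abs_re_add_abs_im z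
    rw [abs_of_nonneg (by linarith : 0 ≤ z.re)] at this
    nlinarith
  have : ‖z‖ ^ (3 / 2 : ℝ) ≤ (a + 2) ^ (3 / 2 : ℝ) * |z.im| ^ (3 / 2 : ℝ) := by
    rw [← Real.mul_rpow (by linarith) (abs_nonneg _)]
    exact Real.rpow_le_rpow (norm_nonneg _) hn (by norm_num)
  rw [mul_assoc]
  exact mul_le_mul (le_abs_self C) (Real.exp_le_exp.2 (mul_le_mul_of_nonneg_left this hB))
    (Real.exp_pos _).le (abs_nonneg _)

lemma stripGrowth_of_norm_le_pow {G : ℂ → ℂ} {a C : ℝ} {n : ℕ} (ha : 0 ≤ a)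
    (h : ∀ z : ℂ, a ≤ z.re → z.re ≤ a + 1 → 1 ≤ |z.im| → ‖G z‖ ≤ C * (1 + ‖z‖) ^ n) :
    StripGrowth G a := by
  refine stripGrowth_of_norm_le (B := n) (C := |C|) ha (by positivity) fun z h0 h1 hz =>
    (h z h0 h1 hz).trans ?_
  have hz1 : 1 ≤ ‖z‖ := hz.trans (Complex.abs_im_le_norm z)
  refine mul_le_mul (le_abs_self C) ?_ (by positivity) (abs_nonneg _)
  have h2 : 1 + ‖z‖ ≤ Real.exp (‖z‖ ^ (3 / 2 : ℝ)) := by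
    have := Real.add_one_le_exp (‖z‖ ^ (3 / 2 : ℝ))
    linarith [self_le_rpow_three_half hz1]
  rw [Real.exp_nat_mul]
  gcongr

lemma tendsto_exp_rpow_sub_sq (B : ℝ) {δ : ℝ} (hδ : 0 < δ) :
    Tendsto (fun t : ℝ => Real.exp (B * t ^ (3 / 2 : ℝ) - δ * t ^ 2)) atTop (nhds 0) := by
  refine Real.tendsto_exp_atBot.comp ?_
  have h1 : Tendsto (fun t : ℝ => t ^ (1 / 2 : ℝ)) atTop atTop := tendsto_rpow_atTop (by norm_num)
  have h2 : Tendsto (fun t : ℝ => t ^ (3 / 2 : ℝ)) atTop atTop := tendsto_rpow_atTop (by norm_num)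
  have h3 : Tendsto (fun t : ℝ => B + -δ * t ^ (1 / 2 : ℝ)) atTop atBot :=
    tendsto_atBot_add_const_left _ _ (h1.const_mul_atTop_of_neg (by linarith))
  refine (h2.atTop_mul_atBot₀ h3).congr' ?_
  filter_upwards [eventually_gt_atTop 0] with t ht
  have : t ^ 2 = t ^ (3 / 2 : ℝ) * t ^ (1 / 2 : ℝ) := by
    rw [← Real.rpow_add ht, ← Real.rpow_natCast]; norm_num
  rw [this]; ring

lemma norm_exp_mul_sq (δ : ℝ) (z : ℂ) :
    ‖Complex.exp (δ * (z - 1 / 2) ^ 2)‖ = Real.exp (δ * (z.re - 1 / 2) ^ 2 - δ * z.im ^ 2) := by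
  rw [Complex.norm_exp]
  congr 1
  simp [sq, Complex.mul_re]
  ring

/-- The quadrature formula on the strip `0 ≤ Re z ≤ 1`, for the density `1 / cosh (π y)` on both
boundary lines. The Gaussian factor `exp (δ (z - 1/2)^2)`, equal to `1` at the node, reduces it to
functions that are small at the ends of the strip. -/
theorem strip_quadrature {G : ℂ → ℂ}
    (hd : DifferentiableOn ℂ G {z | 0 < z.re ∧ z.re < 1})
    (hc : ContinuousOn G {z | 0 ≤ z.re ∧ z.re ≤ 1})
    (hg : StripGrowth G 0)
    (h0 : Integrable fun y : ℝ => G (Complex.I * y) / (Real.cosh (Real.pi * y) : ℂ))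
    (h1 : Integrable fun y : ℝ => G (1 + Complex.I * y) / (Real.cosh (Real.pi * y) : ℂ)) :
    (∫ y : ℝ, G (Complex.I * y) / (Real.cosh (Real.pi * y) : ℂ)) +
      ∫ y : ℝ, G (1 + Complex.I * y) / (Real.cosh (Real.pi * y) : ℂ) = 2 * G (1 / 2) := by
  obtain ⟨B, C, hBC⟩ := hg
  set E : ℝ → ℂ → ℂ := fun δ z => Complex.exp (δ * (z - 1 / 2) ^ 2) with hE
  have hEc : ∀ δ, Differentiable ℂ (E δ) := fun δ => by simp only [hE]; fun_prop
  have hEb : ∀ δ : ℝ, 0 ≤ δ → δ ≤ 1 → ∀ z : ℂ, 0 ≤ z.re → z.re ≤ 1 → ‖E δ z‖ ≤ Real.exp 1 := by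
    intro δ h0 h1 z hz0 hz1
    simp only [hE]
    rw [norm_exp_mul_sq]
    refine Real.exp_le_exp.2 ?_
    have : (z.re - 1 / 2) ^ 2 ≤ 1 := by nlinarith
    nlinarith [mul_nonneg h0 (sq_nonneg z.im), mul_le_mul h1 this (sq_nonneg _) zero_le_one]
  have hbd : ∀ δ : ℝ, 0 ≤ δ → δ ≤ 1 → ∀ u : ℝ → ℂ, Continuous u → (∀ y, 0 ≤ (u y).re) →
      (∀ y, (u y).re ≤ 1) →
      (Integrable fun y : ℝ => G (u y) / (Real.cosh (Real.pi * y) : ℂ)) →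
      (Integrable fun y : ℝ => E δ (u y) * G (u y) / (Real.cosh (Real.pi * y) : ℂ)) := by
    intro δ hδ0 hδ1 u hu hu0 hu1 hint
    have := hint.bdd_mul (c := Real.exp 1) (f := fun y => E δ (u y))
      ((hEc δ).continuous.comp hu).aestronglyMeasurable
      (Eventually.of_forall fun y => hEb δ hδ0 hδ1 _ (hu0 y) (hu1 y))
    simpa only [mul_div_assoc] using this
  have key : ∀ δ : ℝ, 0 < δ → δ ≤ 1 →
      (∫ y : ℝ, E δ (Complex.I * y) * G (Complex.I * y) / (Real.cosh (Real.pi * y) : ℂ)) +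
      ∫ y : ℝ, E δ (1 + Complex.I * y) * G (1 + Complex.I * y) / (Real.cosh (Real.pi * y) : ℂ)
        = 2 * G (1 / 2) := by
    intro δ hδ hδ1
    have hE1 : E δ (1 / 2) = 1 := by simp [hE]
    have := strip_quadrature_of_small (G := fun z => E δ z * G z)
      ((hEc δ).differentiableOn.mul hd) ((hEc δ).continuous.continuousOn.mul hc) ?_
      (hbd δ hδ.le hδ1 _ (by fun_prop) (by simp) (by simp) h0)
      (hbd δ hδ.le hδ1 _ (by fun_prop) (by simp) (by simp) h1)
    · simp only [hE1, one_mul] at this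
      exact this
    · intro ε hε
      have ht := ((tendsto_exp_rpow_sub_sq B hδ).const_mul (Real.exp 1 * |C|))
      rw [mul_zero] at ht
      obtain ⟨T, hT⟩ := (ht.eventually_le_const hε).exists_forall_of_atTop
      refine ⟨max T 1, fun z hz0 hz1 hz => ?_⟩
      have hzT : T ≤ |z.im| := (le_max_left _ _).trans hz
      have hzo : 1 ≤ |z.im| := (le_max_right _ _).trans hz
      have b1 := hBC z hz0 (by linarith) hzo
      have b2 : ‖E δ z‖ ≤ Real.exp 1 * Real.exp (-δ * |z.im| ^ 2) := by
        simp only [hE]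
        rw [norm_exp_mul_sq, ← Real.exp_add, sq_abs]
        refine Real.exp_le_exp.2 ?_
        have : (z.re - 1 / 2) ^ 2 ≤ 1 := by nlinarith
        nlinarith [mul_le_mul hδ1 this (sq_nonneg _) zero_le_one]
      have b3 := hT _ hzT
      rw [norm_mul]
      calc ‖E δ z‖ * ‖G z‖ ≤ (Real.exp 1 * Real.exp (-δ * |z.im| ^ 2)) *
            (|C| * Real.exp (B * |z.im| ^ (3 / 2 : ℝ))) := by
            refine mul_le_mul b2 (b1.trans ?_) (norm_nonneg _) (by positivity)
            gcongr; exact le_abs_self C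
        _ = Real.exp 1 * |C| * Real.exp (B * |z.im| ^ (3 / 2 : ℝ) - δ * |z.im| ^ 2) := by
            rw [sub_eq_add_neg, Real.exp_add]; ring_nf
        _ ≤ ε := b3
        _ ≤ ε * Real.cosh (Real.pi * z.im) := by
            nlinarith [Real.one_le_cosh (Real.pi * z.im)]
  -- removal of the Gaussian factor by dominated convergence
  set δ : ℕ → ℝ := fun n => 1 / ((n : ℝ) + 1) with hδ
  have hδ0 : ∀ n, 0 < δ n := fun n => by simp only [hδ]; positivity
  have hδ1 : ∀ n, δ n ≤ 1 := fun n => by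
    simp only [hδ]
    rw [div_le_one (by positivity)]
    have : (0 : ℝ) ≤ n := by positivity
    linarith
  have hδlim : Tendsto δ atTop (nhds 0) := tendsto_one_div_add_atTop_nhds_zero_nat
  have hlim : ∀ u : ℝ → ℂ, Continuous u → (∀ y, 0 ≤ (u y).re) → (∀ y, (u y).re ≤ 1) →
      (Integrable fun y : ℝ => G (u y) / (Real.cosh (Real.pi * y) : ℂ)) →
      Tendsto (fun n => ∫ y : ℝ, E (δ n) (u y) * G (u y) / (Real.cosh (Real.pi * y) : ℂ)) atTop
        (nhds (∫ y : ℝ, G (u y) / (Real.cosh (Real.pi * y) : ℂ))) := by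
    intro u hu hu0 hu1 hint
    refine tendsto_integral_of_dominated_convergence
      (fun y => Real.exp 1 * ‖G (u y) / (Real.cosh (Real.pi * y) : ℂ)‖)
      (fun n => (hbd _ (hδ0 n).le (hδ1 n) u hu hu0 hu1 hint).aestronglyMeasurable)
      (hint.norm.const_mul _) (fun n => Eventually.of_forall fun y => ?_)
      (Eventually.of_forall fun y => ?_)
    · rw [mul_div_assoc, norm_mul]
      exact mul_le_mul_of_nonneg_right (hEb _ (hδ0 n).le (hδ1 n) _ (hu0 y) (hu1 y)) (norm_nonneg _)
    · have hcont : Continuous fun d : ℝ =>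
          E d (u y) * G (u y) / (Real.cosh (Real.pi * y) : ℂ) := by
        simp only [hE, div_eq_mul_inv]; fun_prop
      have := (hcont.tendsto 0).comp hδlim
      simpa [hE, Function.comp_def] using this
  have hsum := (hlim (fun y => Complex.I * y) (by fun_prop) (by simp) (by simp) h0).add
    (hlim (fun y => 1 + Complex.I * y) (by fun_prop) (by simp) (by simp) h1)
  refine tendsto_nhds_unique hsum ?_
  simp only [fun n => key (δ n) (hδ0 n) (hδ1 n)]
  exact tendsto_const_nhds

/-- Summation of the residues of `G z / cos (π z)` over the right half-plane, strip by strip. The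
partial sums converge because the integrals over the lines `Re z = K` tend to zero. -/
theorem tendsto_alternating_sum_of_halfPlane {G : ℂ → ℂ}
    (hd : DifferentiableOn ℂ G {z | 0 < z.re}) (hc : ContinuousOn G {z | 0 ≤ z.re})
    (hg : ∀ K : ℕ, StripGrowth G K)
    (hi : ∀ K : ℕ, Integrable fun y : ℝ => G (K + Complex.I * y) / (Real.cosh (Real.pi * y) : ℂ))
    (hlim : Tendsto (fun K : ℕ =>
      ∫ y : ℝ, G (K + Complex.I * y) / (Real.cosh (Real.pi * y) : ℂ)) atTop (nhds 0)) :
    Tendsto (fun K : ℕ => 2 * ∑ N ∈ Finset.range K, (-1) ^ N * G (N + 1 / 2)) atTop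
      (nhds (∫ y : ℝ, G (Complex.I * y) / (Real.cosh (Real.pi * y) : ℂ))) := by
  set J : ℕ → ℂ := fun K => ∫ y : ℝ, G (K + Complex.I * y) / (Real.cosh (Real.pi * y) : ℂ) with hJ
  have step : ∀ K : ℕ, J K + J (K + 1) = 2 * G (K + 1 / 2) := by
    intro K
    have hcast : ∀ w : ℂ, ((K + 1 : ℕ) : ℂ) + w = K + (1 + w) := fun w => by push_cast; ring
    have := strip_quadrature (G := fun z => G (K + z)) ?_ ?_ ?_ (hi K) ?_
    · simp only [hJ, hcast]
      exact this
    · refine hd.comp (by fun_prop) fun z hz => ?_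
      have := hz.1
      simp only [Set.mem_ofPred_eq, Complex.add_re, Complex.natCast_re]
      positivity
    · refine hc.comp (by fun_prop) fun z hz => ?_
      have := hz.1
      simp only [Set.mem_ofPred_eq, Complex.add_re, Complex.natCast_re]
      positivity
    · obtain ⟨B, C, h⟩ := hg K
      refine ⟨B, C, fun z h0 h1 hz => ?_⟩
      have := h (K + z) (by simpa using h0)
        (by simp only [Complex.add_re, Complex.natCast_re]; linarith) (by simpa using hz)
      simpa using this
    · have := hi (K + 1)
      simpa only [hcast] using this
  -- the alternating sum of the strip formulas telescopes
  have hsum : ∀ K : ℕ, 2 * ∑ N ∈ Finset.range K, (-1) ^ N * G (N + 1 / 2)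
      = J 0 - (-1) ^ K * J K := by
    intro K
    induction K with
    | zero => simp
    | succ K ih =>
      rw [Finset.sum_range_succ, mul_add, ih]
      have := step K
      rw [pow_succ]
      linear_combination (-(-1) ^ K) * this
  have h0 : J 0 = ∫ y : ℝ, G (Complex.I * y) / (Real.cosh (Real.pi * y) : ℂ) := by
    simp [hJ]
  simp only [hsum]
  rw [← h0]
  have hz : Tendsto (fun K => (-1) ^ K * J K) atTop (nhds 0) := by
    rw [tendsto_zero_iff_norm_tendsto_zero] at hlim ⊢
    simpa using hlim
  simpa using hz.const_sub (J 0)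

/-! ### Growth in the half-plane -/

lemma isOpen_rightHalfPlane : IsOpen {z : ℂ | 0 < z.re} :=
  isOpen_lt continuous_const Complex.continuous_re

lemma norm_le_maxModulus {f : ℂ → ℂ} (hc : ContinuousOn f {z : ℂ | 0 ≤ z.re}) {z : ℂ}
    (hz : 0 ≤ z.re) : ‖f z‖ ≤ maxModulus f ‖z‖ := by
  have hS : IsCompact {w : ℂ | ‖w‖ = ‖z‖ ∧ 0 ≤ w.re} := by
    have h1 : {w : ℂ | ‖w‖ = ‖z‖ ∧ 0 ≤ w.re} = Metric.sphere 0 ‖z‖ ∩ {w | 0 ≤ w.re} := by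
      ext w; simp
    rw [h1]
    exact (isCompact_sphere _ _).inter_right (isClosed_le continuous_const Complex.continuous_re)
  refine le_csSup (hS.image_of_continuousOn ?_).bddAbove ⟨z, ⟨rfl, hz⟩, rfl⟩
  exact (hc.mono fun w hw => hw.2).norm

lemma le_exp_posLog (x : ℝ) : x ≤ Real.exp (Real.posLog x) := by
  rcases le_or_gt x 0 with h | h
  · exact h.trans (Real.exp_pos _).le
  · calc x = Real.exp (Real.log x) := (Real.exp_log h).symm
      _ ≤ _ := Real.exp_le_exp.2 (by rw [Real.posLog_apply]; exact le_max_right _ _)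

/-- A function of order at most one in the half-plane is bounded by `C exp (|z|^(3/2))`. -/
lemma exists_norm_le_exp_rpow_of_order {f : ℂ → ℂ} (hc : ContinuousOn f {z : ℂ | 0 ≤ z.re})
    (ho : HasOrderAtMostOne f) :
    ∃ C : ℝ, ∀ z : ℂ, 0 ≤ z.re → ‖f z‖ ≤ C * Real.exp (‖z‖ ^ (3 / 2 : ℝ)) := by
  have h1 : (1 : EReal) < ((3 / 2 : ℝ) : EReal) := by
    have : ((1 : ℝ) : EReal) < ((3 / 2 : ℝ) : EReal) := EReal.coe_lt_coe_iff.2 (by norm_num)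
    simpa using this
  have h2 := eventually_lt_of_limsup_lt (lt_of_le_of_lt ho h1)
  obtain ⟨R, hR⟩ := (h2.and (eventually_gt_atTop 1)).exists_forall_of_atTop
  have hfar : ∀ z : ℂ, 0 ≤ z.re → R ≤ ‖z‖ → ‖f z‖ ≤ Real.exp (‖z‖ ^ (3 / 2 : ℝ)) := by
    intro z hz hzR
    obtain ⟨a, b⟩ := hR _ hzR
    rw [EReal.coe_lt_coe_iff, div_lt_iff₀ (Real.log_pos b)] at a
    refine (norm_le_maxModulus hc hz).trans ((le_exp_posLog _).trans (Real.exp_le_exp.2 ?_))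
    refine (le_exp_posLog _).trans ?_
    rw [Real.rpow_def_of_pos (by linarith), mul_comm]
    exact Real.exp_le_exp.2 a.le
  have hcomp : IsCompact (Metric.closedBall (0 : ℂ) R ∩ {w | 0 ≤ w.re}) :=
    (isCompact_closedBall _ _).inter_right (isClosed_le continuous_const Complex.continuous_re)
  obtain ⟨M, hM⟩ := hcomp.exists_bound_of_continuousOn (hc.mono fun w hw => hw.2)
  refine ⟨max M 1, fun z hz => ?_⟩
  have he : 1 ≤ Real.exp (‖z‖ ^ (3 / 2 : ℝ)) := Real.one_le_exp (by positivity)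
  rcases le_total ‖z‖ R with h | h
  · have := hM z ⟨by simpa using h, hz⟩
    have h3 : M ≤ max M 1 := le_max_left _ _
    have h4 : 1 ≤ max M 1 := le_max_right _ _
    nlinarith
  · have := hfar z hz h
    have h4 : 1 ≤ max M 1 := le_max_right _ _
    nlinarith

/-- A nonpositive indicator in the direction of the positive axis means subexponential growth
there. -/
lemma exists_norm_le_exp_of_indicator {f : ℂ → ℂ} (hc : ContinuousOn f {z : ℂ | 0 ≤ z.re})
    (hi : indicator f 0 ≤ 0) {ε : ℝ} (hε : 0 < ε) :
    ∃ C : ℝ, ∀ x : ℝ, 0 ≤ x → ‖f x‖ ≤ C * Real.exp (ε * x) := by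
  have h1 : (0 : EReal) < ((ε : ℝ) : EReal) := EReal.coe_pos.2 hε
  have h2 := eventually_lt_of_limsup_lt (lt_of_le_of_lt hi h1)
  obtain ⟨R, hR⟩ := (h2.and (eventually_gt_atTop 0)).exists_forall_of_atTop
  have hfar : ∀ x : ℝ, R ≤ x → ‖f x‖ ≤ Real.exp (ε * x) := by
    intro x hx
    obtain ⟨a, b⟩ := hR x hx
    rw [EReal.div_lt_iff (EReal.coe_pos.2 b) (EReal.coe_ne_top _), ← EReal.coe_mul] at a
    have e : ((x : ℂ) * Complex.exp (Complex.I * ((0 : ℝ) : ℂ))) = x := by simp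
    rw [e] at a
    have := EReal.exp_monotone a.le
    rw [ENNReal.exp_log, EReal.exp_coe, ← ofReal_norm,
      ENNReal.ofReal_le_ofReal_iff (Real.exp_pos _).le] at this
    exact this
  have hcr : ContinuousOn (fun x : ℝ => f x) (Set.Icc 0 R) :=
    hc.comp Complex.continuous_ofReal.continuousOn fun x hx => by simpa using hx.1
  obtain ⟨M, hM⟩ := isCompact_Icc.exists_bound_of_continuousOn hcr
  refine ⟨max M 1, fun x hx => ?_⟩
  have he : 1 ≤ Real.exp (ε * x) := Real.one_le_exp (by positivity)
  have h4 : 1 ≤ max M 1 := le_max_right _ _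
  rcases le_total x R with h | h
  · have := hM x ⟨hx, h⟩
    have h3 : M ≤ max M 1 := le_max_left _ _
    nlinarith
  · have := hfar x h
    nlinarith

/-- A continuous function on the closed half-plane extends continuously to `ℂ`, by its values at
the nearest point of the half-plane. -/
lemma exists_continuous_eq_on_halfPlane {f : ℂ → ℂ} (hc : ContinuousOn f {z : ℂ | 0 ≤ z.re}) :
    ∃ g : ℂ → ℂ, Continuous g ∧ ∀ z : ℂ, 0 ≤ z.re → g z = f z := by
  refine ⟨fun z => f ((max z.re 0 : ℝ) + z.im * Complex.I), ?_, fun z hz => ?_⟩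
  · refine hc.comp_continuous (by fun_prop) fun z => ?_
    simp
  · simp only [max_eq_left hz, Complex.re_add_im]

/-- The integral of `g` along the segment from `0` to `z`, parametrized by `[0, 1]` so that it is
defined and continuous in `z` as soon as `g` is continuous. -/
noncomputable def segmentIntegral (g : ℂ → ℂ) (z : ℂ) : ℂ := ∫ t in (0 : ℝ)..1, z * g (t * z)

lemma continuous_segmentIntegral {g : ℂ → ℂ} (hg : Continuous g) :
    Continuous (segmentIntegral g) := by
  refine intervalIntegral.continuous_parametric_intervalIntegral_of_continuous' ?_ 0 1
  simp only [Function.uncurry_def]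
  fun_prop

lemma exists_primitive_halfPlane {g : ℂ → ℂ} (hd : DifferentiableOn ℂ g {z | 0 < z.re}) :
    ∃ B : ℂ → ℂ, ∀ z : ℂ, 0 < z.re → HasDerivAt B (g z) z := by
  -- the form `g z dz` is closed, hence exact on the half-plane by the Poincaré lemma
  set L : ℂ →L[ℂ] (ℂ →L[ℂ] ℂ) := ContinuousLinearMap.mul ℂ ℂ with hL
  have key : ∀ a ∈ {z : ℂ | 0 < z.re}, HasFDerivAt (𝕜 := ℝ) (fun z => L (g z))
      ((L.restrictScalars ℝ).comp
        ((ContinuousLinearMap.toSpanSingleton ℂ (deriv g a)).restrictScalars ℝ)) a := by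
    intro a ha
    have h1 := (hd.differentiableAt (isOpen_rightHalfPlane.mem_nhds ha)).hasDerivAt.hasFDerivAt
    exact (L.restrictScalars ℝ).hasFDerivAt.comp a (h1.restrictScalars ℝ)
  obtain ⟨B, hB⟩ := Convex.exists_forall_hasFDerivAt_of_fderiv_symmetric (𝕜 := ℂ)
    (s := {z : ℂ | 0 < z.re}) (ω := fun z => L (g z))
    (convex_halfSpace_re_gt 0) isOpen_rightHalfPlane
    (fun a ha => (key a ha).differentiableAt.differentiableWithinAt) (by
      intro a ha x y
      rw [(key a ha).fderiv]
      simp [hL]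
      ring)
  refine ⟨B, fun z hz => ?_⟩
  have := (hB z hz).hasDerivAt
  simpa [hL] using this

/-- The segment integral of a function that is holomorphic in the open half-plane and continuous up
to the boundary point `0` is a primitive. -/
lemma hasDerivAt_segmentIntegral {g : ℂ → ℂ} (hg : Continuous g)
    (hd : DifferentiableOn ℂ g {z | 0 < z.re}) {z : ℂ} (hz : 0 < z.re) :
    HasDerivAt (segmentIntegral g) (g z) z := by
  obtain ⟨B, hB⟩ := exists_primitive_halfPlane hd
  have hFTC : ∀ w : ℂ, 0 < w.re → ∀ s : ℝ, 0 < s → s ≤ 1 →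
      ∫ t in s..1, w * g (t * w) = B w - B (s * w) := by
    intro w hw s hs hs1
    have := intervalIntegral.integral_eq_sub_of_hasDerivAt (a := s) (b := 1)
      (f := fun t : ℝ => B (t * w)) (f' := fun t : ℝ => w * g (t * w)) ?_
      (Continuous.intervalIntegrable (by fun_prop) _ _)
    · simpa using this
    · intro t ht
      rw [Set.uIcc_of_le hs1] at ht
      have htw : 0 < ((t : ℂ) * w).re := by
        simp only [Complex.re_ofReal_mul]
        exact mul_pos (hs.trans_le ht.1) hw
      have h1 : HasDerivAt (fun t : ℝ => (t : ℂ) * w) w t := by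
        simpa using (Complex.ofRealCLM.hasDerivAt (x := t)).mul_const w
      have := (hB _ htw).comp t h1
      rw [mul_comm] at this
      exact this
  have hlim : ∀ w : ℂ, 0 < w.re →
      Tendsto (fun s : ℝ => B (s * w)) (nhdsWithin 0 (Set.Ioi 0))
        (nhds (B w - segmentIntegral g w)) := by
    intro w hw
    have hcont : Continuous fun s : ℝ => ∫ t in s..1, w * g (t * w) := by
      have : (fun s : ℝ => ∫ t in s..1, w * g (t * w)) =
          fun s : ℝ => -∫ t in (1 : ℝ)..s, w * g (t * w) := by
        ext s; rw [intervalIntegral.integral_symm]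
      rw [this]
      exact (intervalIntegral.continuous_primitive (fun a b =>
        Continuous.intervalIntegrable (by fun_prop) _ _) 1).neg
    have h0 := (hcont.tendsto 0).mono_left (nhdsWithin_le_nhds (s := Set.Ioi (0 : ℝ)))
    refine (h0.const_sub (B w)).congr' ?_
    have h1 : ∀ᶠ s : ℝ in nhdsWithin 0 (Set.Ioi 0), s ∈ Set.Ioc (0 : ℝ) 1 :=
      Ioc_mem_nhdsGT zero_lt_one
    filter_upwards [h1] with s hs
    rw [hFTC w hw s hs.1 hs.2]
    ring
  -- `B (s w) - B (s z) = O(s)`, so the limit of `B` at `0` is the same along all rays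
  have hconst : ∀ w : ℂ, 0 < w.re →
      B w - segmentIntegral g w = B z - segmentIntegral g z := by
    intro w hw
    set R : ℝ := max ‖w‖ ‖z‖ with hR
    obtain ⟨M, hM⟩ := (isCompact_closedBall (0 : ℂ) R).exists_bound_of_continuousOn
      hg.continuousOn
    have hconv : Convex ℝ ({w : ℂ | 0 < w.re} ∩ Metric.closedBall 0 R) :=
      (convex_halfSpace_re_gt 0).inter (convex_closedBall _ _)
    have hmem : ∀ v : ℂ, 0 < v.re → ‖v‖ ≤ R → ∀ s : ℝ, s ∈ Set.Ioc (0 : ℝ) 1 →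
        (s : ℂ) * v ∈ {w : ℂ | 0 < w.re} ∩ Metric.closedBall 0 R := by
      intro v hv hvR s hs
      refine ⟨?_, ?_⟩
      · simp only [Set.mem_ofPred_eq, Complex.re_ofReal_mul]
        exact mul_pos hs.1 hv
      · rw [mem_closedBall_zero_iff, norm_mul, Complex.norm_real, Real.norm_of_nonneg hs.1.le]
        nlinarith [hs.2, hs.1, norm_nonneg v]
    have hdiff : Tendsto (fun s : ℝ => B (s * w) - B (s * z)) (nhdsWithin 0 (Set.Ioi 0))
        (nhds 0) := by
      have hlin : Tendsto (fun s : ℝ => M * (s * ‖w - z‖)) (nhdsWithin 0 (Set.Ioi 0))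
          (nhds 0) := by
        have : Continuous fun s : ℝ => M * (s * ‖w - z‖) := by fun_prop
        simpa using (this.tendsto 0).mono_left (nhdsWithin_le_nhds (s := Set.Ioi (0 : ℝ)))
      refine squeeze_zero_norm' ?_ hlin
      have h1 : ∀ᶠ s : ℝ in nhdsWithin 0 (Set.Ioi 0), s ∈ Set.Ioc (0 : ℝ) 1 :=
        Ioc_mem_nhdsGT zero_lt_one
      filter_upwards [h1] with s hs
      have := hconv.norm_image_sub_le_of_norm_hasDerivWithin_le (f := B) (f' := g) (C := M)
        (fun v hv => (hB v hv.1).hasDerivWithinAt) (fun v hv => hM v hv.2)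
        (hmem z hz (le_max_right _ _) s hs) (hmem w hw (le_max_left _ _) s hs)
      rwa [← mul_sub, norm_mul, Complex.norm_real, Real.norm_of_nonneg hs.1.le] at this
    have := tendsto_nhds_unique hdiff ((hlim w hw).sub (hlim z hz))
    exact (sub_eq_zero.1 this.symm)
  have heq : segmentIntegral g =ᶠ[nhds z] fun w => B w - (B z - segmentIntegral g z) := by
    filter_upwards [isOpen_rightHalfPlane.mem_nhds hz] with w hw
    rw [← hconst w hw]; ring
  exact ((hB z hz).sub_const _).congr_of_eventuallyEq heq

lemma norm_segmentIntegral_le {g : ℂ → ℂ} {z : ℂ} {M : ℝ}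
    (h : ∀ t : ℝ, 0 < t → t ≤ 1 → ‖g (t * z)‖ ≤ M) : ‖segmentIntegral g z‖ ≤ ‖z‖ * M := by
  have := intervalIntegral.norm_integral_le_of_norm_le_const (a := 0) (b := 1) (C := ‖z‖ * M)
    (f := fun t : ℝ => z * g (t * z)) (by
      intro t ht
      rw [Set.uIoc_of_le zero_le_one] at ht
      rw [norm_mul]
      exact mul_le_mul_of_nonneg_left (h t ht.1 ht.2) (norm_nonneg _))
  simpa [segmentIntegral] using this

/-- On the imaginary axis, `|g| ≤ 1 + |g|^2` bounds the primitive of a square-integrable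
function. -/
lemma norm_segmentIntegral_I_le {g : ℂ → ℂ} (hg : Continuous g)
    (h2 : Integrable fun y : ℝ => ‖g (Complex.I * y)‖ ^ 2) (y : ℝ) :
    ‖segmentIntegral g (y * Complex.I)‖ ≤ |y| + ∫ s : ℝ, ‖g (Complex.I * s)‖ ^ 2 := by
  have hb : ‖segmentIntegral g (y * Complex.I)‖ ≤
      ∫ t in (0 : ℝ)..1, (|y| + |y| * ‖g (Complex.I * (t * y : ℝ))‖ ^ 2) := by
    refine intervalIntegral.norm_integral_le_of_norm_le zero_le_one
      (Eventually.of_forall fun t _ => ?_) (Continuous.intervalIntegrable (by fun_prop) _ _)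
    rw [norm_mul, norm_mul, Complex.norm_I, mul_one, Complex.norm_real, Real.norm_eq_abs]
    have e : ((t : ℂ) * (y * Complex.I)) = Complex.I * (t * y : ℝ) := by push_cast; ring
    rw [e]
    nlinarith [abs_nonneg y, sq_nonneg (‖g (Complex.I * (t * y : ℝ))‖ - 1),
      norm_nonneg (g (Complex.I * (t * y : ℝ))),
      mul_nonneg (abs_nonneg y) (sq_nonneg (‖g (Complex.I * (t * y : ℝ))‖ - 1)),
      mul_nonneg (abs_nonneg y) (norm_nonneg (g (Complex.I * (t * y : ℝ))))]
  refine hb.trans ?_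
  rw [intervalIntegral.integral_add (by simp)
    (Continuous.intervalIntegrable (by fun_prop) _ _)]
  simp only [intervalIntegral.integral_const, sub_zero, one_smul]
  gcongr
  rw [intervalIntegral.integral_const_mul]
  have h3 := intervalIntegral.mul_integral_comp_mul_right (a := 0) (b := 1)
    (f := fun s : ℝ => ‖g (Complex.I * s)‖ ^ 2) y
  have hnn : 0 ≤ ∫ t in (0 : ℝ)..1, ‖g (Complex.I * (t * y : ℝ))‖ ^ 2 :=
    intervalIntegral.integral_nonneg zero_le_one fun t _ => by positivity
  calc |y| * ∫ t in (0 : ℝ)..1, ‖g (Complex.I * (t * y : ℝ))‖ ^ 2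
      = |y * ∫ t in (0 : ℝ)..1, ‖g (Complex.I * (t * y : ℝ))‖ ^ 2| := by
        rw [abs_mul, abs_of_nonneg hnn]
    _ = |∫ s in (0 * y)..(1 * y), ‖g (Complex.I * s)‖ ^ 2| := by rw [h3]
    _ ≤ ∫ s in Set.uIoc (0 * y) (1 * y), ‖‖g (Complex.I * s)‖ ^ 2‖ := by
        have := intervalIntegral.norm_integral_le_integral_norm_uIoc (μ := volume)
          (f := fun s : ℝ => ‖g (Complex.I * s)‖ ^ 2) (a := 0 * y) (b := 1 * y)
        exact this
    _ = ∫ s in Set.uIoc (0 * y) (1 * y), ‖g (Complex.I * s)‖ ^ 2 := by simp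
    _ ≤ ∫ s : ℝ, ‖g (Complex.I * s)‖ ^ 2 :=
        setIntegral_le_integral h2 (Eventually.of_forall fun s => by positivity)

/-- Phragmén–Lindelöf for a function of order less than two that is square-integrable on the
imaginary axis and of zero exponential type on the positive axis. The principle is applied to a
primitive, which is `O(|y|)` on the imaginary axis; a Cauchy estimate recovers the function. -/
theorem exists_norm_le_of_one_le_re {f : ℂ → ℂ}
    (hd : DifferentiableOn ℂ f {z | 0 < z.re}) (hc : ContinuousOn f {z | 0 ≤ z.re})
    (hexp : ∃ C : ℝ, ∀ z : ℂ, 0 ≤ z.re → ‖f z‖ ≤ C * Real.exp (‖z‖ ^ (3 / 2 : ℝ)))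
    (h2 : Integrable fun y : ℝ => ‖f (Complex.I * y)‖ ^ 2)
    {ε : ℝ} (hε : 0 < ε) (hre : ∃ C : ℝ, ∀ x : ℝ, 0 ≤ x → ‖f x‖ ≤ C * Real.exp (ε * x)) :
    ∃ C : ℝ, 0 ≤ C ∧ ∀ z : ℂ, 1 ≤ z.re → ‖f z‖ ≤ C * (1 + ‖z‖) * Real.exp (ε * z.re) := by
  obtain ⟨g, hg, hgf⟩ := exists_continuous_eq_on_halfPlane hc
  have hgd : DifferentiableOn ℂ g {z | 0 < z.re} :=
    hd.congr fun z hz => hgf z (le_of_lt hz)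
  have hg2 : Integrable fun y : ℝ => ‖g (Complex.I * y)‖ ^ 2 := by
    refine h2.congr (Eventually.of_forall fun y => ?_)
    simp only
    rw [hgf _ (by simp)]
  obtain ⟨C₁, hC₁⟩ := hexp
  obtain ⟨C₂, hC₂⟩ := hre
  set S : ℝ := ∫ s : ℝ, ‖g (Complex.I * s)‖ ^ 2 with hS
  have hS0 : 0 ≤ S := integral_nonneg fun s => by positivity
  set A := segmentIntegral g with hA
  -- bounded on the real axis by the hypothesis there, on the imaginary axis by the `L²` bound
  set Ψ : ℂ → ℂ := fun z => Complex.exp (-(ε * z)) * A z / (1 + z) with hΨ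
  have hne : ∀ z : ℂ, 0 ≤ z.re → 1 + z ≠ 0 := by
    intro z hz h
    have := congrArg Complex.re h
    simp at this; linarith
  have hle : ∀ z : ℂ, 0 ≤ z.re → ‖z‖ ≤ ‖1 + z‖ := by
    intro z hz
    rw [← sq_le_sq₀ (norm_nonneg _) (norm_nonneg _), ← Complex.normSq_eq_norm_sq,
      ← Complex.normSq_eq_norm_sq, Complex.normSq_apply, Complex.normSq_apply]
    simp
    nlinarith
  have hnorm : ∀ z : ℂ, ‖Ψ z‖ = Real.exp (-(ε * z.re)) * ‖A z‖ / ‖1 + z‖ := by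
    intro z
    simp only [hΨ]
    rw [norm_div, norm_mul, Complex.norm_exp]
    simp
  have hC₁0 : 0 ≤ C₁ := by
    have := (norm_nonneg _).trans (hC₁ 0 (by simp))
    exact nonneg_of_mul_nonneg_left this (Real.exp_pos _)
  have hC₂0 : 0 ≤ C₂ := by
    have := (norm_nonneg _).trans (hC₂ 0 (by simp))
    exact nonneg_of_mul_nonneg_left this (Real.exp_pos _)
  have hcl : closure {z : ℂ | 0 < z.re} = {z | 0 ≤ z.re} := Complex.closure_setOfPred_lt_re 0
  have hdcl : DiffContOnCl ℂ Ψ {z | 0 < z.re} := by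
    refine ⟨?_, ?_⟩
    · refine DifferentiableOn.div ?_ (by fun_prop) fun z hz => hne z (le_of_lt hz)
      refine DifferentiableOn.mul (by fun_prop) fun z hz => ?_
      exact (hasDerivAt_segmentIntegral hg hgd hz).differentiableAt.differentiableWithinAt
    · rw [hcl]
      refine ContinuousOn.div ?_ (by fun_prop) fun z hz => hne z hz
      exact ((by fun_prop : Continuous fun z : ℂ => Complex.exp (-(ε * z))).mul
        (continuous_segmentIntegral hg)).continuousOn
  have hgrow : ∃ c < (2 : ℝ), ∃ B,
      Ψ =O[Bornology.cobounded ℂ ⊓ Filter.principal {z | 0 < z.re}]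
        fun z => Real.exp (B * ‖z‖ ^ c) := by
    refine ⟨3 / 2, by norm_num, 1, Asymptotics.IsBigO.of_bound C₁ ?_⟩
    rw [eventually_inf_principal]
    refine Eventually.of_forall fun z hz => ?_
    have hz0 : 0 ≤ z.re := le_of_lt hz
    have hAz : ‖A z‖ ≤ ‖z‖ * (C₁ * Real.exp (‖z‖ ^ (3 / 2 : ℝ))) := by
      refine norm_segmentIntegral_le fun t ht ht1 => ?_
      have htz : 0 ≤ ((t : ℂ) * z).re := by
        rw [Complex.re_ofReal_mul]; positivity
      rw [hgf _ htz]
      refine (hC₁ _ htz).trans ?_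
      gcongr
      rw [norm_mul, Complex.norm_real, Real.norm_of_nonneg ht.le]
      nlinarith [norm_nonneg z]
    have hpos : 0 < ‖1 + z‖ := norm_pos_iff.2 (hne z hz0)
    have he : Real.exp (-(ε * z.re)) ≤ 1 := Real.exp_le_one_iff.2 (by nlinarith)
    rw [hnorm, one_mul, Real.norm_of_nonneg (Real.exp_pos _).le, div_le_iff₀ hpos]
    calc Real.exp (-(ε * z.re)) * ‖A z‖ ≤ 1 * ‖A z‖ := by gcongr
      _ ≤ ‖z‖ * (C₁ * Real.exp (‖z‖ ^ (3 / 2 : ℝ))) := by rw [one_mul]; exact hAz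
      _ ≤ ‖1 + z‖ * (C₁ * Real.exp (‖z‖ ^ (3 / 2 : ℝ))) := by
        gcongr; exact hle z hz0
      _ = _ := by ring
  have hreal : IsBoundedUnder (· ≤ ·) atTop fun x : ℝ => ‖Ψ x‖ := by
    refine isBoundedUnder_of_eventually_le (a := C₂) ?_
    filter_upwards [eventually_ge_atTop 0] with x hx
    have hAx : ‖A x‖ ≤ ‖(x : ℂ)‖ * (C₂ * Real.exp (ε * x)) := by
      refine norm_segmentIntegral_le fun t ht ht1 => ?_
      have htx : 0 ≤ t * x := by positivity
      rw [← Complex.ofReal_mul, hgf _ (by simpa using htx)]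
      refine (hC₂ _ htx).trans ?_
      gcongr
      nlinarith
    have hx0 : 0 ≤ (x : ℂ).re := by simpa using hx
    have hpos : 0 < ‖1 + (x : ℂ)‖ := norm_pos_iff.2 (hne x hx0)
    rw [hnorm, div_le_iff₀ hpos, Complex.ofReal_re]
    calc Real.exp (-(ε * x)) * ‖A x‖
        ≤ Real.exp (-(ε * x)) * (‖(x : ℂ)‖ * (C₂ * Real.exp (ε * x))) := by gcongr
      _ = (Real.exp (-(ε * x)) * Real.exp (ε * x)) * (C₂ * ‖(x : ℂ)‖) := by ring
      _ = C₂ * ‖(x : ℂ)‖ := by rw [← Real.exp_add]; simp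
      _ ≤ C₂ * ‖1 + (x : ℂ)‖ := by gcongr; exact hle _ hx0
  have himag : ∀ y : ℝ, ‖Ψ (y * Complex.I)‖ ≤ 1 + S := by
    intro y
    have h0 : ((y : ℂ) * Complex.I).re = 0 := by simp
    have hpos : 0 < ‖1 + (y : ℂ) * Complex.I‖ := norm_pos_iff.2 (hne _ h0.ge)
    rw [hnorm, h0, div_le_iff₀ hpos]
    have h1 : |y| ≤ ‖1 + (y : ℂ) * Complex.I‖ := by
      have := Complex.abs_im_le_norm (1 + (y : ℂ) * Complex.I); simpa using this
    have h3 : 1 ≤ ‖1 + (y : ℂ) * Complex.I‖ := by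
      have := Complex.abs_re_le_norm (1 + (y : ℂ) * Complex.I); simpa using this
    have := norm_segmentIntegral_I_le hg hg2 y
    simp only [mul_zero, neg_zero, Real.exp_zero, one_mul]
    nlinarith
  have hPL : ∀ z : ℂ, 0 ≤ z.re → ‖A z‖ ≤ (1 + S) * (1 + ‖z‖) * Real.exp (ε * z.re) := by
    intro z hz
    have := PhragmenLindelof.right_half_plane_of_bounded_on_real hdcl hgrow hreal himag hz
    have hpos : 0 < ‖1 + z‖ := norm_pos_iff.2 (hne z hz)
    rw [hnorm, div_le_iff₀ hpos, Real.exp_neg, inv_mul_le_iff₀ (Real.exp_pos _)] at this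
    have h3 : ‖1 + z‖ ≤ 1 + ‖z‖ := by simpa using norm_add_le (1 : ℂ) z
    calc ‖A z‖ ≤ Real.exp (ε * z.re) * ((1 + S) * ‖1 + z‖) := this
      _ ≤ Real.exp (ε * z.re) * ((1 + S) * (1 + ‖z‖)) := by gcongr
      _ = _ := by ring
  -- Cauchy's estimate for `A' = g` on the disc of radius `1 / 2` about `z`
  refine ⟨(1 + S) * 4 * Real.exp (ε / 2), by positivity, fun z hz => ?_⟩
  have hderiv := (hasDerivAt_segmentIntegral hg hgd (by linarith : 0 < z.re)).deriv
  have hball : ∀ w ∈ Metric.closedBall z (1 / 2), 0 < w.re ∧ ‖w‖ ≤ ‖z‖ + 1 / 2 ∧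
      w.re ≤ z.re + 1 / 2 := by
    intro w hw
    rw [mem_closedBall_iff_norm] at hw
    have h1 := (Complex.abs_re_le_norm (w - z)).trans hw
    rw [Complex.sub_re, abs_le] at h1
    have h3 := norm_le_norm_add_norm_sub' w z
    exact ⟨by linarith, by linarith, by linarith⟩
  have hcauchy := Complex.norm_deriv_le_of_forall_mem_sphere_norm_le (c := z) (R := 1 / 2)
    (C := (1 + S) * (2 * (1 + ‖z‖)) * (Real.exp (ε / 2) * Real.exp (ε * z.re))) (f := A)
    (by norm_num) ?_ ?_
  · rw [hderiv, hgf z (by linarith)] at hcauchy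
    refine hcauchy.trans (le_of_eq ?_)
    ring
  · refine DifferentiableOn.diffContOnCl_ball (U := {z : ℂ | 0 < z.re}) (c := z)
      (R := 1 / 2) ?_ fun w hw => (hball w hw).1
    intro w hw
    exact (hasDerivAt_segmentIntegral hg hgd hw).differentiableAt.differentiableWithinAt
  · intro w hw
    obtain ⟨a1, a2, a3⟩ := hball w (Metric.sphere_subset_closedBall hw)
    refine (hPL w a1.le).trans ?_
    rw [← Real.exp_add]
    have : 1 + ‖w‖ ≤ 2 * (1 + ‖z‖) := by linarith [norm_nonneg z]
    gcongr
    nlinarith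

/-! ### The Meixner–Pollaczek polynomials -/

/-- The normalized rising factorial `(s)_k / k!`. -/
noncomputable def risingBinom (k : ℕ) (s : ℂ) : ℂ := (ascPochhammer ℂ k).eval s / k.factorial

@[simp] lemma risingBinom_zero (s : ℂ) : risingBinom 0 s = 1 := by simp [risingBinom]

lemma succ_mul_risingBinom_succ (k : ℕ) (s : ℂ) :
    (k + 1) * risingBinom (k + 1) s = (s + k) * risingBinom k s := by
  rw [risingBinom, risingBinom, ascPochhammer_succ_eval, Nat.factorial_succ]
  push_cast
  field_simp

/-- `₂F₁(-n, s; 1; 2)` as a finite sum. -/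
noncomputable def meixnerSum (n : ℕ) (s : ℂ) : ℂ :=
  ∑ k ∈ Finset.range (n + 1), (n.choose k : ℂ) * (-2) ^ k * risingBinom k s

lemma meixnerSum_eq_sum_range {n M : ℕ} (h : n + 1 ≤ M) (s : ℂ) :
    meixnerSum n s = ∑ k ∈ Finset.range M, (n.choose k : ℂ) * (-2) ^ k * risingBinom k s := by
  refine Finset.sum_subset (Finset.range_mono h) fun k _ hk => ?_
  rw [Finset.mem_range, not_lt] at hk
  rw [Nat.choose_eq_zero_of_lt (by omega)]
  simp

lemma ascPochhammer_eval_neg_natCast (n k : ℕ) :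
    (ascPochhammer ℂ k).eval (-(n : ℂ)) = (-1) ^ k * (k.factorial * n.choose k) := by
  rw [ascPochhammer_eval_neg_eq_descPochhammer, descPochhammer_eval_eq_descFactorial,
    Nat.descFactorial_eq_factorial_mul_choose]
  push_cast
  ring

/-- The hypergeometric series terminates: the terms with `k > n` vanish. -/
lemma meixnerPollaczek_eq (n : ℕ) (z : ℂ) :
    meixnerPollaczek n z = Complex.I ^ n * meixnerSum n (1 / 2 + Complex.I * z) := by
  rw [meixnerPollaczek, ordinaryHypergeometric_eq_tsum]
  congr 1
  have hterm : ∀ k : ℕ, ((k.factorial : ℂ)⁻¹ * (ascPochhammer ℂ k).eval (-(n : ℂ)) *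
      (ascPochhammer ℂ k).eval (1 / 2 + Complex.I * z) * ((ascPochhammer ℂ k).eval (1 : ℂ))⁻¹) •
        (2 : ℂ) ^ k = (n.choose k : ℂ) * (-2) ^ k * risingBinom k (1 / 2 + Complex.I * z) := by
    intro k
    rw [ascPochhammer_eval_neg_natCast, ascPochhammer_eval_one, risingBinom, smul_eq_mul,
      neg_pow (2 : ℂ)]
    field_simp
  simp only [hterm]
  rw [tsum_eq_sum (s := Finset.range (n + 1))]
  · rfl
  · intro k hk
    rw [Finset.mem_range, not_lt] at hk
    rw [Nat.choose_eq_zero_of_lt (by omega)]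
    simp

/-- The three-term recurrence, by comparing coefficients of `risingBinom k s` after multiplication
by `s` has been expressed through `succ_mul_risingBinom_succ`. -/
lemma meixnerSum_recurrence (n : ℕ) (s : ℂ) :
    (n + 2) * meixnerSum (n + 2) s =
      (n + 1) * meixnerSum n s - (2 * s - 1) * meixnerSum (n + 1) s := by
  have hshift : (2 * s - 1) * meixnerSum (n + 1) s =
      ∑ k ∈ Finset.range (n + 3), (-(k * ((n + 1).choose (k - 1) : ℂ)) -
        (2 * k + 1) * (n + 1).choose k) * (-2) ^ k * risingBinom k s := by
    have e : ∀ k : ℕ, (2 * s - 1) * (((n + 1).choose k : ℂ) * (-2) ^ k * risingBinom k s) =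
        -(((k + 1 : ℕ) : ℂ) * ((n + 1).choose (k + 1 - 1) : ℂ) * (-2) ^ (k + 1) *
          risingBinom (k + 1) s) -
        (2 * k + 1) * (n + 1).choose k * (-2) ^ k * risingBinom k s := by
      intro k
      have := succ_mul_risingBinom_succ k s
      rw [Nat.add_sub_cancel, pow_succ]
      push_cast
      linear_combination (-2 * ((n + 1).choose k : ℂ) * (-2) ^ k) * this
    have hsum1 : ∑ k ∈ Finset.range (n + 2), ((k + 1 : ℕ) : ℂ) *
        ((n + 1).choose (k + 1 - 1) : ℂ) * (-2) ^ (k + 1) * risingBinom (k + 1) s =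
        ∑ k ∈ Finset.range (n + 3), (k : ℂ) * ((n + 1).choose (k - 1) : ℂ) * (-2) ^ k *
          risingBinom k s := by
      rw [Finset.sum_range_succ' _ (n + 2)]
      simp
    have hsum2 : ∑ k ∈ Finset.range (n + 2), (2 * k + 1 : ℂ) * (n + 1).choose k * (-2) ^ k *
          risingBinom k s =
        ∑ k ∈ Finset.range (n + 3), (2 * k + 1 : ℂ) * (n + 1).choose k * (-2) ^ k *
          risingBinom k s := by
      rw [Finset.sum_range_succ _ (n + 2), Nat.choose_eq_zero_of_lt (by omega : n + 1 < n + 2)]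
      simp
    rw [meixnerSum, Finset.mul_sum]
    simp only [e]
    rw [Finset.sum_sub_distrib, Finset.sum_neg_distrib, hsum1, hsum2, ← Finset.sum_neg_distrib,
      ← Finset.sum_sub_distrib]
    refine Finset.sum_congr rfl fun k _ => ?_
    ring
  rw [hshift, meixnerSum, meixnerSum_eq_sum_range (by omega : n + 1 ≤ n + 3), Finset.mul_sum,
    Finset.mul_sum, ← Finset.sum_sub_distrib]
  refine Finset.sum_congr rfl fun k _ => ?_
  have hcoef : ((n : ℂ) + 2) * (n + 2).choose k = (n + 1) * n.choose k -
      (-(k * ((n + 1).choose (k - 1) : ℂ)) - (2 * k + 1) * (n + 1).choose k) := by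
    cases k with
    | zero => simp; ring
    | succ j =>
      have a1 : ((n + 2).choose (j + 1) : ℂ) = (n + 1).choose j + (n + 1).choose (j + 1) := by
        exact_mod_cast Nat.choose_succ_succ' (n + 1) j
      have a2 : ((n : ℂ) + 2) * (n + 1).choose j = (n + 2).choose (j + 1) * (j + 1) := by
        exact_mod_cast Nat.add_one_mul_choose_eq (n + 1) j
      have a3 : ((n : ℂ) + 1) * n.choose j = (n + 1).choose (j + 1) * (j + 1) := by
        exact_mod_cast Nat.add_one_mul_choose_eq n j
      have a4 : ((n + 1).choose (j + 1) : ℂ) = n.choose j + n.choose (j + 1) := by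
        exact_mod_cast Nat.choose_succ_succ' n j
      rw [Nat.add_sub_cancel]
      push_cast
      rw [a1] at a2 ⊢
      linear_combination a2 + a3 + (n + 1 : ℂ) * a4
  rw [← mul_assoc, ← mul_assoc, hcoef]
  ring

lemma meixnerPollaczek_zero (z : ℂ) : meixnerPollaczek 0 z = 1 := by
  simp [meixnerPollaczek_eq, meixnerSum]

lemma meixnerPollaczek_one (z : ℂ) : meixnerPollaczek 1 z = 2 * z := by
  have := succ_mul_risingBinom_succ 0 (1 / 2 + Complex.I * z)
  simp at this
  simp [meixnerPollaczek_eq, meixnerSum, Finset.sum_range_succ, this]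
  linear_combination (-2 * z) * Complex.I_mul_I

lemma meixnerPollaczek_recurrence (n : ℕ) (z : ℂ) :
    (n + 2) * meixnerPollaczek (n + 2) z =
      2 * z * meixnerPollaczek (n + 1) z - (n + 1) * meixnerPollaczek n z := by
  have h := meixnerSum_recurrence n (1 / 2 + Complex.I * z)
  simp only [meixnerPollaczek_eq]
  rw [pow_succ, pow_succ]
  linear_combination (Complex.I ^ n * Complex.I * Complex.I) * h -
    Complex.I ^ n * (2 * z * Complex.I * meixnerSum (n + 1) (1 / 2 + Complex.I * z) -
      (n + 1) * meixnerSum n (1 / 2 + Complex.I * z)) * Complex.I_mul_I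

lemma meixnerPollaczek_add_two (n : ℕ) (z : ℂ) :
    meixnerPollaczek (n + 2) z =
      (2 * z * meixnerPollaczek (n + 1) z - (n + 1) * meixnerPollaczek n z) / (n + 2) := by
  have h2 : (n + 2 : ℂ) ≠ 0 := by exact_mod_cast (by omega : n + 2 ≠ 0)
  rw [eq_div_iff h2, ← meixnerPollaczek_recurrence, mul_comm]

lemma differentiable_meixnerPollaczek (n : ℕ) : Differentiable ℂ (meixnerPollaczek n) := by
  induction n using Nat.twoStepInduction with
  | zero => rw [funext meixnerPollaczek_zero]; fun_prop
  | one => rw [funext meixnerPollaczek_one]; fun_prop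
  | more n h0 h1 =>
    rw [funext (meixnerPollaczek_add_two n)]
    fun_prop

/-- The recurrence shows that the coefficients are real. -/
lemma conj_meixnerPollaczek (n : ℕ) (z : ℂ) :
    starRingEnd ℂ (meixnerPollaczek n z) = meixnerPollaczek n (starRingEnd ℂ z) := by
  induction n using Nat.twoStepInduction with
  | zero => simp [meixnerPollaczek_zero]
  | one => simp [meixnerPollaczek_one, map_ofNat (starRingEnd ℂ) 2]
  | more n h0 h1 =>
    rw [meixnerPollaczek_add_two, meixnerPollaczek_add_two]
    simp [h0, h1, map_ofNat (starRingEnd ℂ) 2]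

lemma exists_norm_meixnerPollaczek_le (n : ℕ) :
    ∃ C : ℝ, 0 ≤ C ∧ ∀ z : ℂ, ‖meixnerPollaczek n z‖ ≤ C * (1 + ‖z‖) ^ n := by
  induction n using Nat.twoStepInduction with
  | zero => exact ⟨1, zero_le_one, fun z => by simp [meixnerPollaczek_zero]⟩
  | one =>
    refine ⟨2, by norm_num, fun z => ?_⟩
    rw [meixnerPollaczek_one, norm_mul]
    simp
  | more n h0 h1 =>
    obtain ⟨C₀, hC₀, h0⟩ := h0
    obtain ⟨C₁, hC₁, h1⟩ := h1
    refine ⟨2 * C₁ + (n + 1) * C₀, by positivity, fun z => ?_⟩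
    have hz := norm_nonneg z
    have hden : (1 : ℝ) ≤ ‖(n + 2 : ℂ)‖ := by
      rw [show (n + 2 : ℂ) = ((n + 2 : ℕ) : ℂ) by push_cast; ring, Complex.norm_natCast]
      push_cast
      linarith [Nat.cast_nonneg (α := ℝ) n]
    have hn : ‖(n + 1 : ℂ)‖ = n + 1 := by
      rw [show (n + 1 : ℂ) = ((n + 1 : ℕ) : ℂ) by push_cast; ring, Complex.norm_natCast]
      push_cast; ring
    rw [meixnerPollaczek_add_two, norm_div]
    refine (div_le_self (norm_nonneg _) hden).trans ((norm_sub_le _ _).trans ?_)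
    rw [norm_mul, norm_mul, norm_mul, hn, Complex.norm_two, add_mul (2 * C₁)]
    have hp : (1 + ‖z‖) ^ n ≤ (1 + ‖z‖) ^ (n + 2) :=
      pow_le_pow_right₀ (by linarith) (by omega)
    refine add_le_add ?_ ?_
    · calc 2 * ‖z‖ * ‖meixnerPollaczek (n + 1) z‖ ≤ 2 * (1 + ‖z‖) * (C₁ * (1 + ‖z‖) ^ (n + 1)) := by
            gcongr
            · linarith
            · exact h1 z
        _ = 2 * C₁ * (1 + ‖z‖) ^ (n + 2) := by ring
    · calc (n + 1 : ℝ) * ‖meixnerPollaczek n z‖ ≤ (n + 1) * (C₀ * (1 + ‖z‖) ^ (n + 2)) := by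
            gcongr
            exact (h0 z).trans (mul_le_mul_of_nonneg_left hp hC₀)
        _ = _ := by ring

/-! ### Orthonormality -/

lemma integrable_div_cosh_of_norm_le_pow {u : ℝ → ℂ} (hu : Continuous u) {C : ℝ} {n : ℕ}
    (h : ∀ y, ‖u y‖ ≤ C * (1 + |y|) ^ n) :
    Integrable fun y : ℝ => u y / (Real.cosh (Real.pi * y) : ℂ) := by
  refine ((integrable_one_add_abs_pow_mul_exp n Real.pi_pos).const_mul (C * 2)).mono'
    ?_ (Eventually.of_forall fun y => ?_)
  · simp only [div_eq_mul_inv, ← Complex.ofReal_inv]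
    exact (hu.mul (Complex.continuous_ofReal.comp continuous_inv_cosh)).aestronglyMeasurable
  · rw [norm_div, Complex.norm_real, Real.norm_of_nonneg (Real.cosh_pos _).le, div_eq_mul_inv]
    calc ‖u y‖ * (Real.cosh (Real.pi * y))⁻¹
        ≤ (C * (1 + |y|) ^ n) * (2 * Real.exp (-Real.pi * |y|)) :=
          mul_le_mul (h y) (inv_cosh_le_two_mul_exp y) (inv_nonneg.2 (Real.cosh_pos _).le)
            ((norm_nonneg _).trans (h y))
      _ = _ := by ring

lemma differentiable_risingBinom (k : ℕ) : Differentiable ℂ (risingBinom k) := by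
  unfold risingBinom
  fun_prop

lemma exists_norm_risingBinom_le (k : ℕ) :
    ∃ C : ℝ, 0 ≤ C ∧ ∀ s : ℂ, ‖risingBinom k s‖ ≤ C * (1 + ‖s‖) ^ k := by
  induction k with
  | zero => exact ⟨1, zero_le_one, fun s => by simp⟩
  | succ k ih =>
    obtain ⟨C, hC, h⟩ := ih
    refine ⟨(k + 1) * C, by positivity, fun s => ?_⟩
    have h1 := succ_mul_risingBinom_succ k s
    have hk : ‖(k + 1 : ℂ)‖ = k + 1 := by
      rw [show (k + 1 : ℂ) = ((k + 1 : ℕ) : ℂ) by push_cast; ring, Complex.norm_natCast]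
      push_cast; ring
    have hs := norm_nonneg s
    have h2 : ‖risingBinom (k + 1) s‖ ≤ ‖(k + 1 : ℂ) * risingBinom (k + 1) s‖ := by
      rw [norm_mul, hk]
      nlinarith [norm_nonneg (risingBinom (k + 1) s)]
    refine h2.trans ?_
    rw [h1, norm_mul]
    have h3 : ‖s + k‖ ≤ (k + 1) * (1 + ‖s‖) := by
      have := norm_add_le s (k : ℂ)
      rw [Complex.norm_natCast] at this
      nlinarith
    calc ‖s + k‖ * ‖risingBinom k s‖ ≤ ((k + 1) * (1 + ‖s‖)) * (C * (1 + ‖s‖) ^ k) := by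
          gcongr
          exact h s
      _ = _ := by ring

lemma risingBinom_one (k : ℕ) : risingBinom k 1 = 1 := by
  have h1 : (k.factorial : ℂ) ≠ 0 := by exact_mod_cast k.factorial_ne_zero
  rw [risingBinom, ascPochhammer_eval_one, div_self h1]

/-- Pascal's rule for rising binomials. -/
lemma risingBinom_succ_add_one (k : ℕ) (s : ℂ) :
    risingBinom (k + 1) (s + 1) = risingBinom (k + 1) s + risingBinom k (s + 1) := by
  have e : (ascPochhammer ℂ (k + 1)).eval s = s * (ascPochhammer ℂ k).eval (s + 1) := by
    rw [ascPochhammer_succ_left]; simp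
  rw [risingBinom, risingBinom, risingBinom, e, ascPochhammer_succ_eval, Nat.factorial_succ]
  push_cast
  field_simp
  ring

lemma integrable_risingBinom_div_cosh (k : ℕ) (c : ℂ) :
    Integrable fun y : ℝ => risingBinom k (c + Complex.I * y) / (Real.cosh (Real.pi * y) : ℂ) := by
  obtain ⟨C, hC, h⟩ := exists_norm_risingBinom_le k
  refine integrable_div_cosh_of_norm_le_pow (C := C * (1 + ‖c‖) ^ k) (n := k)
    ((differentiable_risingBinom k).continuous.comp (by fun_prop)) fun y => (h _).trans ?_
  rw [mul_assoc, ← mul_pow]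
  have : ‖c + Complex.I * y‖ ≤ ‖c‖ + |y| := by
    have := norm_add_le c (Complex.I * y)
    simpa using this
  gcongr
  nlinarith [norm_nonneg c, abs_nonneg y, mul_nonneg (norm_nonneg c) (abs_nonneg y)]

/-- The moments of the hyperbolic secant density in the basis of rising binomials. Quadrature on
the strip gives `m k + n k = 2` for the integrals `m k`, `n k` over the two boundary lines, and
Pascal's rule gives `n (k + 1) = m (k + 1) + n k`. -/
lemma integral_risingBinom_div_cosh (k : ℕ) :
    ∫ y : ℝ, risingBinom k (1 / 2 + Complex.I * y) / (Real.cosh (Real.pi * y) : ℂ)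
      = (1 / 2) ^ k := by
  set m : ℕ → ℂ := fun k =>
    ∫ y : ℝ, risingBinom k (1 / 2 + Complex.I * y) / (Real.cosh (Real.pi * y) : ℂ) with hm
  set n : ℕ → ℂ := fun k =>
    ∫ y : ℝ, risingBinom k (1 / 2 + 1 + Complex.I * y) / (Real.cosh (Real.pi * y) : ℂ) with hn
  have hmn : ∀ k, m k + n k = 2 := by
    intro k
    obtain ⟨C, hC, h⟩ := exists_norm_risingBinom_le k
    have := strip_quadrature (G := fun z => risingBinom k (1 / 2 + z))
      ((differentiable_risingBinom k).comp (by fun_prop)).differentiableOn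
      ((differentiable_risingBinom k).continuous.comp (by fun_prop)).continuousOn
      (stripGrowth_of_norm_le_pow (C := C * 2 ^ k) (n := k) le_rfl fun z _ _ _ => ?_)
      (integrable_risingBinom_div_cosh k _) ?_
    · simp only [hm, hn, add_assoc]
      rw [this]
      norm_num [risingBinom_one]
    · refine (h _).trans ?_
      rw [mul_assoc, ← mul_pow]
      have := norm_add_le (1 / 2 : ℂ) z
      gcongr
      norm_num at this
      linarith [norm_nonneg z]
    · simpa only [add_assoc] using integrable_risingBinom_div_cosh k (1 / 2 + 1)
  have hstep : ∀ k, n (k + 1) = m (k + 1) + n k := by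
    intro k
    simp only [hm, hn]
    rw [← integral_add (integrable_risingBinom_div_cosh _ _) (integrable_risingBinom_div_cosh _ _)]
    refine integral_congr_ae (Eventually.of_forall fun y => ?_)
    simp only
    rw [← add_div, show (1 / 2 + 1 + Complex.I * y : ℂ) = (1 / 2 + Complex.I * y) + 1 by ring,
      risingBinom_succ_add_one]
  have hnk : ∀ k, n k = 2 - (1 / 2) ^ k := by
    intro k
    induction k with
    | zero =>
      have h1 := hmn 0
      have h2 : m 0 = n 0 := by simp [hm, hn]
      rw [h2] at h1
      rw [pow_zero]
      linear_combination h1 / 2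
    | succ k ih =>
      have h1 := hmn (k + 1)
      have h2 := hstep k
      rw [ih] at h2
      rw [pow_succ]
      linear_combination h1 / 2 + h2 / 2
  have := hmn k
  rw [hnk k] at this
  change m k = _
  linear_combination this

/-- With the moments `(1/2)^k` the integral becomes `i^n ∑ (-1)^k (n choose k) = i^n (1 - 1)^n`. -/
lemma integral_meixnerPollaczek_div_cosh (n : ℕ) :
    ∫ y : ℝ, meixnerPollaczek n y / (Real.cosh (Real.pi * y) : ℂ) = if n = 0 then 1 else 0 := by
  have h1 : ∀ y : ℝ, meixnerPollaczek n y / (Real.cosh (Real.pi * y) : ℂ) =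
      ∑ k ∈ Finset.range (n + 1), (Complex.I ^ n * ((n.choose k : ℂ) * (-2) ^ k)) *
        (risingBinom k (1 / 2 + Complex.I * y) / (Real.cosh (Real.pi * y) : ℂ)) := by
    intro y
    rw [meixnerPollaczek_eq, meixnerSum, Finset.mul_sum, Finset.sum_div]
    exact Finset.sum_congr rfl fun k _ => by ring
  simp only [h1]
  rw [integral_finsetSum _ fun k _ => (integrable_risingBinom_div_cosh k _).const_mul _]
  simp only [integral_const_mul, integral_risingBinom_div_cosh]
  have h2 : ∀ k ∈ Finset.range (n + 1), Complex.I ^ n * ((n.choose k : ℂ) * (-2) ^ k) * (1 / 2) ^ k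
      = Complex.I ^ n * ((-1) ^ k * 1 ^ (n - k) * n.choose k) := by
    intro k _
    rw [mul_assoc, mul_assoc, ← mul_pow, one_pow]
    norm_num
    ring
  rw [Finset.sum_congr rfl h2, ← Finset.mul_sum, ← add_pow]
  split_ifs with hn
  · simp [hn]
  · simp [hn]

lemma exists_norm_meixnerPollaczek_ofReal_le (n : ℕ) :
    ∃ C : ℝ, 0 ≤ C ∧ ∀ y : ℝ, ‖meixnerPollaczek n y‖ ≤ C * (1 + |y|) ^ n := by
  obtain ⟨C, hC, h⟩ := exists_norm_meixnerPollaczek_le n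
  exact ⟨C, hC, fun y => by simpa using h y⟩

lemma continuous_meixnerPollaczek_ofReal (n : ℕ) :
    Continuous fun y : ℝ => meixnerPollaczek n y :=
  (differentiable_meixnerPollaczek n).continuous.comp Complex.continuous_ofReal

lemma integrable_meixnerPollaczek_mul_div_cosh (m n : ℕ) :
    Integrable fun y : ℝ =>
      meixnerPollaczek m y * meixnerPollaczek n y / (Real.cosh (Real.pi * y) : ℂ) := by
  obtain ⟨C, hC, h⟩ := exists_norm_meixnerPollaczek_ofReal_le m
  obtain ⟨D, hD, h'⟩ := exists_norm_meixnerPollaczek_ofReal_le n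
  refine integrable_div_cosh_of_norm_le_pow (C := C * D) (n := m + n)
    ((continuous_meixnerPollaczek_ofReal m).mul (continuous_meixnerPollaczek_ofReal n)) fun y => ?_
  rw [norm_mul, pow_add]
  calc _ ≤ (C * (1 + |y|) ^ m) * (D * (1 + |y|) ^ n) :=
        mul_le_mul (h y) (h' y) (norm_nonneg _) (by positivity)
    _ = _ := by ring

/-- Multiplication by the variable in the basis of Meixner–Pollaczek polynomials. For `n = 0` the
truncated index `n - 1` is harmless, as its coefficient vanishes. -/
lemma two_mul_meixnerPollaczek (n : ℕ) (z : ℂ) :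
    2 * z * meixnerPollaczek n z =
      (n + 1) * meixnerPollaczek (n + 1) z + n * meixnerPollaczek (n - 1) z := by
  cases n with
  | zero => simp [meixnerPollaczek_zero, meixnerPollaczek_one]
  | succ n =>
    have := meixnerPollaczek_recurrence n z
    rw [Nat.add_sub_cancel]
    push_cast
    linear_combination -this

/-- Orthonormality with respect to `dy / cosh (π y)`: the recurrence propagates it from the
first row. -/
lemma integral_meixnerPollaczek_mul_div_cosh (m n : ℕ) :
    ∫ y : ℝ, meixnerPollaczek m y * meixnerPollaczek n y / (Real.cosh (Real.pi * y) : ℂ)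
      = if m = n then 1 else 0 := by
  set L : ℕ → ℕ → ℂ := fun m n => ∫ y : ℝ, meixnerPollaczek m y * meixnerPollaczek n y /
    (Real.cosh (Real.pi * y) : ℂ) with hL
  -- multiplication by `2 y` is symmetric for the pairing
  have hrec : ∀ m n : ℕ, (m + 1 : ℂ) * L (m + 1) n + m * L (m - 1) n =
      (n + 1) * L m (n + 1) + n * L m (n - 1) := by
    intro m n
    simp only [hL]
    simp only [← integral_const_mul]
    rw [← integral_add ((integrable_meixnerPollaczek_mul_div_cosh _ _).const_mul _)
        ((integrable_meixnerPollaczek_mul_div_cosh _ _).const_mul _),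
      ← integral_add ((integrable_meixnerPollaczek_mul_div_cosh _ _).const_mul _)
        ((integrable_meixnerPollaczek_mul_div_cosh _ _).const_mul _)]
    refine integral_congr_ae (Eventually.of_forall fun y => ?_)
    simp only
    have h1 := two_mul_meixnerPollaczek m y
    have h2 := two_mul_meixnerPollaczek n y
    linear_combination (meixnerPollaczek m y / (Real.cosh (Real.pi * y) : ℂ)) * h2 -
      (meixnerPollaczek n y / (Real.cosh (Real.pi * y) : ℂ)) * h1
  have h0 : ∀ n, L 0 n = if 0 = n then 1 else 0 := by
    intro n
    simp only [hL, meixnerPollaczek_zero, one_mul]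
    rw [integral_meixnerPollaczek_div_cosh]
    simp [eq_comm]
  have hcase : ∀ m : ℕ, ∀ n, L m n = if m = n then 1 else 0 := by
    intro m
    induction m using Nat.twoStepInduction with
    | zero => exact h0
    | one =>
      intro n
      have := hrec 0 n
      rw [h0, h0] at this
      rcases n with _ | _ | n
      · simpa [h0] using this
      · simpa [h0] using this
      · simpa [h0] using this
    | more m ih0 ih1 =>
      intro n
      have hne : (m + 2 : ℂ) ≠ 0 := by exact_mod_cast (by omega : m + 2 ≠ 0)
      have := hrec (m + 1) n
      rw [ih1, ih1, Nat.add_sub_cancel, ih0] at this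
      push_cast at this
      apply mul_left_cancel₀ hne
      have e : (m + 2 : ℂ) * L (m + 2) n = (n + 1) * (if m = n then 1 else 0) +
          n * (if m + 1 = n - 1 then 1 else 0) - (m + 1) * (if m = n then 1 else 0) := by
        linear_combination this
      rw [e]
      rcases n with _ | n
      · rcases m with _ | m
        · simp
        · simp
      · simp only [Nat.add_sub_cancel]
        by_cases h1 : m = n + 1
        · have h2 : ¬ (m + 1 = n) := by omega
          simp [h1]
          omega
        · by_cases h2 : m + 1 = n
          · subst h2
            have : ¬ (m = m + 1 + 1) := by omega
            simp [this]; ring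
          · simp [h1, h2]
  exact hcase m n

/-! ### The functions `psi n` -/

lemma conj_Gamma_half (y : ℝ) : starRingEnd ℂ (Complex.Gamma (1 / 2 + Complex.I * y)) =
    Complex.Gamma (1 / 2 - Complex.I * y) := by
  rw [← Complex.Gamma_conj]
  congr 1
  simp [map_ofNat (starRingEnd ℂ) 2, sub_eq_add_neg]

/-- The reflection formula around `1/2`. -/
lemma Gamma_half_sub_mul_Gamma_half_add (z : ℂ) :
    Complex.Gamma (1 / 2 - z) * Complex.Gamma (1 / 2 + z) =
      Real.pi / Complex.cos (Real.pi * z) := by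
  have := Complex.Gamma_mul_Gamma_one_sub (1 / 2 - z)
  rw [show (1 : ℂ) - (1 / 2 - z) = 1 / 2 + z by ring,
    show (Real.pi * (1 / 2 - z) : ℂ) = Real.pi / 2 - Real.pi * z by ring,
    Complex.sin_pi_div_two_sub] at this
  exact this

lemma norm_Gamma_half_sq (y : ℝ) :
    ‖Complex.Gamma (1 / 2 + Complex.I * y)‖ ^ 2 = Real.pi / Real.cosh (Real.pi * y) := by
  have := Gamma_half_sub_mul_Gamma_half_add (Complex.I * y)
  rw [← conj_Gamma_half, cos_pi_mul_I, Complex.conj_mul'] at this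
  exact_mod_cast this

lemma differentiableAt_Gamma_half {z : ℂ} (hz : -(1 / 2) < z.re) :
    DifferentiableAt ℂ (fun w => Complex.Gamma (1 / 2 + w)) z := by
  have h : DifferentiableAt ℂ Complex.Gamma (1 / 2 + z) := by
    refine Complex.differentiableAt_Gamma _ fun m h => ?_
    have := congrArg Complex.re h
    simp at this
    norm_num at this
    linarith
  exact h.comp z (by fun_prop : DifferentiableAt ℂ (fun w => 1 / 2 + w) z)

lemma continuous_Gamma_half : Continuous fun y : ℝ => Complex.Gamma (1 / 2 + Complex.I * y) := by
  rw [continuous_iff_continuousAt]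
  intro y
  have h := (differentiableAt_Gamma_half (z := Complex.I * y) (by simp)).continuousAt
  exact ContinuousAt.comp (f := fun y : ℝ => (Complex.I * y : ℂ))
    (g := fun w => Complex.Gamma (1 / 2 + w)) h (by fun_prop)

lemma continuous_psi (n : ℕ) : Continuous (psi n) := by
  unfold psi
  exact (continuous_const.mul continuous_Gamma_half).mul (continuous_meixnerPollaczek_ofReal n)

lemma conj_meixnerPollaczek_ofReal (n : ℕ) (y : ℝ) :
    starRingEnd ℂ (meixnerPollaczek n y) = meixnerPollaczek n y := by
  rw [conj_meixnerPollaczek, Complex.conj_ofReal]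

lemma psi_mul_conj_psi (m n : ℕ) (y : ℝ) : psi n y * starRingEnd ℂ (psi m y) =
    meixnerPollaczek m y * meixnerPollaczek n y / (Real.cosh (Real.pi * y) : ℂ) := by
  have h1 : Complex.Gamma (1 / 2 + Complex.I * y) *
      starRingEnd ℂ (Complex.Gamma (1 / 2 + Complex.I * y)) =
        Real.pi / (Real.cosh (Real.pi * y) : ℂ) := by
    rw [Complex.mul_conj', ← Complex.ofReal_pow, norm_Gamma_half_sq]
    push_cast; rfl
  have h2 : (1 / (Real.sqrt Real.pi : ℂ)) * (1 / (Real.sqrt Real.pi : ℂ)) = 1 / Real.pi := by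
    rw [div_mul_div_comm, ← Complex.ofReal_mul, Real.mul_self_sqrt Real.pi_pos.le, one_mul]
  have h3 : starRingEnd ℂ (1 / (Real.sqrt Real.pi : ℂ)) = 1 / (Real.sqrt Real.pi : ℂ) := by simp
  rw [psi, psi, map_mul, map_mul, conj_meixnerPollaczek_ofReal, h3]
  calc _ = (1 / (Real.sqrt Real.pi : ℂ)) * (1 / (Real.sqrt Real.pi : ℂ)) *
      (Complex.Gamma (1 / 2 + Complex.I * y) *
      starRingEnd ℂ (Complex.Gamma (1 / 2 + Complex.I * y))) *
      (meixnerPollaczek m y * meixnerPollaczek n y) := by ring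
    _ = _ := by rw [h1, h2]; field_simp

lemma memLp_psi (n : ℕ) : MemLp (psi n) 2 (volume : Measure ℝ) := by
  rw [memLp_two_iff_integrable_sq_norm (continuous_psi n).aestronglyMeasurable]
  refine (integrable_meixnerPollaczek_mul_div_cosh n n).norm.congr
    (Eventually.of_forall fun y => ?_)
  simp only
  rw [← psi_mul_conj_psi, norm_mul, RCLike.norm_conj, sq]

lemma inner_toLp_psi {g : ℝ → ℂ} (n : ℕ) (hg : MemLp g 2 (volume : Measure ℝ)) :
    inner ℂ ((memLp_psi n).toLp (psi n)) (hg.toLp g) = ∫ y : ℝ, g y * starRingEnd ℂ (psi n y) := by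
  rw [L2.inner_def]
  refine integral_congr_ae ?_
  filter_upwards [(memLp_psi n).coeFn_toLp, hg.coeFn_toLp] with y h1 h2
  rw [h1, h2, RCLike.inner_apply]

theorem orthonormal_psi : Orthonormal ℂ (fun n : ℕ => (memLp_psi n).toLp (psi n)) := by
  rw [orthonormal_iff_ite]
  intro m n
  rw [inner_toLp_psi]
  simp only [psi_mul_conj_psi]
  exact integral_meixnerPollaczek_mul_div_cosh m n

/-! ### Completeness -/

lemma mem_interior_integrableExpSet {μ : Measure ℝ} [IsFiniteMeasure μ] {a : ℝ}
    (h : Integrable (fun x => Real.exp (a * |x|)) μ) {t : ℝ} (ht : |t| < a) :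
    t ∈ interior (ProbabilityTheory.integrableExpSet id μ) := by
  rw [mem_interior]
  refine ⟨Set.Ioo (-a) a, fun s hs => ?_, isOpen_Ioo, abs_lt.1 ht⟩
  refine h.mono' (by fun_prop) (Eventually.of_forall fun x => ?_)
  rw [Real.norm_of_nonneg (Real.exp_pos _).le]
  refine Real.exp_le_exp.2 ((le_abs_self _).trans ?_)
  rw [abs_mul]
  exact mul_le_mul_of_nonneg_right (abs_lt.2 hs).le (abs_nonneg _)

/-- Finite measures with an exponential moment are determined by their moments: the two complex
moment generating functions have the same Taylor series at `0`, hence agree in a strip around the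
imaginary axis. -/
theorem measure_ext_of_moments {μ ν : Measure ℝ} [IsFiniteMeasure μ] [IsFiniteMeasure ν] {a : ℝ}
    (ha : 0 < a) (hμ : Integrable (fun x => Real.exp (a * |x|)) μ)
    (hν : Integrable (fun x => Real.exp (a * |x|)) ν)
    (h : ∀ k : ℕ, ∫ x, x ^ k ∂μ = ∫ x, x ^ k ∂ν) : μ = ν := by
  set F := ProbabilityTheory.complexMGF id μ with hF
  set G := ProbabilityTheory.complexMGF id ν with hG
  set S : Set ℂ := {z | |z.re| < a} with hS
  have hFan : AnalyticOnNhd ℂ F S := fun z hz =>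
    ProbabilityTheory.analyticAt_complexMGF (mem_interior_integrableExpSet hμ hz)
  have hGan : AnalyticOnNhd ℂ G S := fun z hz =>
    ProbabilityTheory.analyticAt_complexMGF (mem_interior_integrableExpSet hν hz)
  have h0S : (0 : ℂ) ∈ S := by simpa [hS] using ha
  have hder : ∀ k : ℕ, iteratedDeriv k F 0 = iteratedDeriv k G 0 := by
    intro k
    rw [hF, hG, ProbabilityTheory.iteratedDeriv_complexMGF
        (mem_interior_integrableExpSet hμ (by simpa using ha)),
      ProbabilityTheory.iteratedDeriv_complexMGF
        (mem_interior_integrableExpSet hν (by simpa using ha))]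
    simp only [id, zero_mul, Complex.exp_zero, mul_one]
    have e : ∀ ρ : Measure ℝ, ∫ x : ℝ, (x : ℂ) ^ k ∂ρ = ((∫ x : ℝ, x ^ k ∂ρ : ℝ) : ℂ) := by
      intro ρ
      rw [← integral_complex_ofReal]
      simp
    rw [e, e, h k]
  have hev : F =ᶠ[nhds 0] G := by
    have h1 := (hFan 0 h0S).hasFPowerSeriesAt
    have h2 := (hGan 0 h0S).hasFPowerSeriesAt
    have h3 := h1.sub h2
    have h4 : (FormalMultilinearSeries.ofScalars ℂ
        (fun n => iteratedDeriv n F 0 / (n.factorial : ℂ))) -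
        FormalMultilinearSeries.ofScalars ℂ (fun n => iteratedDeriv n G 0 / (n.factorial : ℂ))
        = 0 := by
      simp only [hder, sub_self]
    rw [h4] at h3
    filter_upwards [h3.eventually_eq_zero] with z hz
    exact sub_eq_zero.1 hz
  have hconv : Convex ℝ S := by
    have : S = {z : ℂ | -a < z.re} ∩ {z : ℂ | z.re < a} := by
      ext z; simp [hS, abs_lt]
    rw [this]
    exact (convex_halfSpace_re_gt _).inter (convex_halfSpace_re_lt _)
  have heq := hFan.eqOn_of_preconnected_of_eventuallyEq hGan hconv.isPreconnected h0S hev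
  refine Measure.ext_of_charFun (funext fun t => ?_)
  rw [← ProbabilityTheory.complexMGF_id_mul_I, ← ProbabilityTheory.complexMGF_id_mul_I]
  exact heq (by simpa [hS] using ha)

/-- An exponentially decaying function with vanishing moments is zero: its positive and negative
parts are densities of measures with the same moments. -/
lemma ae_eq_zero_of_real_moments {v : ℝ → ℝ} {a : ℝ} (ha : 0 < a)
    (hv : Integrable fun y => Real.exp (a * |y|) * v y)
    (hint : ∀ k : ℕ, Integrable fun y => y ^ k * v y)
    (h : ∀ k : ℕ, ∫ y, y ^ k * v y = 0) : v =ᵐ[volume] 0 := by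
  have hv0 : Integrable v := by simpa using hint 0
  have hmp : AEMeasurable (fun y => ENNReal.ofReal (v y)) := hv0.aemeasurable.ennreal_ofReal
  have hmn : AEMeasurable (fun y => ENNReal.ofReal (-v y)) := hv0.neg.aemeasurable.ennreal_ofReal
  have fin : ∀ w : ℝ → ℝ, Integrable w → ∫⁻ y, ENNReal.ofReal (w y) ≠ ⊤ := fun w hw =>
    (hw.lintegral_lt_top).ne
  set μ := (volume : Measure ℝ).withDensity fun y => ENNReal.ofReal (v y) with hμ
  set ν := (volume : Measure ℝ).withDensity fun y => ENNReal.ofReal (-v y) with hν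
  have : IsFiniteMeasure μ := isFiniteMeasure_withDensity (fin _ hv0)
  have : IsFiniteMeasure ν := isFiniteMeasure_withDensity (fin _ hv0.neg)
  have itrans : ∀ w : ℝ → ℝ, Integrable w → ∀ φ : ℝ → ℝ, Measurable φ →
      Integrable (fun y => φ y * w y) →
      Integrable φ (volume.withDensity fun y => ENNReal.ofReal (w y)) := by
    intro w hw φ hφ hφw
    rw [integrable_withDensity_iff_integrable_smul₀' hw.aemeasurable.ennreal_ofReal
      (Eventually.of_forall fun y => ENNReal.ofReal_lt_top)]
    refine hφw.mono ((hw.aemeasurable.ennreal_ofReal.ennreal_toReal.mul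
      hφ.aemeasurable).aestronglyMeasurable) (Eventually.of_forall fun y => ?_)
    simp only [smul_eq_mul, norm_mul, Real.norm_eq_abs]
    rw [mul_comm]
    refine mul_le_mul_of_nonneg_left ?_ (abs_nonneg _)
    rw [abs_of_nonneg ENNReal.toReal_nonneg, ENNReal.toReal_ofReal']
    exact max_le (le_abs_self _) (abs_nonneg _)
  have ival : ∀ w : ℝ → ℝ, Integrable w → ∀ φ : ℝ → ℝ,
      ∫ y, φ y ∂(volume.withDensity fun y => ENNReal.ofReal (w y)) =
        ∫ y, max (w y) 0 * φ y := by
    intro w hw φ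
    rw [integral_withDensity_eq_integral_toReal_smul₀ hw.aemeasurable.ennreal_ofReal
      (Eventually.of_forall fun y => ENNReal.ofReal_lt_top)]
    simp only [smul_eq_mul, ENNReal.toReal_ofReal']
  have hmax : ∀ (w : ℝ → ℝ), Integrable w → ∀ k : ℕ, Integrable (fun y => y ^ k * w y) →
      Integrable fun y => max (w y) 0 * y ^ k := by
    intro w hw k hk
    refine hk.mono ((hw.aemeasurable.max aemeasurable_const).mul
      (by fun_prop)).aestronglyMeasurable (Eventually.of_forall fun y => ?_)
    simp only [norm_mul, Real.norm_eq_abs]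
    rw [mul_comm]
    refine mul_le_mul_of_nonneg_left ?_ (abs_nonneg _)
    rw [abs_of_nonneg (le_max_right _ _)]
    exact max_le (le_abs_self _) (abs_nonneg _)
  have hneg : ∀ k : ℕ, Integrable fun y => y ^ k * -v y := fun k => by
    simpa [mul_neg] using (hint k).neg
  have hmeas : μ = ν := by
    refine measure_ext_of_moments ha (itrans v hv0 _ (by fun_prop) hv)
      (itrans _ hv0.neg _ (by fun_prop) (by simpa using hv.neg)) fun k => ?_
    have e1 := ival v hv0 fun y => y ^ k
    have e2 := ival (fun y => -v y) hv0.neg fun y => y ^ k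
    rw [hμ, hν, e1, e2, ← sub_eq_zero, ← integral_sub (hmax v hv0 k (hint k))
      (hmax (fun y => -v y) hv0.neg k (hneg k))]
    refine Eq.trans ?_ (h k)
    refine integral_congr_ae (Eventually.of_forall fun y => ?_)
    simp only
    rcases le_total (v y) 0 with hy | hy
    · rw [max_eq_right hy, max_eq_left (by linarith)]; ring
    · rw [max_eq_left hy, max_eq_right (by linarith)]; ring
  have := (withDensity_eq_iff hmp hmn (fin _ hv0)).1 hmeas
  filter_upwards [this] with y hy
  rcases le_total (v y) 0 with h1 | h1
  · rw [ENNReal.ofReal_of_nonpos h1, eq_comm, ENNReal.ofReal_eq_zero] at hy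
    simp only [Pi.zero_apply]; linarith
  · rw [ENNReal.ofReal_of_nonpos (by linarith : -v y ≤ 0), ENNReal.ofReal_eq_zero] at hy
    simp only [Pi.zero_apply]; linarith

theorem ae_eq_zero_of_moments {u : ℝ → ℂ} {a : ℝ} (ha : 0 < a)
    (hu : Integrable fun y => (Real.exp (a * |y|) : ℂ) * u y)
    (hint : ∀ k : ℕ, Integrable fun y : ℝ => (y : ℂ) ^ k * u y)
    (h : ∀ k : ℕ, ∫ y : ℝ, (y : ℂ) ^ k * u y = 0) : u =ᵐ[volume] 0 := by
  have cre : ∀ (r : ℝ) (w : ℂ), ((r : ℂ) * w).re = r * w.re := Complex.re_ofReal_mul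
  have cim : ∀ (r : ℝ) (w : ℂ), ((r : ℂ) * w).im = r * w.im := Complex.im_ofReal_mul
  simp only [← Complex.ofReal_pow] at hint h
  have hre : (fun y => (u y).re) =ᵐ[volume] 0 := by
    refine ae_eq_zero_of_real_moments ha ?_ (fun k => ?_) fun k => ?_
    · simpa only [RCLike.re_to_complex, cre] using hu.re
    · simpa only [RCLike.re_to_complex, cre] using (hint k).re
    · have := congrArg Complex.re (h k)
      rw [← RCLike.re_to_complex, ← integral_re (hint k)] at this
      simpa only [RCLike.re_to_complex, cre, Complex.zero_re] using this
  have him : (fun y => (u y).im) =ᵐ[volume] 0 := by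
    refine ae_eq_zero_of_real_moments ha ?_ (fun k => ?_) fun k => ?_
    · simpa only [RCLike.im_to_complex, cim] using hu.im
    · simpa only [RCLike.im_to_complex, cim] using (hint k).im
    · have := congrArg Complex.im (h k)
      rw [← RCLike.im_to_complex, ← integral_im (hint k)] at this
      simpa only [RCLike.im_to_complex, cim, Complex.zero_im] using this
  filter_upwards [hre, him] with y h1 h2
  exact Complex.ext h1 h2

/-- The Gamma factor decays like `exp (-π |y| / 2)`, which leaves room for a factor `exp |y|`. -/
lemma memLp_pow_mul_exp_mul_Gamma (m : ℕ) :
    MemLp (fun y : ℝ => (1 + |y|) ^ m * Real.exp |y| * ‖Complex.Gamma (1 / 2 + Complex.I * y)‖) 2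
      volume := by
  have hc : Continuous fun y : ℝ =>
      (1 + |y|) ^ m * Real.exp |y| * ‖Complex.Gamma (1 / 2 + Complex.I * y)‖ :=
    (by fun_prop : Continuous fun y : ℝ => (1 + |y|) ^ m * Real.exp |y|).mul
      continuous_Gamma_half.norm
  rw [memLp_two_iff_integrable_sq hc.aestronglyMeasurable]
  have hpi : 0 < Real.pi - 2 := by linarith [Real.pi_gt_three]
  refine ((integrable_one_add_abs_pow_mul_exp (2 * m) hpi).const_mul (2 * Real.pi)).mono'
    (hc.pow 2).aestronglyMeasurable (Eventually.of_forall fun y => ?_)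
  rw [Real.norm_of_nonneg (by positivity), mul_pow, mul_pow, norm_Gamma_half_sq, div_eq_mul_inv,
    ← pow_mul, ← Real.exp_nat_mul, mul_comm m 2]
  have e : -(Real.pi - 2) * |y| = (2 : ℕ) * |y| + -Real.pi * |y| := by push_cast; ring
  rw [e, Real.exp_add]
  calc (1 + |y|) ^ (2 * m) * Real.exp ((2 : ℕ) * |y|) * (Real.pi * (Real.cosh (Real.pi * y))⁻¹)
      ≤ (1 + |y|) ^ (2 * m) * Real.exp ((2 : ℕ) * |y|) *
        (Real.pi * (2 * Real.exp (-Real.pi * |y|))) := by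
        have := Real.pi_pos
        gcongr
        exact inv_cosh_le_two_mul_exp y
    _ = _ := by ring

lemma integrable_mul_mul_conj_Gamma {h : ℝ → ℂ} (hh : MemLp h 2 (volume : Measure ℝ)) {w : ℝ → ℂ}
    (hw : Continuous w) {C : ℝ} {m : ℕ} (hb : ∀ y, ‖w y‖ ≤ C * ((1 + |y|) ^ m * Real.exp |y|)) :
    Integrable fun y : ℝ =>
      w y * (h y * starRingEnd ℂ (Complex.Gamma (1 / 2 + Complex.I * y))) := by
  have h1 := (memLp_pow_mul_exp_mul_Gamma m).integrable_mul hh.norm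
  refine (h1.const_mul C).mono' (hw.aestronglyMeasurable.mul (hh.aestronglyMeasurable.mul
    (Complex.continuous_conj.comp continuous_Gamma_half).aestronglyMeasurable))
    (Eventually.of_forall fun y => ?_)
  rw [norm_mul, norm_mul, RCLike.norm_conj]
  calc ‖w y‖ * (‖h y‖ * ‖Complex.Gamma (1 / 2 + Complex.I * y)‖)
      ≤ (C * ((1 + |y|) ^ m * Real.exp |y|)) *
        (‖h y‖ * ‖Complex.Gamma (1 / 2 + Complex.I * y)‖) := by gcongr; exact hb y
    _ = _ := by simp only [Pi.mul_apply]; ring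

/-- The closed span of the `psi n` is everything: a function orthogonal to all of them, multiplied
by the Gamma factor, has vanishing moments, since the recurrence turns orthogonality to the
polynomials into orthogonality to the monomials. -/
theorem topologicalClosure_span_psi :
    (Submodule.span ℂ (Set.range fun n : ℕ => (memLp_psi n).toLp (psi n))).topologicalClosure
      = ⊤ := by
  rw [Submodule.topologicalClosure_eq_top_iff, Submodule.eq_bot_iff]
  intro h hh
  rw [Submodule.mem_orthogonal] at hh
  have hmem := Lp.memLp h
  set u : ℝ → ℂ := fun y => h y * starRingEnd ℂ (Complex.Gamma (1 / 2 + Complex.I * y)) with hu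
  have hpow : ∀ (j : ℕ) (y : ℝ), ‖(y : ℂ) ^ j‖ ≤ (1 + |y|) ^ j := by
    intro j y
    rw [norm_pow, Complex.norm_real, Real.norm_eq_abs]
    gcongr
    linarith [abs_nonneg y]
  have hexp : ∀ y : ℝ, 1 ≤ Real.exp |y| := fun y => Real.one_le_exp (abs_nonneg y)
  have hint : ∀ j n : ℕ, Integrable fun y : ℝ => (y : ℂ) ^ j * meixnerPollaczek n y * u y := by
    intro j n
    obtain ⟨C, hC, hb⟩ := exists_norm_meixnerPollaczek_ofReal_le n
    refine integrable_mul_mul_conj_Gamma (C := C) (m := j + n) hmem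
      ((by fun_prop : Continuous fun y : ℝ => (y : ℂ) ^ j).mul
        (continuous_meixnerPollaczek_ofReal n)) fun y => ?_
    rw [norm_mul]
    calc _ ≤ (1 + |y|) ^ j * (C * (1 + |y|) ^ n) :=
          mul_le_mul (hpow j y) (hb y) (norm_nonneg _) (by positivity)
      _ = C * (1 + |y|) ^ (j + n) * 1 := by ring
      _ ≤ C * (1 + |y|) ^ (j + n) * Real.exp |y| := by gcongr; exact hexp y
      _ = _ := by ring
  have horth : ∀ j n : ℕ, ∫ y : ℝ, (y : ℂ) ^ j * meixnerPollaczek n y * u y = 0 := by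
    intro j
    induction j with
    | zero =>
      intro n
      have h1 := hh _ (Submodule.subset_span ⟨n, rfl⟩)
      have h2 := inner_toLp_psi n hmem
      rw [Lp.toLp_coeFn, h1] at h2
      have hs : (1 / (Real.sqrt Real.pi : ℂ)) ≠ 0 :=
        one_div_ne_zero (by exact_mod_cast (Real.sqrt_pos.2 Real.pi_pos).ne')
      apply mul_left_cancel₀ hs
      rw [mul_zero, h2, ← integral_const_mul]
      refine integral_congr_ae (Eventually.of_forall fun y => ?_)
      have h3 : starRingEnd ℂ (1 / (Real.sqrt Real.pi : ℂ)) = 1 / (Real.sqrt Real.pi : ℂ) := by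
        simp
      simp only [hu, psi, map_mul, h3, conj_meixnerPollaczek_ofReal]
      ring
    | succ j ih =>
      intro n
      have e : ∀ y : ℝ, (y : ℂ) ^ (j + 1) * meixnerPollaczek n y * u y =
          (n + 1) / 2 * ((y : ℂ) ^ j * meixnerPollaczek (n + 1) y * u y) +
            n / 2 * ((y : ℂ) ^ j * meixnerPollaczek (n - 1) y * u y) := by
        intro y
        have := two_mul_meixnerPollaczek n y
        rw [pow_succ]
        linear_combination ((y : ℂ) ^ j * u y / 2) * this
      simp only [e]
      rw [integral_add ((hint _ _).const_mul _) ((hint _ _).const_mul _), integral_const_mul,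
        integral_const_mul, ih, ih]
      simp
  have hu0 : u =ᵐ[volume] 0 := by
    refine ae_eq_zero_of_moments (a := 1) zero_lt_one ?_ (fun k => ?_) fun k => ?_
    · refine integrable_mul_mul_conj_Gamma (C := 1) (m := 0) hmem
        (Complex.continuous_ofReal.comp (by fun_prop)) fun y => ?_
      rw [Complex.norm_real, Real.norm_of_nonneg (Real.exp_pos _).le]
      simp
    · simpa [meixnerPollaczek_zero] using hint k 0
    · simpa [meixnerPollaczek_zero] using horth k 0
  rw [Lp.eq_zero_iff_ae_eq_zero]
  filter_upwards [hu0] with y hy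
  have hne : starRingEnd ℂ (Complex.Gamma (1 / 2 + Complex.I * y)) ≠ 0 := by
    rw [Ne, map_eq_zero]
    exact Complex.Gamma_ne_zero_of_re_pos (by simp)
  exact (mul_eq_zero.1 hy).resolve_right hne

/-! ### The coefficients -/

lemma norm_Gamma_le_Gamma_re {s : ℂ} (hs : 0 < s.re) : ‖Complex.Gamma s‖ ≤ Real.Gamma s.re := by
  rw [Complex.Gamma_eq_integral hs, Real.Gamma_eq_integral hs, Complex.GammaIntegral]
  refine (norm_integral_le_integral_norm _).trans (le_of_eq ?_)
  refine setIntegral_congr_fun measurableSet_Ioi fun x hx => ?_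
  simp only [norm_mul]
  rw [Complex.norm_cpow_eq_rpow_re_of_pos hx, Complex.norm_real,
    Real.norm_of_nonneg (Real.exp_pos _).le]
  simp

lemma norm_cos_le_exp_abs_im (z : ℂ) : ‖Complex.cos z‖ ≤ Real.exp |z.im| := by
  have h1 : ‖Complex.exp (z * Complex.I)‖ ≤ Real.exp |z.im| := by
    rw [Complex.norm_exp]
    refine Real.exp_le_exp.2 ?_
    simpa using neg_le_abs z.im
  have h2 : ‖Complex.exp (-z * Complex.I)‖ ≤ Real.exp |z.im| := by
    rw [Complex.norm_exp]
    refine Real.exp_le_exp.2 ?_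
    simpa using le_abs_self z.im
  rw [Complex.cos, norm_div, Complex.norm_two]
  have := norm_add_le (Complex.exp (z * Complex.I)) (Complex.exp (-z * Complex.I))
  linarith

lemma stripGrowth_cos_pi {a : ℝ} : StripGrowth (fun z => Complex.cos (Real.pi * z)) a := by
  refine ⟨Real.pi, 1, fun z _ _ hz => (norm_cos_le_exp_abs_im _).trans ?_⟩
  rw [one_mul]
  refine Real.exp_le_exp.2 ?_
  have : |(Real.pi * z : ℂ).im| = Real.pi * |z.im| := by
    simp [abs_mul, abs_of_pos Real.pi_pos]
  rw [this]
  exact mul_le_mul_of_nonneg_left (self_le_rpow_three_half hz) Real.pi_pos.le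

lemma one_le_norm_of_one_le_abs_im {w : ℂ} (h : 1 ≤ |w.im|) : 1 ≤ ‖w‖ :=
  h.trans (Complex.abs_im_le_norm w)

/-- Vertical growth of `1 / Γ`, from the reflection formula on the first strip and the functional
equation on the others. -/
lemma stripGrowth_inv_Gamma_half (K : ℕ) :
    StripGrowth (fun z => (Complex.Gamma (1 / 2 + z))⁻¹) K := by
  induction K with
  | zero =>
    have hcont : ContinuousOn Real.Gamma (Set.Icc (1 / 2) (3 / 2)) := fun x hx =>
      (Real.differentiableAt_Gamma fun m => by
        have : (0 : ℝ) ≤ m := Nat.cast_nonneg m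
        linarith [hx.1]).continuousAt.continuousWithinAt
    obtain ⟨M, hM⟩ := isCompact_Icc.exists_bound_of_continuousOn hcont
    have hmul : StripGrowth (fun z => (M : ℂ) * Complex.cos (Real.pi * z)) ((0 : ℕ) : ℝ) :=
      (stripGrowth_const (M : ℂ) _).mul stripGrowth_cos_pi
    refine hmul.mono fun z h0 h1 hz => ?_
    rw [Nat.cast_zero] at h0 h1
    have hcos : Complex.cos (Real.pi * z) ≠ 0 := by
      have := cosh_le_four_mul_norm_cos hz
      have h2 := Real.cosh_pos (Real.pi * z.im)
      exact norm_pos_iff.1 (by linarith)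
    have hp : (Real.pi : ℂ) ≠ 0 := by exact_mod_cast Real.pi_ne_zero
    have hrefl := Gamma_half_sub_mul_Gamma_half_add z
    have hne : Complex.Gamma (1 / 2 + z) ≠ 0 := by
      intro h
      rw [h, mul_zero] at hrefl
      exact div_ne_zero hp hcos hrefl.symm
    have hinv : (Complex.Gamma (1 / 2 + z))⁻¹ =
        Complex.Gamma (1 / 2 - z) * Complex.cos (Real.pi * z) / Real.pi := by
      rw [eq_div_iff hcos] at hrefl
      rw [inv_eq_one_div, div_eq_div_iff hne hp]
      linear_combination -hrefl
    have hhalf : (1 / 2 - z) ≠ 0 := by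
      intro h
      have := congrArg Complex.im h
      simp at this
      rw [this, abs_zero] at hz
      linarith
    have hfe := Complex.Gamma_add_one (1 / 2 - z) hhalf
    have hG1 : ‖Complex.Gamma (1 / 2 - z + 1)‖ ≤ M := by
      have hre : (1 / 2 - z + 1).re = 3 / 2 - z.re := by
        simp; norm_num; ring
      refine (norm_Gamma_le_Gamma_re (by rw [hre]; linarith)).trans ?_
      rw [hre]
      exact (le_abs_self _).trans (hM _ ⟨by linarith, by linarith⟩)
    have hone : 1 ≤ ‖1 / 2 - z‖ := one_le_norm_of_one_le_abs_im (by simpa using hz)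
    have hG : ‖Complex.Gamma (1 / 2 - z)‖ ≤ M := by
      rw [hfe, norm_mul] at hG1
      nlinarith [norm_nonneg (Complex.Gamma (1 / 2 - z))]
    have hpi1 : 1 ≤ ‖(Real.pi : ℂ)‖ := by
      rw [Complex.norm_real, Real.norm_of_nonneg Real.pi_pos.le]
      linarith [Real.pi_gt_three]
    rw [hinv, norm_div]
    refine (div_le_self (norm_nonneg _) hpi1).trans ?_
    rw [norm_mul, norm_mul, Complex.norm_real]
    exact mul_le_mul_of_nonneg_right (hG.trans (le_abs_self M)) (norm_nonneg _)
  | succ K ih =>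
    obtain ⟨B, C, h⟩ := ih
    refine ⟨B, C, fun z h0 h1 hz => ?_⟩
    push_cast at h0 h1
    have := h (z - 1) (by simp; linarith) (by simp; linarith) (by simpa using hz)
    have him : (z - 1).im = z.im := by simp
    rw [him] at this
    have hn : 1 ≤ ‖1 / 2 + (z - 1)‖ := one_le_norm_of_one_le_abs_im (by simpa using hz)
    have hne : (1 / 2 + (z - 1)) ≠ 0 := norm_pos_iff.1 (by linarith)
    have hfe := Complex.Gamma_add_one _ hne
    rw [show 1 / 2 + (z - 1) + 1 = 1 / 2 + z by ring] at hfe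
    change ‖(Complex.Gamma (1 / 2 + z))⁻¹‖ ≤ _
    change ‖(Complex.Gamma (1 / 2 + (z - 1)))⁻¹‖ ≤ _ at this
    rw [hfe, norm_inv, norm_mul]
    rw [norm_inv] at this
    refine le_trans ?_ this
    rw [mul_inv]
    exact mul_le_of_le_one_left (by positivity) (inv_le_one_of_one_le₀ hn)

/-- The functional equation, with `|K + 1/2 + i y| ≥ K + 1/2` at each step. -/
lemma factorial_mul_norm_Gamma_le (K : ℕ) (y : ℝ) :
    ((K + 1).factorial : ℝ) * ‖Complex.Gamma (1 / 2 + Complex.I * y)‖ ≤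
      2 * (K + 1) * ‖Complex.Gamma (1 / 2 + ((K + 1 : ℕ) + Complex.I * y))‖ := by
  have step : ∀ K : ℕ, ((K : ℝ) + 1 / 2) * ‖Complex.Gamma (1 / 2 + (K + Complex.I * y))‖ ≤
      ‖Complex.Gamma (1 / 2 + ((K + 1 : ℕ) + Complex.I * y))‖ := by
    intro K
    have hre : (1 / 2 + (K + Complex.I * y) : ℂ).re = K + 1 / 2 := by simp; ring
    have hK : (0 : ℝ) ≤ K := Nat.cast_nonneg K
    have hne : (1 / 2 + (K + Complex.I * y) : ℂ) ≠ 0 := by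
      intro h
      rw [h] at hre
      simp at hre
      linarith
    rw [show (1 / 2 + ((K + 1 : ℕ) + Complex.I * y) : ℂ) = 1 / 2 + (K + Complex.I * y) + 1 by
      push_cast; ring, Complex.Gamma_add_one _ hne, norm_mul]
    refine mul_le_mul_of_nonneg_right ?_ (norm_nonneg _)
    rw [← hre]
    exact Complex.re_le_norm _
  induction K with
  | zero =>
    have := step 0
    simp at this ⊢
    linarith
  | succ K ih =>
    have h := step (K + 1)
    rw [Nat.factorial_succ]
    push_cast at h ih ⊢
    have hK : (0 : ℝ) ≤ K := Nat.cast_nonneg K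
    set a := ‖Complex.Gamma (1 / 2 + Complex.I * y)‖
    set b := ‖Complex.Gamma (1 / 2 + (K + 1 + Complex.I * y))‖
    have hb : 0 ≤ b := norm_nonneg _
    calc ((K : ℝ) + 1 + 1) * ((K + 1).factorial : ℝ) * a
        = (K + 1 + 1) * (((K + 1).factorial : ℝ) * a) := by ring
      _ ≤ (K + 1 + 1) * (2 * (K + 1) * b) := by gcongr
      _ ≤ 2 * (K + 1 + 1) * ((K + 1 + 1 / 2) * b) := by nlinarith [mul_nonneg hK hb]
      _ ≤ _ := by gcongr

lemma norm_Gamma_half_le (y : ℝ) :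
    ‖Complex.Gamma (1 / 2 + Complex.I * y)‖ ≤ 3 * Real.exp (-1 * |y|) := by
  refine le_of_sq_le_sq ?_ (by positivity)
  rw [norm_Gamma_half_sq, mul_pow, ← Real.exp_nat_mul, div_eq_mul_inv]
  have h1 := inv_cosh_le_two_mul_exp y
  have h2 : Real.exp (-Real.pi * |y|) ≤ Real.exp ((2 : ℕ) * (-1 * |y|)) := by
    refine Real.exp_le_exp.2 ?_
    push_cast
    nlinarith [abs_nonneg y, Real.pi_gt_three]
  calc Real.pi * (Real.cosh (Real.pi * y))⁻¹
      ≤ Real.pi * (2 * Real.exp ((2 : ℕ) * (-1 * |y|))) := by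
        have := Real.pi_pos
        gcongr
        exact h1.trans (by gcongr)
    _ ≤ _ := by nlinarith [Real.pi_lt_four, Real.exp_pos ((2 : ℕ) * (-1 * |y|))]

lemma norm_inv_Gamma_div_cosh (y : ℝ) :
    ‖(Complex.Gamma (1 / 2 + Complex.I * y))⁻¹‖ / Real.cosh (Real.pi * y) =
      ‖Complex.Gamma (1 / 2 + Complex.I * y)‖ / Real.pi := by
  have h := norm_Gamma_half_sq y
  have hc := Real.cosh_pos (Real.pi * y)
  have hp := Real.pi_pos
  have hG : 0 < ‖Complex.Gamma (1 / 2 + Complex.I * y)‖ :=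
    norm_pos_iff.2 (Complex.Gamma_ne_zero_of_re_pos (by simp))
  rw [eq_div_iff hc.ne'] at h
  rw [norm_inv, inv_eq_one_div, div_div, div_eq_div_iff (mul_pos hG hc).ne' hp.ne']
  linear_combination -h

/-- Decay of `1 / (Γ (1/2 + z) cosh (π y))` on the vertical lines `Re z = K + 1`. -/
lemma norm_inv_Gamma_shift_div_cosh_le (K : ℕ) (y : ℝ) :
    ‖(Complex.Gamma (1 / 2 + ((K + 1 : ℕ) + Complex.I * y)))⁻¹‖ / Real.cosh (Real.pi * y) ≤
      2 * (K + 1) / ((K + 1).factorial : ℝ) * Real.exp (-1 * |y|) := by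
  have h := factorial_mul_norm_Gamma_le K y
  have hf : (0 : ℝ) < (K + 1).factorial := by exact_mod_cast (K + 1).factorial_pos
  have hG : 0 < ‖Complex.Gamma (1 / 2 + Complex.I * y)‖ :=
    norm_pos_iff.2 (Complex.Gamma_ne_zero_of_re_pos (by simp))
  have hG' : 0 < ‖Complex.Gamma (1 / 2 + ((K + 1 : ℕ) + Complex.I * y))‖ := by
    by_contra hcon
    have : ‖Complex.Gamma (1 / 2 + ((K + 1 : ℕ) + Complex.I * y))‖ = 0 :=
      le_antisymm (not_lt.1 hcon) (norm_nonneg _)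
    rw [this, mul_zero] at h
    exact absurd h (not_le.2 (mul_pos hf hG))
  have h1 : ‖(Complex.Gamma (1 / 2 + ((K + 1 : ℕ) + Complex.I * y)))⁻¹‖ ≤
      2 * (K + 1) / ((K + 1).factorial : ℝ) * ‖(Complex.Gamma (1 / 2 + Complex.I * y))⁻¹‖ := by
    rw [norm_inv, norm_inv, ← div_eq_mul_inv, inv_eq_one_div, div_div,
      div_le_div_iff₀ hG' (by positivity)]
    linarith
  calc _ ≤ 2 * (K + 1) / ((K + 1).factorial : ℝ) * ‖(Complex.Gamma (1 / 2 + Complex.I * y))⁻¹‖ /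
        Real.cosh (Real.pi * y) := by gcongr
    _ = 2 * (K + 1) / ((K + 1).factorial : ℝ) *
        (‖Complex.Gamma (1 / 2 + Complex.I * y)‖ / Real.pi) := by
        rw [mul_div_assoc, norm_inv_Gamma_div_cosh]
    _ ≤ _ := by
        gcongr
        rw [div_le_iff₀ Real.pi_pos]
        have := norm_Gamma_half_le y
        nlinarith [Real.pi_gt_three, Real.exp_pos (-1 * |y|)]

lemma pow_le_factorial_mul_exp {x : ℝ} (hx : 0 ≤ x) (m : ℕ) :
    x ^ m ≤ m.factorial * Real.exp x := by
  have := Real.pow_div_factorial_le_exp x hx m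
  rwa [div_le_iff₀ (by positivity), mul_comm] at this

lemma one_add_norm_nat_add_le (K : ℕ) (y : ℝ) :
    1 + ‖(K + Complex.I * y : ℂ)‖ ≤ (1 + K) * (1 + |y|) := by
  have := norm_add_le (K : ℂ) (Complex.I * y)
  rw [norm_mul, Complex.norm_I, one_mul, Complex.norm_real, Complex.norm_natCast,
    Real.norm_eq_abs] at this
  nlinarith [abs_nonneg y, Nat.cast_nonneg (α := ℝ) K,
    mul_nonneg (Nat.cast_nonneg (α := ℝ) K) (abs_nonneg y)]

lemma norm_sample_le {f : ℂ → ℂ} {C ε : ℝ} (h : ∀ x : ℝ, 0 ≤ x → ‖f x‖ ≤ C * Real.exp (ε * x))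
    (N : ℕ) : ‖sample f N‖ ≤ C * Real.exp (ε * (N + 1 / 2)) := by
  have := h (N + 1 / 2) (by positivity)
  push_cast at this
  exact this

theorem summable_coeffTerm {f : ℂ → ℂ} {C : ℝ} (h : ∀ x : ℝ, 0 ≤ x → ‖f x‖ ≤ C * Real.exp (1 * x))
    (n : ℕ) : Summable (coeffTerm f n) := by
  obtain ⟨D, hD, hP⟩ := exists_norm_meixnerPollaczek_le n
  have hC : 0 ≤ C := by
    have := (norm_nonneg _).trans (h 0 le_rfl)
    exact nonneg_of_mul_nonneg_left this (Real.exp_pos _)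
  refine Summable.of_norm_bounded
    (g := fun N : ℕ => C * Real.exp 1 * D * n.factorial * Real.exp 2 *
      (Real.exp 2 ^ N / N.factorial)) ((Real.summable_pow_div_factorial _).mul_left _) fun N => ?_
  have hz : ‖-Complex.I * ((N : ℂ) + 1 / 2)‖ ≤ N + 1 := by
    rw [norm_mul, norm_neg, Complex.norm_I, one_mul]
    refine (norm_add_le _ _).trans ?_
    rw [Complex.norm_natCast]
    norm_num
  have h1 : ‖meixnerPollaczek n (-Complex.I * ((N : ℂ) + 1 / 2))‖ ≤
      D * (n.factorial * Real.exp (N + 2)) := by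
    refine (hP _).trans ?_
    gcongr
    exact (pow_le_pow_left₀ (by positivity) (by linarith) n).trans
      (pow_le_factorial_mul_exp (by positivity) n)
  have h2 : ‖sample f N‖ ≤ C * Real.exp (N + 1) := by
    refine (norm_sample_le h N).trans ?_
    gcongr
    linarith
  rw [coeffTerm, norm_mul, norm_mul, norm_div, norm_pow, norm_neg, norm_one, one_pow,
    Complex.norm_natCast]
  calc 1 / (N.factorial : ℝ) * ‖sample f N‖ * ‖meixnerPollaczek n (-Complex.I * ((N : ℂ) + 1 / 2))‖
      ≤ 1 / (N.factorial : ℝ) * (C * Real.exp (N + 1)) *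
        (D * (n.factorial * Real.exp (N + 2))) := by gcongr
    _ = _ := by
        rw [Real.exp_add, Real.exp_add, ← Real.exp_nat_mul, show (N : ℝ) * 2 = N + N by ring,
          Real.exp_add]
        ring

lemma tendsto_succ_pow_mul_exp_div_factorial (m : ℕ) :
    Tendsto (fun K : ℕ => ((K : ℝ) + 2) ^ m * Real.exp (K + 1) / ((K + 1).factorial : ℝ)) atTop
      (nhds 0) := by
  have h := ((FloorSemiring.tendsto_pow_div_factorial_atTop (Real.exp 2)).comp
    (tendsto_add_atTop_nat 1)).const_mul (m.factorial * Real.exp 1)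
  rw [mul_zero] at h
  refine squeeze_zero (fun K => by positivity) (fun K => ?_) h
  have h1 := pow_le_factorial_mul_exp (x := (K : ℝ) + 2) (by positivity) m
  simp only [Function.comp]
  rw [← mul_div_assoc]
  refine div_le_div_of_nonneg_right ?_ (by positivity)
  calc ((K : ℝ) + 2) ^ m * Real.exp (K + 1)
      ≤ m.factorial * Real.exp (K + 2) * Real.exp (K + 1) := by gcongr
    _ = _ := by
      rw [← Real.exp_nat_mul, mul_assoc, mul_assoc, ← Real.exp_add, ← Real.exp_add]
      push_cast
      ring_nf

/-- The Fourier coefficients of `y ↦ f (i y)` with respect to the `psi n` are given by the residue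
series. By the reflection formula `conj (psi n y)` is, up to a constant, the boundary value of
`P_n (-i z) / (Γ (1/2 + z) cos (π z))`, and `Γ (1/2 + z)` takes the value `N!` at `z = N + 1/2`. -/
theorem inner_psi_eq_coeff {f : ℂ → ℂ}
    (hd : DifferentiableOn ℂ f {z | 0 < z.re}) (hc : ContinuousOn f {z | 0 ≤ z.re})
    (hexp : ∃ C : ℝ, ∀ z : ℂ, 0 ≤ z.re → ‖f z‖ ≤ C * Real.exp (‖z‖ ^ (3 / 2 : ℝ)))
    (hL2 : MemLp (fun y : ℝ => f (Complex.I * (y : ℂ))) 2 volume)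
    (hre : ∃ C : ℝ, ∀ x : ℝ, 0 ≤ x → ‖f x‖ ≤ C * Real.exp (1 * x))
    (hgrow : ∃ C : ℝ, 0 ≤ C ∧
      ∀ z : ℂ, 1 ≤ z.re → ‖f z‖ ≤ C * (1 + ‖z‖) * Real.exp (1 * z.re)) (n : ℕ) :
    inner ℂ ((memLp_psi n).toLp (psi n)) (hL2.toLp _) = coeff f n := by
  obtain ⟨C₁, hC₁⟩ := hexp
  obtain ⟨C, hC, hf⟩ := hgrow
  obtain ⟨C₂, hC₂⟩ := hre
  obtain ⟨D, hD, hP⟩ := exists_norm_meixnerPollaczek_le n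
  set G : ℂ → ℂ := fun z =>
    f z * meixnerPollaczek n (-Complex.I * z) * (Complex.Gamma (1 / 2 + z))⁻¹ with hG
  have hPd : Differentiable ℂ fun z => meixnerPollaczek n (-Complex.I * z) :=
    (differentiable_meixnerPollaczek n).comp (by fun_prop)
  have hΓd : Differentiable ℂ fun z => (Complex.Gamma (1 / 2 + z))⁻¹ :=
    Complex.differentiable_one_div_Gamma.comp
      (by fun_prop : Differentiable ℂ fun z : ℂ => 1 / 2 + z)
  have hGc : ContinuousOn G {z | 0 ≤ z.re} :=
    (hc.mul hPd.continuous.continuousOn).mul hΓd.continuous.continuousOn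
  have hzero : ∀ y : ℝ, G (Complex.I * y) / (Real.cosh (Real.pi * y) : ℂ) =
      1 / (Real.sqrt Real.pi : ℂ) * (f (Complex.I * y) * starRingEnd ℂ (psi n y)) := by
    intro y
    have hne : Complex.Gamma (1 / 2 + Complex.I * y) ≠ 0 :=
      Complex.Gamma_ne_zero_of_re_pos (by simp)
    have hcosh : (Real.cosh (Real.pi * y) : ℂ) ≠ 0 := by
      exact_mod_cast (Real.cosh_pos (Real.pi * y)).ne'
    have hp : (Real.pi : ℂ) ≠ 0 := by exact_mod_cast Real.pi_ne_zero
    have hrefl := Gamma_half_sub_mul_Gamma_half_add (Complex.I * y)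
    rw [cos_pi_mul_I] at hrefl
    have h2 : (1 / (Real.sqrt Real.pi : ℂ)) * (1 / (Real.sqrt Real.pi : ℂ)) = 1 / Real.pi := by
      rw [div_mul_div_comm, ← Complex.ofReal_mul, Real.mul_self_sqrt Real.pi_pos.le, one_mul]
    have h3 : starRingEnd ℂ (1 / (Real.sqrt Real.pi : ℂ)) = 1 / (Real.sqrt Real.pi : ℂ) := by simp
    have h4 : (Complex.Gamma (1 / 2 + Complex.I * y))⁻¹ / (Real.cosh (Real.pi * y) : ℂ) =
        Complex.Gamma (1 / 2 - Complex.I * y) * (1 / Real.pi) := by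
      rw [eq_div_iff hcosh] at hrefl
      rw [inv_eq_one_div, div_div, mul_one_div, div_eq_div_iff (mul_ne_zero hne hcosh) hp]
      linear_combination -hrefl
    have h5 : -Complex.I * (Complex.I * y) = y := by
      linear_combination (-(y : ℂ)) * Complex.I_mul_I
    simp only [hG, psi, map_mul, h3, conj_meixnerPollaczek_ofReal, conj_Gamma_half, h5]
    rw [mul_div_assoc, h4, ← h2]
    ring
  have hbound : ∀ (K : ℕ) (y : ℝ),
      ‖G ((K + 1 : ℕ) + Complex.I * y) / (Real.cosh (Real.pi * y) : ℂ)‖ ≤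
      2 * C * D * (((K : ℝ) + 2) ^ (n + 2) * Real.exp (K + 1) / ((K + 1).factorial : ℝ)) *
        ((1 + |y|) ^ (n + 1) * Real.exp (-1 * |y|)) := by
    intro K y
    have hK : (0 : ℝ) ≤ K := Nat.cast_nonneg K
    have e1 := one_add_norm_nat_add_le (K + 1) y
    set z : ℂ := (K + 1 : ℕ) + Complex.I * y with hz
    have hzre : z.re = K + 1 := by simp [hz]
    have e1' : 1 + ‖z‖ ≤ (K + 2) * (1 + |y|) := by
      refine e1.trans (le_of_eq ?_)
      push_cast
      ring
    have e2 : ‖f z‖ ≤ C * ((K + 2) * (1 + |y|)) * Real.exp (K + 1) := by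
      refine (hf z (by rw [hzre]; linarith)).trans ?_
      rw [hzre, one_mul]
      gcongr
    have e3 : ‖meixnerPollaczek n (-Complex.I * z)‖ ≤ D * ((K + 2) * (1 + |y|)) ^ n := by
      refine (hP _).trans ?_
      rw [norm_mul, norm_neg, Complex.norm_I, one_mul]
      gcongr
    have e4 := norm_inv_Gamma_shift_div_cosh_le K y
    rw [← hz] at e4
    have hcosh := Real.cosh_pos (Real.pi * y)
    simp only [hG]
    rw [norm_div, norm_mul, norm_mul, Complex.norm_real, Real.norm_of_nonneg hcosh.le,
      mul_div_assoc]
    calc ‖f z‖ * ‖meixnerPollaczek n (-Complex.I * z)‖ *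
        (‖(Complex.Gamma (1 / 2 + z))⁻¹‖ / Real.cosh (Real.pi * y))
        ≤ (C * ((K + 2) * (1 + |y|)) * Real.exp (K + 1)) * (D * ((K + 2) * (1 + |y|)) ^ n) *
          (2 * (K + 1) / ((K + 1).factorial : ℝ) * Real.exp (-1 * |y|)) := by gcongr
      _ ≤ (C * ((K + 2) * (1 + |y|)) * Real.exp (K + 1)) * (D * ((K + 2) * (1 + |y|)) ^ n) *
          (2 * (K + 2) / ((K + 1).factorial : ℝ) * Real.exp (-1 * |y|)) := by
          gcongr
          linarith
      _ = _ := by rw [mul_pow]; ring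
  have hint : ∀ K : ℕ, Integrable fun y : ℝ =>
      G (K + Complex.I * y) / (Real.cosh (Real.pi * y) : ℂ) := by
    intro K
    cases K with
    | zero =>
      simp only [Nat.cast_zero, zero_add, hzero]
      refine Integrable.const_mul ?_ _
      have := hL2.integrable_mul (memLp_psi n).star
      exact this
    | succ K =>
      refine ((integrable_one_add_abs_pow_mul_exp (n + 1) one_pos).const_mul _).mono' ?_
        (Eventually.of_forall (hbound K))
      have : Continuous fun y : ℝ => G ((K + 1 : ℕ) + Complex.I * y) :=
        hGc.comp_continuous (by fun_prop) fun y => by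
          simp only [Set.mem_ofPred_eq]
          simp
          positivity
      simp only [div_eq_mul_inv, ← Complex.ofReal_inv]
      exact (this.mul (Complex.continuous_ofReal.comp continuous_inv_cosh)).aestronglyMeasurable
  have hlim : Tendsto (fun K : ℕ =>
      ∫ y : ℝ, G (K + Complex.I * y) / (Real.cosh (Real.pi * y) : ℂ)) atTop (nhds 0) := by
    rw [← tendsto_add_atTop_iff_nat 1]
    have h := ((tendsto_succ_pow_mul_exp_div_factorial (n + 2)).const_mul (2 * C * D)).mul_const
      (∫ y : ℝ, (1 + |y|) ^ (n + 1) * Real.exp (-1 * |y|))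
    rw [mul_zero, zero_mul] at h
    refine squeeze_zero_norm (fun K => ?_) h
    rw [← integral_const_mul]
    exact norm_integral_le_of_norm_le
      ((integrable_one_add_abs_pow_mul_exp (n + 1) one_pos).const_mul _)
      (Eventually.of_forall (hbound K))
  have hmain := tendsto_alternating_sum_of_halfPlane (G := G)
    ((hd.mul hPd.differentiableOn).mul hΓd.differentiableOn) hGc (fun K => ?_) hint hlim
  · have hterm : ∀ N : ℕ, (-1) ^ N * G (N + 1 / 2) = coeffTerm f n N := by
      intro N
      simp only [hG, coeffTerm, sample]
      rw [show (1 / 2 + ((N : ℂ) + 1 / 2)) = N + 1 by ring, Complex.Gamma_nat_eq_factorial]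
      ring
    simp only [hterm] at hmain
    have hs := ((summable_coeffTerm hC₂ n).hasSum.tendsto_sum_nat).const_mul 2
    have heq := tendsto_nhds_unique hmain hs
    simp only [hzero, integral_const_mul] at heq
    rw [inner_toLp_psi, coeff]
    field_simp at heq
    linear_combination heq
  · have hK : (0 : ℝ) ≤ K := Nat.cast_nonneg K
    refine ((stripGrowth_of_norm_le (B := 1) (C := C₁) hK zero_le_one fun z h0 _ _ => ?_).mul
      (stripGrowth_of_norm_le_pow (C := D) (n := n) hK fun z _ _ _ => ?_)).mul
      (stripGrowth_inv_Gamma_half K)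
    · rw [one_mul]; exact hC₁ z (hK.trans h0)
    · simpa using hP (-Complex.I * z)

/-! ### The interpolation formula -/

lemma sincPi_eq_sinc (t : ℝ) : sincPi t = Real.sinc (Real.pi * t) := by
  rw [sincPi, Real.sinc]
  simp [Real.pi_ne_zero]

lemma abs_sincPi_le_one (t : ℝ) : |sincPi t| ≤ 1 := by
  rw [sincPi_eq_sinc]
  exact Real.abs_sinc_le_one _

lemma abs_mul_abs_sincPi_le_one (t : ℝ) : |t| * |sincPi t| ≤ 1 := by
  rw [sincPi]
  split_ifs with h
  · simp [h]
  · have ht : 0 < |t| := abs_pos.2 h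
    rw [abs_div, abs_mul, abs_of_pos Real.pi_pos, ← mul_div_assoc,
      div_le_one (mul_pos Real.pi_pos ht)]
    nlinarith [Real.abs_sin_le_one (Real.pi * t), Real.pi_gt_three]

lemma sincPi_natCast_sub {m N : ℕ} (h : m ≠ N) : sincPi ((m : ℝ) - N) = 0 := by
  have h0 : (m : ℝ) - N ≠ 0 := sub_ne_zero.2 (by exact_mod_cast h)
  rw [sincPi, if_neg h0]
  have : Real.sin (Real.pi * ((m : ℝ) - N)) = 0 := by
    have := Real.sin_int_mul_pi ((m : ℤ) - N)
    push_cast at this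
    rwa [mul_comm] at this
  rw [this, zero_div]

lemma sincPi_sub_natCast {x : ℝ} {N : ℕ} (h : x ≠ N) :
    sincPi (x - N) = (-1) ^ N * Real.sin (Real.pi * x) / (Real.pi * (x - N)) := by
  rw [sincPi, if_neg (sub_ne_zero.2 h), mul_sub, mul_comm Real.pi (N : ℝ), Real.sin_sub_nat_mul_pi]

lemma summable_sample_mul_sincPi {f : ℂ → ℂ}
    (hsum : Summable (fun N : ℕ => ‖sample f (N + 1)‖ / ((N : ℝ) + 1))) (x : ℝ) :
    Summable (fun N : ℕ => sample f N * (sincPi (x - N) : ℂ)) := by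
  rw [← summable_nat_add_iff 1]
  refine Summable.of_norm_bounded (hsum.mul_left (|x| + 1)) fun N => ?_
  have hN : (0 : ℝ) < N + 1 := by positivity
  rw [norm_mul, Complex.norm_real, Real.norm_eq_abs]
  set t : ℝ := x - (N + 1 : ℕ) with ht
  have h1 := abs_sincPi_le_one t
  have h2 := abs_mul_abs_sincPi_le_one t
  have h3 : (N : ℝ) + 1 ≤ |x| + |t| := by
    have e : (N : ℝ) + 1 = x - t := by rw [ht]; push_cast; ring
    rw [e]
    exact (le_abs_self _).trans (abs_sub _ _)
  have h4 : |sincPi t| ≤ (|x| + 1) / (N + 1) := by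
    rw [le_div_iff₀ hN]
    nlinarith [abs_nonneg (sincPi t), abs_nonneg x, mul_le_mul_of_nonneg_left h1 (abs_nonneg x)]
  calc ‖sample f (N + 1)‖ * |sincPi t| ≤ ‖sample f (N + 1)‖ * ((|x| + 1) / (N + 1)) := by gcongr
    _ = _ := by ring

lemma integrable_of_bound_outside {φ : ℝ → ℂ} (hφ : Continuous φ) {b : ℝ → ℝ} (hb : Integrable b)
    (hb0 : ∀ y, 0 ≤ b y) (h : ∀ y, 1 ≤ |y| → ‖φ y‖ ≤ b y) : Integrable φ := by
  obtain ⟨M, hM⟩ := (isCompact_Icc (a := (-1 : ℝ)) (b := 1)).exists_bound_of_continuousOn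
    hφ.continuousOn
  refine ((integrable_inv_one_add_sq.const_mul (2 * |M|)).add hb).mono'
    hφ.aestronglyMeasurable (Eventually.of_forall fun y => ?_)
  simp only [Pi.add_apply]
  rcases le_total 1 |y| with hy | hy
  · have : 0 ≤ 2 * |M| * (1 + y ^ 2)⁻¹ := by positivity
    linarith [h y hy]
  · have h1 := hM y (abs_le.1 hy)
    have h2 : (1 : ℝ) / 2 ≤ (1 + y ^ 2)⁻¹ := by
      rw [one_div]
      refine inv_anti₀ (by positivity) ?_
      nlinarith [sq_abs y, abs_nonneg y]
    nlinarith [hb0 y, le_abs_self M, abs_nonneg M]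

lemma integral_univ_inv_sq_add_sq {w : ℝ} (hw : 0 < w) :
    ∫ y : ℝ, (y ^ 2 + w ^ 2)⁻¹ = Real.pi / w := by
  have h := Measure.integral_comp_mul_left (fun y : ℝ => (1 + y ^ 2)⁻¹) w⁻¹
  rw [integral_univ_inv_one_add_sq, inv_inv, abs_of_pos hw] at h
  have e : ∀ y : ℝ, (y ^ 2 + w ^ 2)⁻¹ = (w ^ 2)⁻¹ * (1 + (w⁻¹ * y) ^ 2)⁻¹ := by
    intro y
    rw [← mul_inv]
    congr 1
    field_simp
    ring
  simp only [e]
  rw [integral_const_mul, h, smul_eq_mul]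
  field_simp

lemma integrable_inv_sq_add_sq {w : ℝ} (hw : 0 < w) :
    Integrable fun y : ℝ => (y ^ 2 + w ^ 2)⁻¹ := by
  by_contra h
  have h1 := integral_univ_inv_sq_add_sq hw
  rw [integral_undef h] at h1
  exact (div_pos Real.pi_pos hw).ne h1

lemma cos_pi_mul_half_integer (N : ℕ) : Complex.cos (Real.pi * (N + 1 / 2)) = 0 :=
  (cos_pi_mul_eq_zero_iff _).2 ⟨N, by simp⟩

lemma sq_add_sq_le_norm_mul {a w y : ℝ} (ha : 0 ≤ a) (hw : 0 ≤ w) :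
    (a - w) ^ 2 + y ^ 2 ≤ ‖(a + Complex.I * y + w : ℂ)‖ * ‖(a + Complex.I * y - w : ℂ)‖ := by
  have h1 : ‖(a + Complex.I * y - w : ℂ)‖ ^ 2 = (a - w) ^ 2 + y ^ 2 := by
    rw [← Complex.normSq_eq_norm_sq, Complex.normSq_apply]
    simp
    ring
  have h2 : ‖(a + Complex.I * y - w : ℂ)‖ ≤ ‖(a + Complex.I * y + w : ℂ)‖ := by
    rw [← sq_le_sq₀ (norm_nonneg _) (norm_nonneg _), h1, ← Complex.normSq_eq_norm_sq,
      Complex.normSq_apply]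
    simp
    nlinarith [mul_nonneg ha hw]
  rw [← h1, sq]
  exact mul_le_mul_of_nonneg_right h2 (norm_nonneg _)

/-- Interpolation at the half-integers, for a function that decays exponentially to the right. The
residue summation is applied to `(g z - g w * v z) / (z - w)`, where
`v z = 2 w cos (π z) / ((z + w) cos (π w))` takes the value `1` at `w` and vanishes at the
half-integers; after division by `cos (π z)` its contribution is that of the rational function
`1 / (z ^ 2 - w ^ 2)`. -/
theorem tendsto_interpolation_of_decay {g : ℂ → ℂ}
    (hd : DifferentiableOn ℂ g {z | 0 < z.re}) (hc : ContinuousOn g {z | 0 ≤ z.re})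
    (hg : ∀ K : ℕ, StripGrowth g K)
    (hi : Integrable fun y : ℝ => g (Complex.I * y) / (Real.cosh (Real.pi * y) : ℂ))
    {C η : ℝ} (hC : 0 ≤ C) (hη : 0 < η)
    (hdec : ∀ z : ℂ, 1 ≤ z.re → ‖g z‖ ≤ C * (1 + ‖z‖) * Real.exp (-η * z.re))
    {w : ℝ} (hw : 0 < w) (hcos : Complex.cos (Real.pi * w) ≠ 0) :
    Tendsto (fun K : ℕ => 2 * ∑ N ∈ Finset.range K, (-1) ^ N * (g (N + 1 / 2) / (N + 1 / 2 - w)))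
      atTop (nhds ((∫ y : ℝ, g (Complex.I * y) /
        ((Complex.I * y - w) * (Real.cosh (Real.pi * y) : ℂ))) +
          2 * Real.pi * g w / Complex.cos (Real.pi * w))) := by
  -- `c` is chosen such that `F w = 0`
  set c : ℂ := 2 * w * g w / Complex.cos (Real.pi * w) with hcdef
  set F : ℂ → ℂ := fun z => g z - c * (Complex.cos (Real.pi * z) * (z + w)⁻¹) with hF
  set H : ℂ → ℂ := dslope F w with hH
  have hwmem : (w : ℂ) ∈ {z : ℂ | 0 < z.re} := by simpa using hw
  have hwn : {z : ℂ | 0 < z.re} ∈ nhds (w : ℂ) := isOpen_rightHalfPlane.mem_nhds hwmem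
  have hwn' : {z : ℂ | 0 ≤ z.re} ∈ nhds (w : ℂ) :=
    mem_of_superset hwn fun z (hz : 0 < z.re) => (hz.le : 0 ≤ z.re)
  have hw0 : (w : ℂ) ≠ 0 := by exact_mod_cast hw.ne'
  have hplus : ∀ z : ℂ, 0 ≤ z.re → z + w ≠ 0 := by
    intro z hz h
    have := congrArg Complex.re h
    simp at this
    linarith
  have hFd : DifferentiableOn ℂ F {z | 0 < z.re} := by
    refine hd.sub (DifferentiableOn.const_mul (DifferentiableOn.mul ?_ ?_) _)
    · exact (Complex.differentiable_cos.comp (by fun_prop :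
        Differentiable ℂ fun z : ℂ => (Real.pi * z : ℂ))).differentiableOn
    · exact DifferentiableOn.inv (by fun_prop) fun z hz => hplus z (le_of_lt hz)
  have hFc : ContinuousOn F {z | 0 ≤ z.re} := by
    refine hc.sub (continuousOn_const.mul (ContinuousOn.mul ?_ ?_))
    · exact (Complex.continuous_cos.comp (by fun_prop :
        Continuous fun z : ℂ => (Real.pi * z : ℂ))).continuousOn
    · exact ContinuousOn.inv₀ (by fun_prop) fun z hz => hplus z hz
  have hFw : F w = 0 := by
    have h1 : c * Complex.cos (Real.pi * w) = 2 * w * g w := div_mul_cancel₀ _ hcos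
    have h2 : (w : ℂ) + w ≠ 0 := hplus w (by simpa using hw.le)
    simp only [hF]
    rw [← mul_assoc, h1, sub_eq_zero, eq_mul_inv_iff_mul_eq₀ h2]
    ring
  have hHeq : ∀ z : ℂ, z ≠ w → H z = F z / (z - w) := by
    intro z hz
    rw [hH, dslope_of_ne _ hz, slope_def_field, hFw, sub_zero]
  have hHd : DifferentiableOn ℂ H {z | 0 < z.re} := (Complex.differentiableOn_dslope hwn).2 hFd
  have hHc : ContinuousOn H {z | 0 ≤ z.re} :=
    (continuousOn_dslope hwn').2 ⟨hFc, hFd.differentiableAt hwn⟩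
  have hgrow : ∀ K : ℕ, StripGrowth H K := by
    intro K
    have hF' : StripGrowth F K := by
      refine (hg K).sub ((stripGrowth_const c _).mul ?_)
      refine (stripGrowth_cos_pi (a := K)).mono fun z _ _ hz => ?_
      rw [norm_mul, norm_inv]
      exact mul_le_of_le_one_right (norm_nonneg _)
        (inv_le_one_of_one_le₀ (one_le_norm_of_one_le_abs_im (by simpa using hz)))
    refine hF'.mono fun z _ _ hz => ?_
    have hzw : 1 ≤ ‖z - w‖ := one_le_norm_of_one_le_abs_im (by simpa using hz)
    have hne : z ≠ w := by
      intro h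
      rw [h] at hz
      simp at hz
      linarith
    rw [hHeq z hne, norm_div]
    exact div_le_self (norm_nonneg _) hzw
  -- on the line `Re z = K`, where `cos (π z) = (-1)^K cosh (π y)`
  have hline : ∀ (K : ℕ) (y : ℝ), (K + Complex.I * y : ℂ) ≠ w →
      H (K + Complex.I * y) / (Real.cosh (Real.pi * y) : ℂ) =
        g (K + Complex.I * y) / ((K + Complex.I * y - w) * (Real.cosh (Real.pi * y) : ℂ)) -
        c * (-1) ^ K * ((K + Complex.I * y + w) * (K + Complex.I * y - w))⁻¹ := by
    intro K y hne
    have h1 : (K + Complex.I * y - w : ℂ) ≠ 0 := sub_ne_zero.2 hne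
    have h2 : (K + Complex.I * y + w : ℂ) ≠ 0 := hplus _ (by simp)
    have h3 : (Real.cosh (Real.pi * y) : ℂ) ≠ 0 := by
      exact_mod_cast (Real.cosh_pos (Real.pi * y)).ne'
    rw [hHeq _ hne]
    simp only [hF]
    rw [cos_pi_nat_add_mul_I]
    field_simp
  have hbd : ∀ (K : ℕ) (y : ℝ), 1 ≤ ‖(K + Complex.I * y - w : ℂ)‖ →
      ‖H (K + Complex.I * y) / (Real.cosh (Real.pi * y) : ℂ)‖ ≤
        ‖g (K + Complex.I * y) / (Real.cosh (Real.pi * y) : ℂ)‖ +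
          ‖c‖ * (((K : ℝ) - w) ^ 2 + y ^ 2)⁻¹ := by
    intro K y h1
    have hne : (K + Complex.I * y : ℂ) ≠ w := by
      intro h
      rw [h, sub_self, norm_zero] at h1
      linarith
    rw [hline K y hne]
    refine (norm_sub_le _ _).trans (add_le_add ?_ ?_)
    · rw [norm_div, norm_div, norm_mul]
      have hcosh : 0 < ‖(Real.cosh (Real.pi * y) : ℂ)‖ := by
        rw [Complex.norm_real, Real.norm_of_nonneg (Real.cosh_pos _).le]
        exact Real.cosh_pos _
      gcongr
      exact le_mul_of_one_le_left hcosh.le h1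
    · rw [norm_mul, norm_mul, norm_pow, norm_neg, norm_one, one_pow, mul_one, norm_inv, norm_mul]
      have h2 := sq_add_sq_le_norm_mul (a := K) (w := w) (y := y) (Nat.cast_nonneg K) hw.le
      rw [Complex.ofReal_natCast] at h2
      rcases eq_or_ne (((K : ℝ) - w) ^ 2 + y ^ 2) 0 with h0 | h0
      · exfalso
        have a1 : ((K : ℝ) - w) = 0 := by nlinarith [sq_nonneg ((K : ℝ) - w), sq_nonneg y]
        have a2 : y = 0 := by nlinarith [sq_nonneg ((K : ℝ) - w), sq_nonneg y]
        apply hne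
        rw [a2, ← sub_eq_zero]
        have : ((K : ℂ) - w) = 0 := by exact_mod_cast a1
        simpa using this
      · have hpos : 0 < ((K : ℝ) - w) ^ 2 + y ^ 2 := lt_of_le_of_ne (by positivity) (Ne.symm h0)
        gcongr
  have hgK : ∀ (K : ℕ) (y : ℝ), 1 ≤ K → ‖g (K + Complex.I * y) / (Real.cosh (Real.pi * y) : ℂ)‖ ≤
      (C * (1 + K) * Real.exp (-η * K)) * (2 * ((1 + |y|) ^ 1 * Real.exp (-Real.pi * |y|))) := by
    intro K y hK
    have hK' : (1 : ℝ) ≤ K := by exact_mod_cast hK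
    have h1 := hdec (K + Complex.I * y) (by simpa using hK')
    have h2 := one_add_norm_nat_add_le K y
    have hre : (K + Complex.I * y : ℂ).re = K := by simp
    rw [hre] at h1
    rw [norm_div, Complex.norm_real, Real.norm_of_nonneg (Real.cosh_pos _).le, div_eq_mul_inv]
    calc _ ≤ (C * ((1 + K) * (1 + |y|)) * Real.exp (-η * K)) * (2 * Real.exp (-Real.pi * |y|)) := by
          refine mul_le_mul (h1.trans (by gcongr)) (inv_cosh_le_two_mul_exp y)
            (inv_nonneg.2 (Real.cosh_pos _).le) (by positivity)
      _ = _ := by ring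
  have hcl : ∀ (u : ℂ → ℂ), ContinuousOn u {z | 0 ≤ z.re} → ∀ K : ℕ,
      Continuous fun y : ℝ => u (K + Complex.I * y) / (Real.cosh (Real.pi * y) : ℂ) := by
    intro u hu K
    have : Continuous fun y : ℝ => u (K + Complex.I * y) :=
      hu.comp_continuous (by fun_prop) fun y => by
        simp only [Set.mem_ofPred_eq]
        simp
    simp only [div_eq_mul_inv, ← Complex.ofReal_inv]
    exact this.mul (Complex.continuous_ofReal.comp continuous_inv_cosh)
  have hgi : ∀ K : ℕ, Integrable fun y : ℝ =>
      g (K + Complex.I * y) / (Real.cosh (Real.pi * y) : ℂ) := by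
    intro K
    rcases Nat.eq_zero_or_pos K with h | h
    · subst h
      simpa using hi
    · exact (((integrable_one_add_abs_pow_mul_exp 1 Real.pi_pos).const_mul 2).const_mul _).mono'
        (hcl g hc K).aestronglyMeasurable (Eventually.of_forall fun y => hgK K y h)
  have hint : ∀ K : ℕ, Integrable fun y : ℝ =>
      H (K + Complex.I * y) / (Real.cosh (Real.pi * y) : ℂ) := by
    intro K
    refine integrable_of_bound_outside (hcl H hHc K)
      ((hgi K).norm.add (integrable_inv_one_add_sq.const_mul (2 * ‖c‖)))
      (fun y => by simp only [Pi.add_apply]; positivity) fun y hy => ?_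
    have h1 : 1 ≤ ‖(K + Complex.I * y - w : ℂ)‖ := one_le_norm_of_one_le_abs_im (by simpa using hy)
    refine (hbd K y h1).trans ?_
    simp only [Pi.add_apply]
    refine add_le_add le_rfl ?_
    have hy2 : 1 ≤ y ^ 2 := by rw [← sq_abs]; nlinarith
    have : (((K : ℝ) - w) ^ 2 + y ^ 2)⁻¹ ≤ 2 * (1 + y ^ 2)⁻¹ := by
      rw [← div_eq_mul_inv, inv_le_comm₀ (by positivity) (by positivity), inv_div]
      nlinarith [sq_nonneg ((K : ℝ) - w)]
    nlinarith [norm_nonneg c]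
  have hlim : Tendsto (fun K : ℕ =>
      ∫ y : ℝ, H (K + Complex.I * y) / (Real.cosh (Real.pi * y) : ℂ)) atTop (nhds 0) := by
    have ha : Tendsto (fun K : ℕ => C * (1 + K) * Real.exp (-η * K)) atTop (nhds 0) := by
      have h1 : Tendsto (fun t : ℝ => (1 + t) * Real.exp (-η * t)) atTop (nhds 0) := by
        have e1 : Tendsto (fun t : ℝ => Real.exp (-η * t)) atTop (nhds 0) :=
          Real.tendsto_exp_atBot.comp (tendsto_id.const_mul_atTop_of_neg (by linarith))
        have e2 : Tendsto (fun t : ℝ => t * Real.exp (-η * t)) atTop (nhds 0) := by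
          have := tendsto_rpow_mul_exp_neg_mul_atTop_nhds_zero 1 η hη
          simpa using this
        have := e1.add e2
        rw [add_zero] at this
        refine this.congr fun t => by ring
      have := (h1.comp tendsto_natCast_atTop_atTop).const_mul C
      rw [mul_zero] at this
      refine this.congr fun K => by simp only [Function.comp]; ring
    obtain ⟨M, hM⟩ := ha.bddAbove_range
    have hM' : ∀ K : ℕ, C * (1 + K) * Real.exp (-η * K) ≤ M := fun K => hM ⟨K, rfl⟩
    have hK1 : ∀ᶠ K : ℕ in atTop, 1 ≤ (K : ℝ) - w := by
      filter_upwards [tendsto_natCast_atTop_atTop.eventually_ge_atTop (w + 1)] with K hK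
      linarith
    have hpt : ∀ᶠ K : ℕ in atTop, ∀ y : ℝ,
        ‖H (K + Complex.I * y) / (Real.cosh (Real.pi * y) : ℂ)‖ ≤
        (C * (1 + K) * Real.exp (-η * K)) * (2 * ((1 + |y|) ^ 1 * Real.exp (-Real.pi * |y|))) +
          ‖c‖ * (((K : ℝ) - w) ^ 2 + y ^ 2)⁻¹ := by
      filter_upwards [hK1] with K hK y
      have hK0 : 1 ≤ K := by
        have : (0 : ℝ) < K := by linarith
        exact_mod_cast this
      have h1 : 1 ≤ ‖(K + Complex.I * y - w : ℂ)‖ := by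
        refine le_trans ?_ (Complex.abs_re_le_norm _)
        simp only [Complex.add_re, Complex.sub_re, Complex.natCast_re, Complex.mul_re,
          Complex.I_re, Complex.I_im, Complex.ofReal_re, Complex.ofReal_im]
        refine le_trans hK (le_trans (le_of_eq ?_) (le_abs_self _))
        ring
      exact (hbd K y h1).trans (add_le_add (hgK K y hK0) le_rfl)
    rw [show (0 : ℂ) = ∫ _ : ℝ, (0 : ℂ) by simp]
    refine tendsto_integral_filter_of_dominated_convergence
      (fun y : ℝ => M * (2 * ((1 + |y|) ^ 1 * Real.exp (-Real.pi * |y|))) +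
        ‖c‖ * (1 + y ^ 2)⁻¹) (Eventually.of_forall fun K => (hint K).aestronglyMeasurable) ?_
      ((((integrable_one_add_abs_pow_mul_exp 1 Real.pi_pos).const_mul 2).const_mul _).add
        (integrable_inv_one_add_sq.const_mul _)) ?_
    · filter_upwards [hpt, hK1] with K hK hK'
      refine Eventually.of_forall fun y => (hK y).trans (add_le_add ?_ ?_)
      · exact mul_le_mul_of_nonneg_right (hM' K) (by positivity)
      · gcongr
        nlinarith
    · refine Eventually.of_forall fun y => ?_
      have hb : Tendsto (fun K : ℕ => (((K : ℝ) - w) ^ 2 + y ^ 2)⁻¹) atTop (nhds 0) := by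
        refine tendsto_inv_atTop_zero.comp (tendsto_atTop_add_const_right _ _ ?_)
        exact (tendsto_pow_atTop two_ne_zero).comp
          (tendsto_atTop_add_const_right _ (-w) tendsto_natCast_atTop_atTop)
      have hsum := (ha.mul_const (2 * ((1 + |y|) ^ 1 * Real.exp (-Real.pi * |y|)))).add
        (hb.const_mul ‖c‖)
      rw [zero_mul, mul_zero, add_zero] at hsum
      exact squeeze_zero_norm' (hpt.mono fun K hK => hK y) hsum
  have hmain := tendsto_alternating_sum_of_halfPlane hHd hHc hgrow hint hlim
  have hnode : ∀ N : ℕ, H (N + 1 / 2) = g (N + 1 / 2) / (N + 1 / 2 - w) := by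
    intro N
    have hne : (N + 1 / 2 : ℂ) ≠ w := by
      intro h
      rw [← h] at hcos
      exact hcos (cos_pi_mul_half_integer N)
    rw [hHeq _ hne]
    simp only [hF]
    rw [cos_pi_mul_half_integer, zero_mul, mul_zero, sub_zero]
  simp only [hnode] at hmain
  convert hmain using 2
  have hIw : ∀ y : ℝ, (Complex.I * y : ℂ) ≠ w := by
    intro y h
    have := congrArg Complex.re h
    simp at this
    linarith
  have hquad : ∀ y : ℝ, ((Complex.I * y + w) * (Complex.I * y - w) : ℂ)⁻¹ =
      -(((y ^ 2 + w ^ 2)⁻¹ : ℝ) : ℂ) := by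
    intro y
    push_cast
    rw [← inv_neg]
    congr 1
    linear_combination (y : ℂ) ^ 2 * Complex.I_sq
  have hzero : ∀ y : ℝ, H (Complex.I * y) / (Real.cosh (Real.pi * y) : ℂ) =
      g (Complex.I * y) / ((Complex.I * y - w) * (Real.cosh (Real.pi * y) : ℂ)) +
        c * (((y ^ 2 + w ^ 2)⁻¹ : ℝ) : ℂ) := by
    intro y
    have := hline 0 y (by simpa using hIw y)
    simp only [Nat.cast_zero, zero_add, pow_zero, mul_one] at this
    rw [this, hquad]
    ring
  have hrat : Integrable fun y : ℝ => c * (((y ^ 2 + w ^ 2)⁻¹ : ℝ) : ℂ) :=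
    (integrable_inv_sq_add_sq hw).ofReal.const_mul c
  have h0 := hint 0
  simp only [Nat.cast_zero, zero_add, hzero] at h0
  have hgint : Integrable fun y : ℝ =>
      g (Complex.I * y) / ((Complex.I * y - w) * (Real.cosh (Real.pi * y) : ℂ)) := by
    refine (h0.sub hrat).congr (Eventually.of_forall fun y => ?_)
    simp only [Pi.sub_apply, add_sub_cancel_right]
  simp only [hzero]
  rw [integral_add hgint hrat, integral_const_mul, integral_complex_ofReal,
    integral_univ_inv_sq_add_sq hw]
  congr 1
  simp only [hcdef]
  push_cast
  field_simp

/-- A square-integrable function times one dominated by the hyperbolic secant is integrable. -/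
lemma integrable_of_memLp_two_mul {u v : ℝ → ℂ} (hu : MemLp u 2 (volume : Measure ℝ))
    (hv : Continuous v) {C : ℝ} (hC : ∀ y, ‖v y‖ ≤ C * (Real.cosh (Real.pi * y))⁻¹) :
    Integrable fun y => u y * v y := by
  have hu2 := (memLp_two_iff_integrable_sq_norm hu.1).1 hu
  have hC0 : 0 ≤ C := by
    have := (norm_nonneg _).trans (hC 0)
    simpa using this
  refine ((hu2.const_mul C).add (integrable_inv_cosh.const_mul C)).mono'
    (hu.1.mul hv.aestronglyMeasurable) (Eventually.of_forall fun y => ?_)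
  have hs : (Real.cosh (Real.pi * y))⁻¹ ≤ 1 := inv_le_one_of_one_le₀ (Real.one_le_cosh _)
  have hs0 : 0 ≤ (Real.cosh (Real.pi * y))⁻¹ := (inv_pos.2 (Real.cosh_pos _)).le
  have h1 : ‖u y‖ * (Real.cosh (Real.pi * y))⁻¹ ≤ ‖u y‖ ^ 2 + (Real.cosh (Real.pi * y))⁻¹ := by
    nlinarith [sq_nonneg (‖u y‖ - (Real.cosh (Real.pi * y))⁻¹), norm_nonneg (u y),
      mul_nonneg (norm_nonneg (u y)) hs0, sq_nonneg ‖u y‖]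
  rw [norm_mul]
  simp only [Pi.add_apply]
  calc ‖u y‖ * ‖v y‖ ≤ ‖u y‖ * (C * (Real.cosh (Real.pi * y))⁻¹) :=
        mul_le_mul_of_nonneg_left (hC y) (norm_nonneg _)
    _ = C * (‖u y‖ * (Real.cosh (Real.pi * y))⁻¹) := by ring
    _ ≤ C * (‖u y‖ ^ 2 + (Real.cosh (Real.pi * y))⁻¹) := mul_le_mul_of_nonneg_left h1 hC0
    _ = _ := by ring

lemma integrable_div_cosh_of_memLp {u : ℝ → ℂ} (hu : MemLp u 2 (volume : Measure ℝ)) :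
    Integrable fun y => u y / (Real.cosh (Real.pi * y) : ℂ) := by
  simp only [div_eq_mul_inv, ← Complex.ofReal_inv]
  refine integrable_of_memLp_two_mul hu (Complex.continuous_ofReal.comp continuous_inv_cosh)
    (C := 1) fun y => ?_
  rw [Complex.norm_real, Real.norm_of_nonneg (inv_pos.2 (Real.cosh_pos _)).le, one_mul]

lemma sub_I_mul_ne_zero {w : ℝ} (hw : 0 < w) (y : ℝ) : (w - Complex.I * y : ℂ) ≠ 0 := by
  intro h
  have := congrArg Complex.re h
  simp at this
  exact hw.ne' this

lemma le_norm_sub_I_mul (w y : ℝ) : w ≤ ‖(w - Complex.I * y : ℂ)‖ := by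
  have := (le_abs_self _).trans (Complex.abs_re_le_norm (w - Complex.I * y : ℂ))
  simpa using this

lemma integrable_interpolation_kernel {u : ℝ → ℂ} (hu : MemLp u 2 (volume : Measure ℝ)) {w : ℝ}
    (hw : 0 < w) :
    Integrable fun y => u y / ((w - Complex.I * y) * (Real.cosh (Real.pi * y) : ℂ)) := by
  have e : ∀ y : ℝ, u y / ((w - Complex.I * y) * (Real.cosh (Real.pi * y) : ℂ)) =
      u y * ((w - Complex.I * y)⁻¹ * (((Real.cosh (Real.pi * y))⁻¹ : ℝ) : ℂ)) := by
    intro y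
    rw [div_eq_mul_inv, mul_inv, Complex.ofReal_inv]
  simp only [e]
  refine integrable_of_memLp_two_mul hu ((Continuous.inv₀ (by fun_prop)
    (sub_I_mul_ne_zero hw)).mul (Complex.continuous_ofReal.comp continuous_inv_cosh))
    (C := w⁻¹) fun y => ?_
  have hs0 : 0 ≤ (Real.cosh (Real.pi * y))⁻¹ := (inv_pos.2 (Real.cosh_pos _)).le
  rw [norm_mul, norm_inv, Complex.norm_real, Real.norm_of_nonneg hs0]
  gcongr
  exact le_norm_sub_I_mul w y

lemma sin_pi_mul_ne_zero_of_forall_ne_natCast {x : ℝ} (hx : -(1 / 2) < x) (h : ∀ N : ℕ, x ≠ N) :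
    Real.sin (Real.pi * x) ≠ 0 := by
  intro h0
  obtain ⟨n, hn⟩ := Real.sin_eq_zero_iff.1 h0
  rw [mul_comm, mul_right_inj' Real.pi_ne_zero] at hn
  have hn0 : 0 ≤ n := by
    by_contra hneg
    have h1 : (n : ℝ) ≤ -1 := by exact_mod_cast (by omega : n ≤ -1)
    linarith
  obtain ⟨N, rfl⟩ := Int.eq_ofNat_of_zero_le hn0
  exact h N (by rw [← hn]; simp)

lemma cos_pi_mul_add_half (x : ℝ) :
    Complex.cos (Real.pi * ((x + 1 / 2 : ℝ) : ℂ)) = -(Real.sin (Real.pi * x) : ℂ) := by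
  rw [← Complex.ofReal_mul, ← Complex.ofReal_cos, mul_add, mul_one_div, Real.cos_add_pi_div_two,
    Complex.ofReal_neg]

/-- The interpolation formula under exponential decay to the right, off the nonnegative integers. -/
theorem interpolation_of_decay {g : ℂ → ℂ}
    (hd : DifferentiableOn ℂ g {z | 0 < z.re}) (hc : ContinuousOn g {z | 0 ≤ z.re})
    (hg : ∀ K : ℕ, StripGrowth g K)
    (hi : Integrable fun y : ℝ => g (Complex.I * y) / (Real.cosh (Real.pi * y) : ℂ))
    {C η : ℝ} (hC : 0 ≤ C) (hη : 0 < η)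
    (hdec : ∀ z : ℂ, 1 ≤ z.re → ‖g z‖ ≤ C * (1 + ‖z‖) * Real.exp (-η * z.re))
    {x : ℝ} (hx : -(1 / 2) < x) (hxN : ∀ N : ℕ, x ≠ N)
    (hs : Summable fun N : ℕ => sample g N * (sincPi (x - N) : ℂ)) :
    g (x + 1 / 2) = (∑' N : ℕ, sample g N * (sincPi (x - N) : ℂ)) -
      (Real.sin (Real.pi * x) : ℂ) / (2 * (Real.pi : ℂ)) * ∫ y : ℝ, g (Complex.I * y) /
        (((x : ℂ) + 1 / 2 - Complex.I * y) * (Real.cosh (Real.pi * y) : ℂ)) := by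
  set w : ℝ := x + 1 / 2 with hwdef
  have hw : 0 < w := by linarith
  have hwc : (w : ℂ) = x + 1 / 2 := by rw [hwdef]; push_cast; ring
  have hs0 : (Real.sin (Real.pi * x) : ℂ) ≠ 0 := by
    exact_mod_cast sin_pi_mul_ne_zero_of_forall_ne_natCast hx hxN
  have hcosw : Complex.cos (Real.pi * w) = -(Real.sin (Real.pi * x) : ℂ) := cos_pi_mul_add_half x
  have h1 := tendsto_interpolation_of_decay hd hc hg hi hC hη hdec hw
    (by rw [hcosw]; exact neg_ne_zero.2 hs0)
  have h2 := hs.hasSum.tendsto_sum_nat.const_mul (-(2 * Real.pi / (Real.sin (Real.pi * x) : ℂ)))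
  have hterm : ∀ N : ℕ, 2 * ((-1) ^ N * (g (N + 1 / 2) / (N + 1 / 2 - w))) =
      -(2 * Real.pi / (Real.sin (Real.pi * x) : ℂ)) * (sample g N * (sincPi (x - N) : ℂ)) := by
    intro N
    have hne : ((x : ℂ) - N) ≠ 0 := by
      rw [sub_ne_zero]
      exact_mod_cast hxN N
    have e : ((N : ℂ) + 1 / 2 - w) = N - x := by rw [hwc]; ring
    have e2 : (x : ℂ) - N = -(N - x) := by ring
    rw [sincPi_sub_natCast (hxN N), sample, e]
    have hsx : (((-1) ^ N * Real.sin (Real.pi * x) / (Real.pi * (x - N)) : ℝ) : ℂ) =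
        (-1) ^ N * (Real.sin (Real.pi * x) : ℂ) / (Real.pi * -((N : ℂ) - x)) := by
      rw [← e2]
      simp only [Complex.ofReal_div, Complex.ofReal_mul, Complex.ofReal_pow, Complex.ofReal_neg,
        Complex.ofReal_one, Complex.ofReal_sub, Complex.ofReal_natCast]
    rw [hsx]
    field_simp
  have h3 := tendsto_nhds_unique h1 (by
    refine h2.congr fun K => ?_
    rw [Finset.mul_sum, Finset.mul_sum]
    exact Finset.sum_congr rfl fun N _ => (hterm N).symm)
  have hint : (∫ y : ℝ, g (Complex.I * y) / ((Complex.I * y - w) * (Real.cosh (Real.pi * y) : ℂ))) =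
      -∫ y : ℝ, g (Complex.I * y) /
        (((x : ℂ) + 1 / 2 - Complex.I * y) * (Real.cosh (Real.pi * y) : ℂ)) := by
    rw [← integral_neg]
    refine integral_congr_ae (Eventually.of_forall fun y => ?_)
    simp only
    rw [← hwc, ← div_neg, ← neg_mul, neg_sub]
  rw [hint, hcosw] at h3
  generalize (∫ y : ℝ, g (Complex.I * y) /
    (((x : ℂ) + 1 / 2 - Complex.I * y) * (Real.cosh (Real.pi * y) : ℂ))) = J at h3 ⊢
  rw [← hwc]
  field_simp at h3 ⊢
  linear_combination -h3

/-- The interpolation formula. Off the nonnegative integers it is the limit `δ → 0` of the formula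
for `exp (-δ z) * f z`; at a nonnegative integer both sides reduce to a single sample. -/
theorem interpolation {f : ℂ → ℂ}
    (hd : DifferentiableOn ℂ f {z | 0 < z.re}) (hc : ContinuousOn f {z | 0 ≤ z.re})
    (hexp : ∃ C : ℝ, ∀ z : ℂ, 0 ≤ z.re → ‖f z‖ ≤ C * Real.exp (‖z‖ ^ (3 / 2 : ℝ)))
    (hL2 : MemLp (fun y : ℝ => f (Complex.I * (y : ℂ))) 2 volume)
    (hgrow : ∀ ε : ℝ, 0 < ε → ∃ C : ℝ, 0 ≤ C ∧
      ∀ z : ℂ, 1 ≤ z.re → ‖f z‖ ≤ C * (1 + ‖z‖) * Real.exp (ε * z.re))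
    {x : ℝ} (hx : -(1 / 2) < x) (hs : Summable fun N : ℕ => sample f N * (sincPi (x - N) : ℂ)) :
    f (x + 1 / 2) = (∑' N : ℕ, sample f N * (sincPi (x - N) : ℂ)) -
      (Real.sin (Real.pi * x) : ℂ) / (2 * (Real.pi : ℂ)) * ∫ y : ℝ, f (Complex.I * y) /
        (((x : ℂ) + 1 / 2 - Complex.I * y) * (Real.cosh (Real.pi * y) : ℂ)) := by
  by_cases hxN : ∃ N : ℕ, x = N
  · obtain ⟨m, rfl⟩ := hxN
    have h0 : Real.sin (Real.pi * m) = 0 := by rw [mul_comm]; exact Real.sin_nat_mul_pi m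
    rw [tsum_eq_single m fun N hN => by rw [sincPi_natCast_sub hN.symm]; simp, h0]
    simp [sincPi, sample]
  push Not at hxN
  have hw : 0 < x + 1 / 2 := by linarith
  have hwc : ((x + 1 / 2 : ℝ) : ℂ) = x + 1 / 2 := by push_cast; ring
  have hfi := integrable_interpolation_kernel hL2 hw
  rw [hwc] at hfi
  set δ : ℕ → ℝ := fun k => 1 / ((k : ℝ) + 1) with hδ
  have hδ0 : ∀ k, 0 < δ k := fun k => Nat.one_div_pos_of_nat
  have hδlim : Tendsto δ atTop (nhds 0) := tendsto_one_div_add_atTop_nhds_zero_nat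
  set E : ℕ → ℂ → ℂ := fun k z => Complex.exp (-(δ k : ℂ) * z) with hE
  have hEn : ∀ k z, ‖E k z‖ = Real.exp (-δ k * z.re) := by
    intro k z
    simp [hE, Complex.norm_exp]
  have hE1 : ∀ k (z : ℂ), 0 ≤ z.re → ‖E k z‖ ≤ 1 := by
    intro k z hz
    rw [hEn, Real.exp_le_one_iff]
    nlinarith [hδ0 k]
  have hElim : ∀ z : ℂ, Tendsto (fun k => E k z) atTop (nhds 1) := by
    intro z
    have h1 : Tendsto (fun t : ℝ => Complex.exp (-(t : ℂ) * z)) (nhds 0)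
        (nhds (Complex.exp (-((0 : ℝ) : ℂ) * z))) :=
      (by fun_prop : Continuous fun t : ℝ => Complex.exp (-(t : ℂ) * z)).tendsto 0
    have := h1.comp hδlim
    rw [Complex.ofReal_zero, neg_zero, zero_mul, Complex.exp_zero] at this
    exact this
  have hEd : ∀ k, Differentiable ℂ (E k) := by
    intro k
    simp only [hE]
    fun_prop
  have hnode : ∀ k N, sample (fun z => E k z * f z) N * (sincPi (x - N) : ℂ) =
      E k (N + 1 / 2) * (sample f N * (sincPi (x - N) : ℂ)) := by
    intro k N
    simp only [sample]
    ring
  have hNre : ∀ N : ℕ, 0 ≤ ((N : ℂ) + 1 / 2).re := by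
    intro N
    have : ((N : ℂ) + 1 / 2).re = N + 1 / 2 := by simp
    rw [this]
    positivity
  have hdom : ∀ k N, ‖sample (fun z => E k z * f z) N * (sincPi (x - N) : ℂ)‖ ≤
      ‖sample f N * (sincPi (x - N) : ℂ)‖ := by
    intro k N
    rw [hnode, norm_mul]
    exact mul_le_of_le_one_left (norm_nonneg _) (hE1 k _ (hNre N))
  have hI : ∀ (k : ℕ) (y : ℝ), ‖E k (Complex.I * y)‖ ≤ 1 := fun k y => hE1 k _ (by simp)
  have hIc : ∀ k, Continuous fun y : ℝ => E k (Complex.I * y) := fun k =>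
    (hEd k).continuous.comp (by fun_prop)
  -- the formula for the regularized functions
  have hformula : ∀ k, E k (x + 1 / 2) * f (x + 1 / 2) =
      (∑' N : ℕ, sample (fun z => E k z * f z) N * (sincPi (x - N) : ℂ)) -
      (Real.sin (Real.pi * x) : ℂ) / (2 * (Real.pi : ℂ)) * ∫ y : ℝ, E k (Complex.I * y) *
        f (Complex.I * y) /
        (((x : ℂ) + 1 / 2 - Complex.I * y) * (Real.cosh (Real.pi * y) : ℂ)) := by
    intro k
    obtain ⟨C, hC, hCz⟩ := hgrow (δ k / 2) (half_pos (hδ0 k))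
    obtain ⟨D, hD⟩ := hexp
    refine interpolation_of_decay (g := fun z => E k z * f z) ((hEd k).differentiableOn.mul hd)
      ((hEd k).continuous.continuousOn.mul hc) (fun K => ?_) ?_ hC (half_pos (hδ0 k))
      (fun z hz => ?_) hx hxN (hs.norm.of_norm_bounded (hdom k))
    · refine stripGrowth_of_norm_le (C := D) (B := 1) (Nat.cast_nonneg K) zero_le_one
        fun z hz _ _ => ?_
      have hz0 : 0 ≤ z.re := (Nat.cast_nonneg K).trans hz
      rw [norm_mul, one_mul]
      exact (mul_le_of_le_one_left (norm_nonneg _) (hE1 k z hz0)).trans (hD z hz0)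
    · have := (integrable_div_cosh_of_memLp hL2).bdd_mul (c := 1) (hIc k).aestronglyMeasurable
        (Eventually.of_forall fun y => hI k y)
      simpa only [mul_div_assoc] using this
    · rw [norm_mul, hEn]
      calc Real.exp (-δ k * z.re) * ‖f z‖
          ≤ Real.exp (-δ k * z.re) * (C * (1 + ‖z‖) * Real.exp (δ k / 2 * z.re)) := by
            gcongr
            exact hCz z hz
        _ = C * (1 + ‖z‖) * (Real.exp (-δ k * z.re) * Real.exp (δ k / 2 * z.re)) := by ring
        _ = _ := by
            rw [← Real.exp_add]
            congr 2
            ring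
  have hl : Tendsto (fun k => E k (x + 1 / 2) * f (x + 1 / 2)) atTop (nhds (f (x + 1 / 2))) := by
    simpa using (hElim (x + 1 / 2)).mul_const (f (x + 1 / 2))
  have hr1 : Tendsto (fun k => ∑' N : ℕ, sample (fun z => E k z * f z) N * (sincPi (x - N) : ℂ))
      atTop (nhds (∑' N : ℕ, sample f N * (sincPi (x - N) : ℂ))) := by
    refine tendsto_tsum_of_dominated_convergence hs.norm (fun N => ?_)
      (Eventually.of_forall fun k N => hdom k N)
    simp only [hnode]
    simpa using (hElim (N + 1 / 2)).mul_const (sample f N * (sincPi (x - N) : ℂ))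
  have hr2 : Tendsto (fun k => ∫ y : ℝ, E k (Complex.I * y) * f (Complex.I * y) /
        (((x : ℂ) + 1 / 2 - Complex.I * y) * (Real.cosh (Real.pi * y) : ℂ))) atTop
      (nhds (∫ y : ℝ, f (Complex.I * y) /
        (((x : ℂ) + 1 / 2 - Complex.I * y) * (Real.cosh (Real.pi * y) : ℂ)))) := by
    simp only [mul_div_assoc]
    refine tendsto_integral_of_dominated_convergence _
      (fun k => (hIc k).aestronglyMeasurable.mul hfi.aestronglyMeasurable) hfi.norm
      (fun k => Eventually.of_forall fun y => ?_) (Eventually.of_forall fun y => ?_)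
    · rw [norm_mul]
      exact mul_le_of_le_one_left (norm_nonneg _) (hI k y)
    · simpa using (hElim (Complex.I * y)).mul_const (f (Complex.I * y) /
        (((x : ℂ) + 1 / 2 - Complex.I * y) * (Real.cosh (Real.pi * y) : ℂ)))
  exact tendsto_nhds_unique hl ((hr1.sub (hr2.const_mul _)).congr fun k => (hformula k).symm)

/-! ### The expansion and the conclusion -/

theorem hasSum_coeff_smul_psi {u : ℝ → ℂ} (hu : MemLp u 2 (volume : Measure ℝ)) {c : ℕ → ℂ}
    (hc : ∀ n, inner ℂ ((memLp_psi n).toLp (psi n)) (hu.toLp u) = c n) :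
    HasSum (fun n : ℕ => c n • (memLp_psi n).toLp (psi n)) (hu.toLp u) := by
  have := (HilbertBasis.mk orthonormal_psi topologicalClosure_span_psi.ge).hasSum_repr (hu.toLp u)
  simpa only [HilbertBasis.repr_apply_apply, HilbertBasis.coe_mk, hc] using this

theorem theorem1 (f : ℂ → ℂ)
    (hhol : DifferentiableOn ℂ f {z : ℂ | 0 < z.re})
    (hcont : ContinuousOn f {z : ℂ | 0 ≤ z.re})
    (horder : HasOrderAtMostOne f)
    (b : ℝ) (hb : b < Real.pi) (hCarlson : CarlsonBound f b)
    (hL2 : MemLp (fun y : ℝ => f (Complex.I * (y : ℂ))) 2 volume)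
    (hsum : Summable (fun N : ℕ => ‖sample f (N + 1)‖ / ((N : ℝ) + 1))) :
    -- the series defining the coefficients converge
    (∀ n : ℕ, Summable (coeffTerm f n)) ∧
    ∃ hψ : ∀ n : ℕ, MemLp (psi n) 2 (volume : Measure ℝ),
      -- the functions `ψ_n` form an orthonormal basis of `L²(ℝ)`
      Orthonormal ℂ (fun n : ℕ => (hψ n).toLp (psi n)) ∧
      (Submodule.span ℂ (Set.range (fun n : ℕ => (hψ n).toLp (psi n)))).topologicalClosure = ⊤ ∧
      -- `f(iy) = ∑ c_n ψ_n(y)`, with convergence in `L²`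
      HasSum (fun n : ℕ => coeff f n • (hψ n).toLp (psi n)) (hL2.toLp _) ∧
      -- the interpolation formula, whose series and integral converge
      ∀ x : ℝ, -(1 / 2) < x →
        Summable (fun N : ℕ => sample f N * (sincPi (x - N) : ℂ)) ∧
        Integrable (fun y : ℝ =>
          (∑' n : ℕ, coeff f n • (hψ n).toLp (psi n) : Lp ℂ 2 (volume : Measure ℝ)) y /
            (((x : ℂ) + 1 / 2 - Complex.I * (y : ℂ)) * (Real.cosh (Real.pi * y) : ℂ))) volume ∧
        f ((x : ℂ) + 1 / 2) =
          (∑' N : ℕ, sample f N * (sincPi (x - N) : ℂ)) -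
          (Real.sin (Real.pi * x) : ℂ) / (2 * (Real.pi : ℂ)) *
            ∫ y : ℝ,
              (∑' n : ℕ, coeff f n • (hψ n).toLp (psi n) : Lp ℂ 2 (volume : Measure ℝ)) y /
                (((x : ℂ) + 1 / 2 - Complex.I * (y : ℂ)) * (Real.cosh (Real.pi * y) : ℂ)) := by

  -- in the direction `θ = 0` Carlson's bound reads `h_f(0) ≤ 0`, whatever `b` is
  have hind : indicator f 0 ≤ 0 := by
    have := hCarlson 0 ⟨by linarith [Real.pi_pos], by linarith [Real.pi_pos]⟩
    simpa using this
  have hexp := exists_norm_le_exp_rpow_of_order hcont horder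
  have hL2' := (memLp_two_iff_integrable_sq_norm hL2.1).1 hL2
  have hre : ∀ ε : ℝ, 0 < ε → ∃ C : ℝ, ∀ x : ℝ, 0 ≤ x → ‖f x‖ ≤ C * Real.exp (ε * x) :=
    fun ε hε => exists_norm_le_exp_of_indicator hcont hind hε
  have hgrow : ∀ ε : ℝ, 0 < ε → ∃ C : ℝ, 0 ≤ C ∧
      ∀ z : ℂ, 1 ≤ z.re → ‖f z‖ ≤ C * (1 + ‖z‖) * Real.exp (ε * z.re) :=
    fun ε hε => exists_norm_le_of_one_le_re hhol hcont hexp hL2' hε (hre ε hε)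
  have hS := hasSum_coeff_smul_psi hL2
    (inner_psi_eq_coeff hhol hcont hexp hL2 (hre 1 one_pos) (hgrow 1 one_pos))
  obtain ⟨C, hC⟩ := hre 1 one_pos
  refine ⟨summable_coeffTerm hC, memLp_psi, orthonormal_psi, topologicalClosure_span_psi, hS,
    fun x hx => ?_⟩
  have hw : 0 < x + 1 / 2 := by linarith
  have hs := summable_sample_mul_sincPi hsum x
  have hfi := integrable_interpolation_kernel hL2 hw
  push_cast at hfi
  -- under the integral, the `L²` sum of the expansion is replaced by its representative `f (i y)`
  have hae : (fun y : ℝ => f (Complex.I * y) /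
      (((x : ℂ) + 1 / 2 - Complex.I * (y : ℂ)) * (Real.cosh (Real.pi * y) : ℂ))) =ᵐ[volume]
      fun y : ℝ => (hL2.toLp _ : Lp ℂ 2 (volume : Measure ℝ)) y /
        (((x : ℂ) + 1 / 2 - Complex.I * (y : ℂ)) * (Real.cosh (Real.pi * y) : ℂ)) := by
    filter_upwards [hL2.coeFn_toLp] with y hy
    rw [hy]
  rw [hS.tsum_eq]
  refine ⟨hs, ?_, ?_⟩
  · refine Integrable.congr ?_ hae
    simpa using hfi
  · rw [← integral_congr_ae hae]
    exact interpolation hhol hcont hexp hL2 hgrow hx hs
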